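/- All vector spaces are over $\mathbb{C}$; $x$ is a formal variable and $z, z_i$ are complex variables. For a graded space $W=\coprod_m W_{[m]}$, let $W'=\coprod_m W_{[m]}^*$ be the graded dual. For a linear map $Y: X\otimes Z\to W[[x,x^{-1}]]$ write $Y(a,x)b=\sum_{n\in\mathbb{Z}}Y_n(a)b\,x^{-n-1}$. An expression such as $\langle w', Y(u_1,z_1)\cdots Y(u_n,z_n)w\rangle$ denotes the multiple series over all indices $k_1,\dots,k_n\in\mathbb{Z}$ with terms $\langle w', Y_{k_1}(u_1)\cdots Y_{k_n}(u_n)w\rangle z_1^{-k_1-1}\cdots z_n^{-k_n-1}$; similarly $\langle w', Y(Y(u_1,z_1-z_2)u_2,z_2)w\rangle$ denotes the double series in powers of $z_1-z_2$ and $z_2$. We say that a product (iterate) series is *rational* if it converges absolutely when $|z_1|>\cdots>|z_n|>0$ (resp. $|z_2|>|z_1-z_2|>0$) to a rational function whose only possible poles are at $z_i=0$ and $z_i=z_j$ $(i\neq j)$. **MOSVA.** A meromorphic open-string vertex algebra (MOSVA) is a $\mathbb{Z}$-graded space $V=\coprod_{n\in\mathbb{Z}}V_{(n)}$ with a linear map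 $Y_V:V\otimes V\to V[[x,x^{-1}]]$ and a vector $\mathbf 1\in V$ such that, with $\mathbf d_Vv=nv$ for $v\in V_{(n)}$ and $D_Vv=\lim_{x\to0}\frac{d}{dx}Y_V(v,x)\mathbf 1$: (1) $V_{(n)}=0$ for $n$ sufficiently negative, and $[\mathbf d_V,Y_V(v,x)]=x\frac{d}{dx}Y_V(v,x)+Y_V(\mathbf d_Vv,x)$; (2) $Y_V(\mathbf 1,x)=1_V$, $Y_V(u,x)\mathbf 1\in V[[x]]$ and $\lim_{x\to0}Y_V(u,x)\mathbf 1=u$; (3) $\frac{d}{dx}Y_V(v,x)=Y_V(D_Vv,x)=[D_V,Y_V(v,x)]$; (4) for all $v'\in V'$ and $u_i,v\in V$ the products $\langle v',Y_V(u_1,z_1)\cdots Y_V(u_n,z_n)v\rangle$ (any $n$) and the iterates $\langle v',Y_V(Y_V(u_1,z_1-z_2)u_2,z_2)v\rangle$ are rational; (5) $\langle v',Y_V(u_1,z_1)Y_V(u_2,z_2)v\rangle=\langle v',Y_V(Y_V(u_1,z_1-z_2)u_2,z_2)v\rangle$ when $|z_1|>|z_2|>|z_1-z_2|>0$. **Modules.**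 Let $V$ be a MOSVA and let $W=\coprod_{m\in\mathbb{C}}W_{[m]}$ be a $\mathbb{C}$-graded space with linear operators $\mathbf d_W,D_W$ on $W$ such that $W_{[m]}=0$ for $\mathrm{Re}(m)$ sufficiently negative, $\mathbf d_Ww=mw$ for $w\in W_{[m]}$, and $D_WW_{[m]}\subseteq W_{[m+1]}$. $(W,Y_W^L,\mathbf d_W,D_W)$ with $Y_W^L:V\otimes W\to W[[x,x^{-1}]]$ linear is a *left $V$-module* if, for $u,u_i\in V$, $w\in W$, $w'\in W'$: $[\mathbf d_W,Y_W^L(u,x)]=Y_W^L(\mathbf d_Vu,x)+x\frac{d}{dx}Y_W^L(u,x)$; $Y_W^L(\mathbf 1,x)=1_W$; $\frac{d}{dx}Y_W^L(u,x)=Y_W^L(D_Vu,x)=[D_W,Y_W^L(u,x)]$; the products $\langle w',Y_W^L(u_1,z_1)\cdots Y_W^L(u_n,z_n)w\rangle$ (any $n$) and the iterates $\langle w',Y_W^L(Y_V(u_1,z_1-z_2)u_2,z_2)w\rangle$ are rational; and $\langle w',Y_W^L(u_1,z_1)Y_W^L(u_2,z_2)w\rangle=\langle w',Y_W^L(Y_V(u_1,z_1-z_2)u_2,z_2)w\rangle$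 when $|z_1|>|z_2|>|z_1-z_2|>0$. $(W,Y_W^R,\mathbf d_W,D_W)$ with $Y_W^R:W\otimes V\to W[[x,x^{-1}]]$ linear is a *right $V$-module* if, for $u_i\in V$, $w\in W$, $w'\in W'$: $\mathbf d_WY_W^R(w,x)-Y_W^R(w,x)\mathbf d_V=Y_W^R(\mathbf d_Ww,x)+x\frac{d}{dx}Y_W^R(w,x)$; $Y_W^R(w,x)\mathbf 1\in W[[x]]$ and $\lim_{x\to0}Y_W^R(w,x)\mathbf 1=w$; $\frac{d}{dx}Y_W^R(w,x)=Y_W^R(D_Ww,x)=D_WY_W^R(w,x)-Y_W^R(w,x)D_V$; the products $\langle w',Y_W^R(w,z_1)Y_V(u_1,z_2)\cdots Y_V(u_{n-1},z_n)u_n\rangle$ (any $n\ge1$) and the iterates $\langle w',Y_W^R(Y_W^R(w,z_1-z_2)u_1,z_2)u_2\rangle$ are rational; and $\langle w',Y_W^R(w,z_1)Y_V(u_1,z_2)u_2\rangle=\langle w',Y_W^R(Y_W^R(w,z_1-z_2)u_1,z_2)u_2\rangle$ when $|z_1|>|z_2|>|z_1-z_2|>0$. **Theorem.** Let $(V,Y_V,\mathbf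 1)$ be a MOSVA. Put $Y_V^s(u,x)v=e^{xD_V}Y_V(v,-x)u$; every coefficient of this series is a finite sum, and $V^{op}=(V,Y_V^s,\mathbf 1)$ (with the same grading) is a MOSVA. Let $W=\coprod_{m\in\mathbb{C}}W_{[m]}$ be a graded space with operators $\mathbf d_W,D_W$. (a) If $(W,Y_W^R,\mathbf d_W,D_W)$ is a right $V$-module, put $Y_W^{s(R)}(v,x)w=e^{xD_W}Y_W^R(w,-x)v$; every coefficient is a finite sum. Then $(W,Y_W^{s(R)},\mathbf d_W,D_W)$ is a left $V^{op}$-module. (b) Conversely, if $(W,Y_W^{s(R)},\mathbf d_W,D_W)$ is a left $V^{op}$-module, put $Y_W^R(w,x)v=e^{xD_W}Y_W^{s(R)}(v,-x)w$; every coefficient is a finite sum. Then $(W,Y_W^R,\mathbf d_W,D_W)$ is a right $V$-module. (c) The constructions in (a) and (b) are inverse to each other, so right $V$-modules and left $V^{op}$-modules are equivalent. -/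

import Mathlib

/-! Formal series `W[[x, x⁻¹]]` are functions `ℤ → W`: `s n` is the coefficient of `x ^ n`.
A vertex operator map `X ⊗ Z → W[[x, x⁻¹]]` is a map `Y : X → Z → ℤ → W` that is bilinear;
`Y a b n` is the coefficient of `x ^ n` in `Y(a, x)b`. -/

noncomputable section

/-- `Y` is linear in each of its two arguments, i.e. a linear map `X ⊗ Z → W[[x, x⁻¹]]`. -/
structure IsVertexMap {X Z W : Type*} [AddCommGroup X] [Module ℂ X] [AddCommGroup Z] [Module ℂ Z]
    [AddCommGroup W] [Module ℂ W] (Y : X → Z → ℤ → W) : Prop where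
  linear_left : ∀ b, IsLinearMap ℂ (fun a => Y a b)
  linear_right : ∀ a, IsLinearMap ℂ (fun b => Y a b)

/-- The isomorphism `⊕ᵢ 𝒱 i ≃ V` of an internal grading. -/
def gradingEquiv {ι V : Type*} [DecidableEq ι] [AddCommGroup V] [Module ℂ V]
    (𝒱 : ι → Submodule ℂ V) (h : DirectSum.IsInternal 𝒱) : (DirectSum ι fun i => 𝒱 i) ≃ₗ[ℂ] V :=
  LinearEquiv.ofBijective (DirectSum.coeLinearMap 𝒱) ⟨h.1, h.2⟩

/-- For a graded space `V = ∐ᵢ 𝒱 i`, the operator acting on `𝒱 i` as multiplication by `wt i`. -/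
def weightOp {ι V : Type*} [DecidableEq ι] [AddCommGroup V] [Module ℂ V] (wt : ι → ℂ)
    (𝒱 : ι → Submodule ℂ V) (h : DirectSum.IsInternal 𝒱) : Module.End ℂ V :=
  DirectSum.toModule ℂ ι V (fun i => wt i • (𝒱 i).subtype) ∘ₗ
    (gradingEquiv 𝒱 h).symm.toLinearMap

theorem weightOp_apply_of_mem {ι V : Type*} [DecidableEq ι] [AddCommGroup V] [Module ℂ V]
    (wt : ι → ℂ) (𝒱 : ι → Submodule ℂ V) (h : DirectSum.IsInternal 𝒱) {i : ι} {v : V}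
    (hv : v ∈ 𝒱 i) : weightOp wt 𝒱 h v = wt i • v := by
  have key : (gradingEquiv 𝒱 h).symm v
      = DirectSum.lof ℂ ι (fun i => 𝒱 i) i ⟨v, hv⟩ := by
    rw [LinearEquiv.symm_apply_eq]
    exact (DirectSum.coeLinearMap_lof 𝒱 i ⟨v, hv⟩).symm
  simp [weightOp, key, DirectSum.toModule_lof]

/-- The graded dual `∐ᵢ (𝒲 i)*` of `W = ∐ᵢ 𝒲 i`, realized inside `W*` as the functionals that
vanish on all but finitely many homogeneous components. -/
def gradedDual {ι W : Type*} [AddCommGroup W] [Module ℂ W] (𝒲 : ι → Submodule ℂ W) :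
    Submodule ℂ (Module.Dual ℂ W) where
  carrier := {φ | {i | ∃ w ∈ 𝒲 i, φ w ≠ 0}.Finite}
  zero_mem' := by simp
  add_mem' := by
    intro φ ψ hφ hψ
    refine (hφ.union hψ).subset ?_
    rintro i ⟨w, hw, hne⟩
    by_cases h : φ w = 0
    · exact Or.inr ⟨w, hw, fun h' => hne (by simp [h, h'])⟩
    · exact Or.inl ⟨w, hw, h⟩
  smul_mem' := by
    intro c φ hφ
    refine hφ.subset ?_
    rintro i ⟨w, hw, hne⟩
    exact ⟨w, hw, fun h => hne (by simp [h])⟩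

/-! ### Convergence to rational functions -/

/-- The term of index `k` of the Laurent series `∑ₖ a k ζ₁^k₁ ⋯ ζₙ^kₙ` at the point `ζ`. -/
def laurentTerm {n : ℕ} (a : (Fin n → ℤ) → ℂ) (ζ : Fin n → ℂ) (k : Fin n → ℤ) : ℂ :=
  a k * ∏ i, ζ i ^ k i

/-- `f` is a rational function of `z₁, …, zₙ` whose only possible poles are at
`zᵢ = 0` and at `zᵢ = zⱼ` for `i ≠ j`. -/
def IsRationalWithPoles {n : ℕ} (f : (Fin n → ℂ) → ℂ) : Prop :=
  ∃ (g : MvPolynomial (Fin n) ℂ) (p : Fin n → ℕ) (q : Fin n → Fin n → ℕ), ∀ z,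
    f z = MvPolynomial.eval z g /
      ((∏ i, z i ^ p i) * ∏ i, ∏ j ∈ Finset.Ioi i, (z i - z j) ^ q i j)

/-- The region `|z₁| > ⋯ > |zₙ| > 0`. -/
def productRegion (n : ℕ) : Set (Fin n → ℂ) :=
  {z | (∀ i j, i < j → ‖z j‖ < ‖z i‖) ∧ ∀ i, 0 < ‖z i‖}

/-- `∑ₖ a k z₁^k₁ ⋯ zₙ^kₙ` converges absolutely when `|z₁| > ⋯ > |zₙ| > 0` to a rational function
with the only possible poles at `zᵢ = 0` and `zᵢ = zⱼ`. -/
def ProductRational {n : ℕ} (a : (Fin n → ℤ) → ℂ) : Prop :=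
  ∃ f : (Fin n → ℂ) → ℂ, IsRationalWithPoles f ∧ ∀ z ∈ productRegion n,
    Summable (fun k => ‖laurentTerm a z k‖) ∧ ∑' k, laurentTerm a z k = f z

/-- `∑ₖ a k (z₁ - z₂)^k₁ z₂^k₂` converges absolutely when `|z₂| > |z₁ - z₂| > 0` to a rational
function with the only possible poles at `z₁ = 0`, `z₂ = 0` and `z₁ = z₂`. -/
def IterateRational (a : (Fin 2 → ℤ) → ℂ) : Prop :=
  ∃ f : (Fin 2 → ℂ) → ℂ, IsRationalWithPoles f ∧ ∀ z₁ z₂ : ℂ,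
    ‖z₁ - z₂‖ < ‖z₂‖ → 0 < ‖z₁ - z₂‖ →
      Summable (fun k => ‖laurentTerm a ![z₁ - z₂, z₂] k‖) ∧
        ∑' k, laurentTerm a ![z₁ - z₂, z₂] k = f ![z₁, z₂]

/-- `∑ₖ a k z₁^k₁ z₂^k₂` and `∑ₖ b k (z₁ - z₂)^k₁ z₂^k₂` have the same sum
when `|z₁| > |z₂| > |z₁ - z₂| > 0`. -/
def AssociativityHolds (a b : (Fin 2 → ℤ) → ℂ) : Prop :=
  ∀ z₁ z₂ : ℂ, ‖z₂‖ < ‖z₁‖ → ‖z₁ - z₂‖ < ‖z₂‖ → 0 < ‖z₁ - z₂‖ →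
    ∑' k, laurentTerm a ![z₁, z₂] k = ∑' k, laurentTerm b ![z₁ - z₂, z₂] k

/-- The coefficient of `x₁^k₁ ⋯ xₙ^kₙ` in `Y(u₁, x₁) ⋯ Y(uₙ, xₙ)w`. -/
def prodCoeff {V W : Type*} (Y : V → W → ℤ → W) :
    (n : ℕ) → (Fin n → V) → W → (Fin n → ℤ) → W
  | 0, _, w, _ => w
  | n + 1, u, w, k => Y (u 0) (prodCoeff Y n (Fin.tail u) w (Fin.tail k)) (k 0)

/-! ### The skew-symmetry construction -/

/-- The contributions `(1 / i!) Dⁱ (-1)^(n - i) Y(a)_{n - i} b`, `i = 0, 1, …`, to the coefficient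
of `x ^ n` in `e^{xD} Y(a, -x)b`. -/
def skewTerm {X Z W : Type*} [AddCommGroup W] [Module ℂ W] (D : W → W) (Y : X → Z → ℤ → W)
    (a : X) (b : Z) (n : ℤ) (i : ℕ) : W :=
  ((i.factorial : ℂ)⁻¹ * (-1 : ℂ) ^ (n - (i : ℤ))) • (D^[i]) (Y a b (n - (i : ℤ)))

/-- Every coefficient of `e^{xD} Y(a, -x)b` is a finite sum. -/
def SkewDefined {X Z W : Type*} [AddCommGroup W] [Module ℂ W] (D : W → W)
    (Y : X → Z → ℤ → W) : Prop :=
  ∀ a b n, (Function.support (skewTerm D Y a b n)).Finite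

/-- The skew-symmetry opposite `Yˢ(b, x)a = e^{xD} Y(a, -x)b`. -/
def skew {X Z W : Type*} [AddCommGroup W] [Module ℂ W] (D : W → W) (Y : X → Z → ℤ → W) :
    Z → X → ℤ → W :=
  fun b a n => ∑ᶠ i : ℕ, skewTerm D Y a b n i

/-! ### Meromorphic open-string vertex algebras -/

/-- A `ℤ`-graded vector space with a vertex operator map and a vacuum; no axiom yet. -/
structure VertexData (V : Type*) [AddCommGroup V] [Module ℂ V] where
  grade : ℤ → Submodule ℂ V
  internal : DirectSum.IsInternal grade
  Y : V → V → ℤ → V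
  vac : V

namespace VertexData

variable {V : Type*} [AddCommGroup V] [Module ℂ V]

/-- The grading operator: `d v = n v` for `v` of weight `n`. -/
def d (A : VertexData V) : Module.End ℂ V :=
  weightOp (fun n : ℤ => (n : ℂ)) A.grade A.internal

/-- `D v = lim_{x → 0} (d/dx) Y(v, x)𝟏`, the coefficient of `x` in `Y(v, x)𝟏`. -/
def D (A : VertexData V) (v : V) : V := A.Y v A.vac 1

/-- The opposite: same grading and vacuum, `Yˢ(u, x)v = e^{xD} Y(v, -x)u`. -/
def op (A : VertexData V) : VertexData V where
  grade := A.grade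
  internal := A.internal
  Y := skew A.D A.Y
  vac := A.vac

end VertexData

/-- The axioms of a meromorphic open-string vertex algebra. -/
structure IsMOSVA {V : Type*} [AddCommGroup V] [Module ℂ V] (A : VertexData V) : Prop where
  vertexMap : IsVertexMap A.Y
  lower_bound : ∃ N : ℤ, ∀ n < N, A.grade n = ⊥
  d_commutator : ∀ u v n,
    A.d (A.Y u v n) - A.Y u (A.d v) n = (n : ℂ) • A.Y u v n + A.Y (A.d u) v n
  identity : ∀ v n, A.Y A.vac v n = if n = 0 then v else 0
  creation_regular : ∀ u, ∀ n < 0, A.Y u A.vac n = 0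
  creation : ∀ u, A.Y u A.vac 0 = u
  D_derivative : ∀ u v (n : ℤ), ((n : ℂ) + 1) • A.Y u v (n + 1) = A.Y (A.D u) v n
  D_commutator : ∀ u v (n : ℤ),
    ((n : ℂ) + 1) • A.Y u v (n + 1) = A.D (A.Y u v n) - A.Y u (A.D v) n
  product_rational : ∀ (n : ℕ) (u : Fin n → V) (v : V), ∀ φ ∈ gradedDual A.grade,
    ProductRational (fun k => φ (prodCoeff A.Y n u v k))
  iterate_rational : ∀ u₁ u₂ v : V, ∀ φ ∈ gradedDual A.grade,
    IterateRational (fun k => φ (A.Y (A.Y u₁ u₂ (k 0)) v (k 1)))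
  associativity : ∀ u₁ u₂ v : V, ∀ φ ∈ gradedDual A.grade,
    AssociativityHolds (fun k => φ (A.Y u₁ (A.Y u₂ v (k 1)) (k 0)))
      (fun k => φ (A.Y (A.Y u₁ u₂ (k 0)) v (k 1)))

/-- `(W, Y, d, D)`, with the grading `W = ∐ₘ 𝒲 m`, is a left module for `A`. -/
structure IsLeftModule {V W : Type*} [AddCommGroup V] [Module ℂ V] [AddCommGroup W] [Module ℂ W]
    (A : VertexData V) (𝒲 : ℂ → Submodule ℂ W) (Y : V → W → ℤ → W)
    (d D : Module.End ℂ W) : Prop where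
  internal : DirectSum.IsInternal 𝒲
  vertexMap : IsVertexMap Y
  D_weight_one : ∀ m, ∀ w ∈ 𝒲 m, D w ∈ 𝒲 (m + 1)
  lower_bound : ∃ r : ℝ, ∀ m : ℂ, m.re < r → 𝒲 m = ⊥
  d_grading : ∀ m, ∀ w ∈ 𝒲 m, d w = m • w
  d_commutator : ∀ u w n,
    d (Y u w n) - Y u (d w) n = Y (A.d u) w n + (n : ℂ) • Y u w n
  identity : ∀ w n, Y A.vac w n = if n = 0 then w else 0
  D_derivative : ∀ u w (n : ℤ), ((n : ℂ) + 1) • Y u w (n + 1) = Y (A.D u) w n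
  D_commutator : ∀ u w (n : ℤ),
    ((n : ℂ) + 1) • Y u w (n + 1) = D (Y u w n) - Y u (D w) n
  product_rational : ∀ (n : ℕ) (u : Fin n → V) (w : W), ∀ φ ∈ gradedDual 𝒲,
    ProductRational (fun k => φ (prodCoeff Y n u w k))
  iterate_rational : ∀ (u₁ u₂ : V) (w : W), ∀ φ ∈ gradedDual 𝒲,
    IterateRational (fun k => φ (Y (A.Y u₁ u₂ (k 0)) w (k 1)))
  associativity : ∀ (u₁ u₂ : V) (w : W), ∀ φ ∈ gradedDual 𝒲,
    AssociativityHolds (fun k => φ (Y u₁ (Y u₂ w (k 1)) (k 0)))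
      (fun k => φ (Y (A.Y u₁ u₂ (k 0)) w (k 1)))

/-- `(W, Y, d, D)`, with the grading `W = ∐ₘ 𝒲 m`, is a right module for `A`. In
`product_rational` the series is `⟨w', Y(w, z₁)Y_V(u₁, z₂) ⋯ Y_V(uₙ, zₙ₊₁)v⟩`. -/
structure IsRightModule {V W : Type*} [AddCommGroup V] [Module ℂ V] [AddCommGroup W] [Module ℂ W]
    (A : VertexData V) (𝒲 : ℂ → Submodule ℂ W) (Y : W → V → ℤ → W)
    (d D : Module.End ℂ W) : Prop where
  internal : DirectSum.IsInternal 𝒲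
  vertexMap : IsVertexMap Y
  D_weight_one : ∀ m, ∀ w ∈ 𝒲 m, D w ∈ 𝒲 (m + 1)
  lower_bound : ∃ r : ℝ, ∀ m : ℂ, m.re < r → 𝒲 m = ⊥
  d_grading : ∀ m, ∀ w ∈ 𝒲 m, d w = m • w
  d_commutator : ∀ w u n,
    d (Y w u n) - Y w (A.d u) n = Y (d w) u n + (n : ℂ) • Y w u n
  creation_regular : ∀ w, ∀ n < 0, Y w A.vac n = 0
  creation : ∀ w, Y w A.vac 0 = w
  D_derivative : ∀ w u (n : ℤ), ((n : ℂ) + 1) • Y w u (n + 1) = Y (D w) u n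
  D_commutator : ∀ w u (n : ℤ),
    ((n : ℂ) + 1) • Y w u (n + 1) = D (Y w u n) - Y w (A.D u) n
  product_rational : ∀ (n : ℕ) (w : W) (u : Fin n → V) (v : V), ∀ φ ∈ gradedDual 𝒲,
    ProductRational (n := n + 1)
      (fun k => φ (Y w (prodCoeff A.Y n u v (Fin.tail k)) (k 0)))
  iterate_rational : ∀ (w : W) (u₁ u₂ : V), ∀ φ ∈ gradedDual 𝒲,
    IterateRational (fun k => φ (Y (Y w u₁ (k 0)) u₂ (k 1)))
  associativity : ∀ (w : W) (u₁ u₂ : V), ∀ φ ∈ gradedDual 𝒲,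
    AssociativityHolds (fun k => φ (Y w (A.Y u₁ u₂ (k 1)) (k 0)))
      (fun k => φ (Y (Y w u₁ (k 0)) u₂ (k 1)))

end

/-! A product of opposite operators is, up to one exponential, a nested expression in the original
ones: Yˢ(u₀,x₀)⋯Yˢ(uₘ,xₘ)v = e^{x₀D} Y(Yˢ(u₁,x₁)⋯Yˢ(uₘ,xₘ)v, -x₀)u₀. Since Y(Yˢ(u,y)v,z)w =
Y(Y(v,-y)u,z+y)w, associativity makes this last series an expansion of the same rational function as
Y(v,z)Y(u,z+y)w. Repeating this step unwinds the nesting into the single product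
Y(v,-x₀)Y(uₘ,xₘ-x₀)⋯Y(u₁,x₁-x₀)u₀, which is rational by hypothesis
(`IsRationalField.act_nestCoeff`). Likewise Yˢ(Yˢ(u₁,y)u₂,z)v unfolds to
e^{(z+y)D}Y(v,-z-y)Y(u₂,-y)u₁. With y = x₀-x₁ and z = x₁ this is the function found for the product,
so rationality of iterates and associativity come together (`exists_skew_duality`). Under a graded
functional the exponential is a finite sum, because D raises weights and weights are bounded below.

Associativity concerns two operators only, so the unwinding is formal rather than analytic. A series
a that converges to g/P on a torus satisfies P·a = g·1 in the module of formal series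
(`act_eq_of_hasLaurentSum_div`, by uniqueness of Fourier coefficients). A two-operator identity is
available for each slice obtained by fixing the remaining exponents, with a denominator depending on
the slice. Denominators act injectively on series with suitable support, so `act_transfer` assembles
the slices into one identity, with the denominator of the full product. The way back to convergence
is a geometric series estimate (`hasLaurentSum_div`).

Modules need no second argument. A right module gives the operator map (v,w)·(v',w') ↦ (Y(v)v',
Y^R(w)v') on V × W, a left module gives (Y(v)v', Y^L(v)w'), and skew-symmetry exchanges the two
types. Tested on functionals of W, both satisfy `IsRationalField`, which mentions neither vacuum nor
grading. The other axioms are formal: skew-symmetry is an involution since e^{xD}e^{-xD} = 1, it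
interchanges the two D-axioms, and it interchanges the identity and creation properties. -/

/-! ### Formal Laurent series as modules over polynomial rings -/

open MvPolynomial in
/-- Formal Laurent series in the variables `σ`, as coefficient functions, form a module over the
polynomials in these variables; `X i` shifts the exponent of the `i`-th variable. -/
noncomputable def act {σ : Type} : MvPolynomial σ ℂ →ₐ[ℂ] Module.End ℂ ((σ → ℤ) → ℂ) :=
  AddMonoidAlgebra.lift ℂ (Module.End ℂ ((σ → ℤ) → ℂ)) (σ →₀ ℕ)
    { toFun := fun m => LinearMap.funLeft ℂ ℂ fun k i => k i - (m.toAdd i : ℤ)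
      map_one' := by
        ext a k
        simp [LinearMap.funLeft]
      map_mul' := fun m m' => by
        ext a k
        simp only [LinearMap.funLeft, toAdd_mul, Finsupp.coe_add, Pi.add_apply, Nat.cast_add,
          LinearMap.coe_mk, AddHom.coe_mk, Function.comp_apply, Module.End.mul_apply]
        congr 1
        ext i
        ring }

/-- The Laurent series `1`. -/
noncomputable def unitSeries (σ : Type) : (σ → ℤ) → ℂ := by
  classical exact Pi.single 0 1

section act

open MvPolynomial

variable {σ ρ : Type}

theorem act_monomial (m : σ →₀ ℕ) (c : ℂ) (a : (σ → ℤ) → ℂ) (k : σ → ℤ) :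
    act (monomial m c) a k = c * a (fun i => k i - (m i : ℤ)) := by
  have : act (monomial m c) = c • (LinearMap.funLeft ℂ ℂ fun (k : σ → ℤ) i => k i - (m i : ℤ)) := by
    exact AddMonoidAlgebra.lift_single _ _ _
  rw [this]
  rfl

theorem act_C (c : ℂ) (a : (σ → ℤ) → ℂ) : act (C c) a = c • a := by
  ext k
  rw [C_apply, act_monomial]
  simp

theorem act_X [DecidableEq σ] (i : σ) (a : (σ → ℤ) → ℂ) (k : σ → ℤ) :
    act (X i) a k = a (k - Pi.single i 1) := by
  rw [X, act_monomial, one_mul]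
  congr 1
  ext j
  by_cases h : j = i
  · subst h; simp
  · simp [h]

theorem act_mul_apply (P Q : MvPolynomial σ ℂ) (a : (σ → ℤ) → ℂ) :
    act (P * Q) a = act P (act Q a) := by
  rw [map_mul]; rfl

theorem act_comm (P Q : MvPolynomial σ ℂ) (a : (σ → ℤ) → ℂ) :
    act P (act Q a) = act Q (act P a) := by
  rw [← act_mul_apply, mul_comm, act_mul_apply]

theorem act_add_apply (P Q : MvPolynomial σ ℂ) (a : (σ → ℤ) → ℂ) :
    act (P + Q) a = act P a + act Q a := by
  rw [map_add]; rfl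

theorem act_one (a : (σ → ℤ) → ℂ) : act 1 a = a := by
  rw [map_one]; rfl

theorem unitSeries_apply (k : σ → ℤ) [Decidable (k = 0)] :
    unitSeries σ k = if k = 0 then 1 else 0 := by
  classical
  rw [unitSeries, Pi.single_apply]
  congr

theorem act_unitSeries_natCast (P : MvPolynomial σ ℂ) (m : σ →₀ ℕ) :
    act P (unitSeries σ) (fun i => (m i : ℤ)) = coeff m P := by
  induction P using MvPolynomial.induction_on' with
  | monomial u c =>
    classical
    rw [act_monomial, coeff_monomial, unitSeries_apply]
    have : (fun i => (m i : ℤ) - (u i : ℤ)) = 0 ↔ u = m := by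
      constructor
      · intro h
        ext i
        have := congrFun h i
        simp only [Pi.zero_apply] at this
        omega
      · rintro rfl
        ext i
        simp
    simp [this]
  | add p q hp hq => rw [act_add_apply, Pi.add_apply, hp, hq, coeff_add]

/-- Polynomials embed into formal series, so a series identity with right-hand side g·1 determines
the numerator g. -/
theorem eq_zero_of_act_unitSeries {P : MvPolynomial σ ℂ}
    (h : act P (unitSeries σ) = 0) : P = 0 := by
  ext m
  rw [← act_unitSeries_natCast, h]
  simp

/-- Subspaces of series that are stable under multiplication by polynomials. -/
def ActStable (M : Submodule ℂ ((σ → ℤ) → ℂ)) : Prop := ∀ a ∈ M, ∀ i, act (X i) a ∈ M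

theorem ActStable.act_mem {M : Submodule ℂ ((σ → ℤ) → ℂ)} (hM : ActStable M)
    (P : MvPolynomial σ ℂ) {a : (σ → ℤ) → ℂ} (ha : a ∈ M) : act P a ∈ M := by
  induction P using MvPolynomial.induction_on generalizing a with
  | C c => rw [act_C]; exact M.smul_mem c ha
  | add p q hp hq => rw [act_add_apply]; exact M.add_mem (hp ha) (hq ha)
  | mul_X p i hp => rw [act_mul_apply]; exact hp (hM a ha i)

/-- A linear map on a stable subspace that intertwines the actions of the variables along `τ`
intertwines the actions of all polynomials. -/
theorem act_intertwine (τ : MvPolynomial σ ℂ →ₐ[ℂ] MvPolynomial ρ ℂ)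
    {M : Submodule ℂ ((σ → ℤ) → ℂ)} (hM : ActStable M)
    (L : ((σ → ℤ) → ℂ) → ((ρ → ℤ) → ℂ)) (hadd : ∀ a ∈ M, ∀ b ∈ M, L (a + b) = L a + L b)
    (hsmul : ∀ (c : ℂ), ∀ a ∈ M, L (c • a) = c • L a)
    (hX : ∀ i, ∀ a ∈ M, L (act (X i) a) = act (τ (X i)) (L a))
    (P : MvPolynomial σ ℂ) {a : (σ → ℤ) → ℂ} (ha : a ∈ M) : L (act P a) = act (τ P) (L a) := by
  induction P using MvPolynomial.induction_on generalizing a with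
  | C c => rw [act_C, hsmul c a ha, ← algebraMap_eq, AlgHom.commutes, algebraMap_eq, act_C]
  | add p q hp hq =>
    rw [act_add_apply, hadd _ (hM.act_mem p ha) _ (hM.act_mem q ha), hp ha, hq ha, map_add,
      act_add_apply]
  | mul_X p i hp => rw [act_mul_apply, hp (hM a ha i), hX i a ha, map_mul, act_mul_apply]

/-- `P` acts injectively on `M`. -/
def ActRegular (M : Submodule ℂ ((σ → ℤ) → ℂ)) (P : MvPolynomial σ ℂ) : Prop :=
  ∀ a ∈ M, act P a = 0 → a = 0

theorem ActRegular.mul {M : Submodule ℂ ((σ → ℤ) → ℂ)} (hM : ActStable M)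
    {P Q : MvPolynomial σ ℂ} (hP : ActRegular M P) (hQ : ActRegular M Q) :
    ActRegular M (P * Q) := fun a ha h =>
  hQ a ha (hP _ (hM.act_mem Q ha) (by rwa [act_mul_apply] at h))

/-- Two series, in possibly different variables, are expansions of one rational function whose
denominator acts injectively on `M`. -/
def SameRational (τ : MvPolynomial σ ℂ →ₐ[ℂ] MvPolynomial ρ ℂ)
    (M : Submodule ℂ ((ρ → ℤ) → ℂ)) (a : (σ → ℤ) → ℂ) (b : (ρ → ℤ) → ℂ) : Prop :=
  b ∈ M ∧ ∃ h g, ActRegular M (τ h) ∧ act h a = act g (unitSeries σ) ∧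
    act (τ h) b = act (τ g) (unitSeries ρ)

namespace SameRational

variable {τ : MvPolynomial σ ℂ →ₐ[ℂ] MvPolynomial ρ ℂ}
  {M : Submodule ℂ ((ρ → ℤ) → ℂ)} {a a' : (σ → ℤ) → ℂ} {b b' : (ρ → ℤ) → ℂ}

theorem smul (c : ℂ) (h : SameRational τ M a b) : SameRational τ M (c • a) (c • b) := by
  obtain ⟨hb, h, g, hr, h1, h2⟩ := h
  refine ⟨M.smul_mem c hb, h, c • g, hr, ?_, ?_⟩
  · rw [map_smul, h1, map_smul]; rfl
  · rw [map_smul, h2, map_smul, map_smul]; rfl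

theorem add (hM : ActStable M) (h : SameRational τ M a b) (h' : SameRational τ M a' b') :
    SameRational τ M (a + a') (b + b') := by
  obtain ⟨hb, h, g, hr, h1, h2⟩ := h
  obtain ⟨hb', h', g', hr', h1', h2'⟩ := h'
  refine ⟨M.add_mem hb hb', h * h', h' * g + h * g', ?_, ?_, ?_⟩
  · rw [map_mul]; exact hr.mul hM hr'
  · rw [map_add, act_add_apply, act_mul_apply, act_mul_apply, act_mul_apply, act_mul_apply, h1',
      act_comm h h', h1]
  · simp only [map_mul, map_add, LinearMap.add_apply, Module.End.mul_apply, h2']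
    rw [act_comm (τ h) (τ h'), h2]

theorem act (hM : ActStable M) (h : SameRational τ M a b) (P : MvPolynomial σ ℂ) :
    SameRational τ M (_root_.act P a) (_root_.act (τ P) b) := by
  obtain ⟨hb, h, g, hr, h1, h2⟩ := h
  refine ⟨hM.act_mem _ hb, h, P * g, hr, ?_, ?_⟩
  · rw [act_comm, h1, act_mul_apply]
  · rw [act_comm, h2, map_mul, act_mul_apply]

/-- The numerator must vanish because `unitSeries` has no annihilator; then the denominator kills
`b`, and regularity concludes. This is what regularity is required for. -/
theorem eq_zero (h : SameRational τ M 0 b) : b = 0 := by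
  obtain ⟨hb, h, g, hr, h1, h2⟩ := h
  rw [map_zero] at h1
  rw [eq_zero_of_act_unitSeries h1.symm] at h2
  refine hr b hb ?_
  rw [h2, map_zero, map_zero]
  rfl

end SameRational

/-- If all slices of `a` and `b` along further variables are expansions of the same rational
functions, and `a` is the expansion of a rational function, then `b` is its expansion too. -/
theorem act_transfer {σ₀ ρ₀ : Type} {K : Type*} (τ : MvPolynomial σ ℂ →ₐ[ℂ] MvPolynomial ρ ℂ)
    (τ₀ : MvPolynomial σ₀ ℂ →ₐ[ℂ] MvPolynomial ρ₀ ℂ)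
    (s : K → ((σ → ℤ) → ℂ) →ₗ[ℂ] ((σ₀ → ℤ) → ℂ)) (t : K → ((ρ → ℤ) → ℂ) →ₗ[ℂ] ((ρ₀ → ℤ) → ℂ))
    (hX : ∀ i, (∃ j, ∀ κ a b, s κ (act (X i) a) = act (X j) (s κ a) ∧
        t κ (act (τ (X i)) b) = act (τ₀ (X j)) (t κ b)) ∨
      ∃ f : K → K, ∀ κ a b, s κ (act (X i) a) = s (f κ) a ∧ t κ (act (τ (X i)) b) = t (f κ) b)
    (hunit : ∀ κ, ∃ r, s κ (unitSeries σ) = act r (unitSeries σ₀) ∧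
      t κ (unitSeries ρ) = act (τ₀ r) (unitSeries ρ₀))
    (hinj : ∀ b, (∀ κ, t κ b = 0) → b = 0)
    {M : Submodule ℂ ((ρ₀ → ℤ) → ℂ)} (hM : ActStable M) (hM1 : unitSeries ρ₀ ∈ M)
    {a : (σ → ℤ) → ℂ} {b : (ρ → ℤ) → ℂ} (hab : ∀ κ, SameRational τ₀ M (s κ a) (t κ b))
    {P g : MvPolynomial σ ℂ} (hP : act P a = act g (unitSeries σ)) :
    act (τ P) b = act (τ g) (unitSeries ρ) := by
  -- The relation is additive and survives each variable, whether it acts inside a slice or moves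
  -- one slice to another. The denominators of different slices are never compared.
  have key : ∀ (P : MvPolynomial σ ℂ) a b, (∀ κ, SameRational τ₀ M (s κ a) (t κ b)) →
      ∀ κ, SameRational τ₀ M (s κ (act P a)) (t κ (act (τ P) b)) := by
    intro P
    induction P using MvPolynomial.induction_on with
    | C c =>
      intro a b h κ
      have : τ (C c) = C c := by rw [← algebraMap_eq, AlgHom.commutes, algebraMap_eq]
      rw [this, act_C, act_C, map_smul, map_smul]
      exact (h κ).smul c
    | add p q hp hq =>
      intro a b h κ
      rw [map_add τ, act_add_apply, act_add_apply, map_add, map_add]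
      exact (hp a b h κ).add hM (hq a b h κ)
    | mul_X p i hp =>
      intro a b h κ
      rw [map_mul τ, act_mul_apply, act_mul_apply]
      refine hp _ _ (fun κ => ?_) κ
      rcases hX i with ⟨j, hj⟩ | ⟨f, hf⟩
      · rw [(hj κ a b).1, (hj κ a b).2]
        exact (h κ).act hM _
      · rw [(hf κ a b).1, (hf κ a b).2]
        exact h _
  have h1 : ∀ κ, SameRational τ₀ M (s κ (unitSeries σ)) (t κ (unitSeries ρ)) := by
    intro κ
    obtain ⟨r, hr, hr'⟩ := hunit κ
    rw [hr, hr']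
    refine SameRational.act hM ⟨hM1, 1, 1, ?_, rfl, ?_⟩ r
    · intro b _ hb
      rwa [map_one, act_one] at hb
    · rw [map_one]
  have h2 := key P a b hab
  have h3 := key g _ _ h1
  -- The slices of the difference correspond to slices of P·a - g·1 = 0.
  refine sub_eq_zero.1 (hinj _ fun κ => SameRational.eq_zero (τ := τ₀) (M := M) ?_)
  have := (h2 κ).add hM ((h3 κ).smul (-1))
  rw [hP, neg_one_smul, neg_one_smul, add_neg_cancel] at this
  rwa [map_sub, sub_eq_add_neg]

/-! ### Supports on which denominators act injectively -/

/-- Series whose coefficients vanish far out in each of the directions `S`. -/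
def boundedAlong (S : Set (σ → ℤ)) : Submodule ℂ ((σ → ℤ) → ℂ) where
  carrier := {a | ∀ v ∈ S, ∀ k, ∃ N : ℕ, ∀ m ≥ N, a (k + m • v) = 0}
  zero_mem' := fun _ _ _ => ⟨0, by simp⟩
  add_mem' := by
    intro a b ha hb v hv k
    obtain ⟨N, hN⟩ := ha v hv k
    obtain ⟨N', hN'⟩ := hb v hv k
    refine ⟨max N N', fun m hm => ?_⟩
    rw [Pi.add_apply, hN m (le_of_max_le_left hm), hN' m (le_of_max_le_right hm), add_zero]
  smul_mem' := by
    intro c a ha v hv k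
    obtain ⟨N, hN⟩ := ha v hv k
    exact ⟨N, fun m hm => by rw [Pi.smul_apply, hN m hm, smul_zero]⟩

theorem actStable_boundedAlong (S : Set (σ → ℤ)) : ActStable (boundedAlong S) := by
  classical
  intro a ha i v hv k
  obtain ⟨N, hN⟩ := ha v hv (k - Pi.single i 1)
  refine ⟨N, fun m hm => ?_⟩
  rw [act_X, ← hN m hm]
  congr 1
  abel

theorem unitSeries_mem_boundedAlong {S : Set (σ → ℤ)} (hS : (0 : σ → ℤ) ∉ S) :
    unitSeries σ ∈ boundedAlong S := by
  intro v hv k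
  have hv0 : ∃ i, v i ≠ 0 := by
    by_contra! h
    exact hS ((funext h : v = 0) ▸ hv)
  obtain ⟨i, hi⟩ := hv0
  -- For such `m`, divisibility of `k i` by `m` forces `k i = 0`, and then `v i = 0`.
  refine ⟨(k i).natAbs + 1, fun m hm => ?_⟩
  classical
  rw [unitSeries_apply, if_neg]
  intro h
  have h1 : k i + m * v i = 0 := by simpa using congrFun h i
  have h2 : (m : ℤ) ∣ k i := ⟨-v i, by linarith⟩
  have h3 : k i = 0 := Int.eq_zero_of_dvd_of_natAbs_lt_natAbs h2 (by simp; omega)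
  rw [h3] at h1
  have : m ≠ 0 := by omega
  simp_all

theorem actRegular_C {M : Submodule ℂ ((σ → ℤ) → ℂ)} {c : ℂ} (hc : c ≠ 0) :
    ActRegular M (C c) := by
  intro a _ h
  rw [act_C] at h
  exact (smul_eq_zero.1 h).resolve_left hc

theorem actRegular_X {M : Submodule ℂ ((σ → ℤ) → ℂ)} (i : σ) :
    ActRegular M (X i) := by
  classical
  intro a _ h
  ext k
  have := congrFun h (k + Pi.single i 1)
  rwa [act_X, add_sub_cancel_right] at this

/-- Annihilation is a recursion: the coefficient at k is a multiple of the one at k + eᵢ - eⱼ, and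
iterating runs into the region where the series vanishes. -/
theorem actRegular_linear [DecidableEq σ] {S : Set (σ → ℤ)} {i j : σ}
    (hS : Pi.single i 1 - Pi.single j 1 ∈ S) (β : ℂ) :
    ActRegular (boundedAlong S) (X i + C β * X j) := by
  intro a ha h
  ext k
  have step : ∀ k, a k = -β * a (k + (Pi.single i 1 - Pi.single j 1)) := by
    intro k
    have := congrFun h (k + Pi.single i 1)
    rw [act_add_apply, act_mul_apply, act_C, Pi.add_apply, Pi.smul_apply, act_X, act_X,
      add_sub_cancel_right, Pi.zero_apply, add_sub_assoc, smul_eq_mul] at this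
    linear_combination this
  have iter : ∀ m : ℕ, a k = (-β) ^ m * a (k + m • (Pi.single i 1 - Pi.single j 1)) := by
    intro m
    induction m with
    | zero => simp
    | succ m ih => rw [ih, step, add_assoc, ← succ_nsmul, pow_succ, mul_assoc]
  obtain ⟨N, hN⟩ := ha _ hS k
  rw [iter N, hN N le_rfl, mul_zero]
  rfl

/-! ### Admissible denominators -/

/-- The polynomials with zeros only at `zᵢ = 0` and `zᵢ = zⱼ`. -/
noncomputable def den (σ : Type) : Submonoid (MvPolynomial σ ℂ) :=
  Submonoid.closure ({P | ∃ c : ℂ, c ≠ 0 ∧ P = C c} ∪ {P | ∃ i, P = X i} ∪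
    {P | ∃ i j, i ≠ j ∧ P = X i - X j})

theorem C_mem_den {c : ℂ} (hc : c ≠ 0) : (C c : MvPolynomial σ ℂ) ∈ den σ :=
  Submonoid.subset_closure (Or.inl (Or.inl ⟨c, hc, rfl⟩))

theorem X_mem_den (i : σ) : (X i : MvPolynomial σ ℂ) ∈ den σ :=
  Submonoid.subset_closure (Or.inl (Or.inr ⟨i, rfl⟩))

theorem X_sub_X_mem_den {i j : σ} (h : i ≠ j) : (X i - X j : MvPolynomial σ ℂ) ∈ den σ :=
  Submonoid.subset_closure (Or.inr ⟨i, j, h, rfl⟩)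

theorem neg_mem_den {P : MvPolynomial σ ℂ} (h : P ∈ den σ) : -P ∈ den σ := by
  have := (den σ).mul_mem (C_mem_den (σ := σ) (c := -1) (by simp)) h
  simpa using this

/-- Ordered differences suffice, since the sign of a reversed one is absorbed into a constant. -/
theorem den_induction [LinearOrder σ] {p : MvPolynomial σ ℂ → Prop}
    (hC : ∀ c : ℂ, c ≠ 0 → p (C c)) (hX : ∀ i, p (X i)) (hsub : ∀ i j, i < j → p (X i - X j))
    (hmul : ∀ P Q, p P → p Q → p (P * Q)) {P : MvPolynomial σ ℂ} (hP : P ∈ den σ) : p P := by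
  induction hP using Submonoid.closure_induction with
  | mem P hP =>
    rcases hP with (⟨c, hc, rfl⟩ | ⟨i, rfl⟩) | ⟨i, j, hij, rfl⟩
    · exact hC c hc
    · exact hX i
    · rcases lt_or_gt_of_ne hij with h | h
      · exact hsub i j h
      · have := hmul _ _ (hC (-1) (by simp)) (hsub j i h)
        simpa using this
  | one => simpa using hC 1 one_ne_zero
  | mul P Q _ _ hP hQ => exact hmul P Q hP hQ

end act

/-! ### Convergence of formal Laurent series -/

section convergence

open MvPolynomial

variable {n : ℕ}

/-- The series `a` converges absolutely at `z`, with sum `s`. -/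
def HasLaurentSum (z : Fin n → ℂ) (a : (Fin n → ℤ) → ℂ) (s : ℂ) : Prop :=
  Summable (fun k => ‖laurentTerm a z k‖) ∧ ∑' k, laurentTerm a z k = s

theorem HasLaurentSum.add {z : Fin n → ℂ} {a b : (Fin n → ℤ) → ℂ} {s t : ℂ}
    (ha : HasLaurentSum z a s) (hb : HasLaurentSum z b t) : HasLaurentSum z (a + b) (s + t) := by
  have h : laurentTerm (a + b) z = fun k => laurentTerm a z k + laurentTerm b z k := by
    ext k; simp [laurentTerm, add_mul]
  refine ⟨?_, ?_⟩
  · rw [h]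
    exact Summable.of_nonneg_of_le (fun _ => norm_nonneg _) (fun k => norm_add_le _ _)
      (ha.1.add hb.1)
  · rw [h, Summable.tsum_add ha.1.of_norm hb.1.of_norm, ha.2, hb.2]

theorem HasLaurentSum.smul {z : Fin n → ℂ} {a : (Fin n → ℤ) → ℂ} {s : ℂ}
    (ha : HasLaurentSum z a s) (c : ℂ) : HasLaurentSum z (c • a) (c * s) := by
  have h : laurentTerm (c • a) z = fun k => c * laurentTerm a z k := by
    ext k; simp [laurentTerm, mul_assoc]
  refine ⟨?_, ?_⟩
  · simp only [h, norm_mul]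
    exact ha.1.mul_left _
  · rw [h, tsum_mul_left, ha.2]

theorem laurentTerm_act_X {z : Fin n → ℂ} (hz : ∀ i, z i ≠ 0) (a : (Fin n → ℤ) → ℂ) (i : Fin n)
    (k : Fin n → ℤ) :
    laurentTerm (act (X i) a) z k = z i * laurentTerm a z (k - Pi.single i 1) := by
  have h : ∏ j, z j ^ k j = z i * ∏ j, z j ^ (k - Pi.single i 1 : Fin n → ℤ) j := by
    have : ∀ j, z j ^ k j = (if j = i then z i else 1) * z j ^ (k - Pi.single i 1 : Fin n → ℤ) j := by
      intro j
      by_cases hj : j = i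
      · subst hj
        rw [if_pos rfl, Pi.sub_apply, Pi.single_eq_same, ← zpow_one_add₀ (hz j)]
        congr 1; ring
      · simp [hj]
    simp_rw [this, Finset.prod_mul_distrib]
    simp
  rw [laurentTerm, laurentTerm, act_X, h]
  ring

theorem HasLaurentSum.act {z : Fin n → ℂ} (hz : ∀ i, z i ≠ 0) {a : (Fin n → ℤ) → ℂ} {s : ℂ}
    (ha : HasLaurentSum z a s) (P : MvPolynomial (Fin n) ℂ) :
    HasLaurentSum z (act P a) (eval z P * s) := by
  induction P using MvPolynomial.induction_on generalizing a s with
  | C c => rw [act_C, eval_C]; exact ha.smul c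
  | add p q hp hq => rw [act_add_apply, map_add, add_mul]; exact (hp ha).add (hq ha)
  | mul_X p i hp =>
    rw [act_mul_apply, map_mul, mul_assoc, eval_X]
    refine hp ⟨?_, ?_⟩
    · simp only [laurentTerm_act_X hz, norm_mul]
      exact ((Equiv.subRight (Pi.single i 1 : Fin n → ℤ)).summable_iff
        (f := fun k => ‖laurentTerm a z k‖) |>.2 ha.1).mul_left _
    · simp only [laurentTerm_act_X hz]
      rw [tsum_mul_left, ← ha.2]
      congr 1
      exact (Equiv.subRight (Pi.single i 1 : Fin n → ℤ)).tsum_eq (fun k => laurentTerm a z k)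

theorem hasLaurentSum_unitSeries (z : Fin n → ℂ) : HasLaurentSum z (unitSeries (Fin n)) 1 := by
  have h : ∀ k, k ≠ 0 → laurentTerm (unitSeries (Fin n)) z k = 0 := by
    intro k hk
    simp [laurentTerm, unitSeries_apply, hk]
  refine ⟨summable_of_ne_finset_zero (s := {0}) fun k hk => ?_, ?_⟩
  · rw [h k (by simpa using hk), norm_zero]
  · rw [tsum_eq_single 0 h]
    simp [laurentTerm, unitSeries_apply]

theorem hasLaurentSum_act_unitSeries {z : Fin n → ℂ} (hz : ∀ i, z i ≠ 0)
    (g : MvPolynomial (Fin n) ℂ) : HasLaurentSum z (act g (unitSeries (Fin n))) (eval z g) := by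
  simpa using (hasLaurentSum_unitSeries z).act hz g

/-- Uniqueness of Laurent coefficients on a torus. -/
theorem eq_zero_of_hasLaurentSum_zero (r : Fin n → ℝ) (hr : ∀ i, 0 < r i) {a : (Fin n → ℤ) → ℂ}
    (h : ∀ z : Fin n → ℂ, (∀ i, ‖z i‖ = r i) → HasLaurentSum z a 0) : a = 0 := by
  -- On the torus the Laurent series becomes an absolutely convergent Fourier series with
  -- coefficients `c`.
  let c : (Fin n → ℤ) → ℂ := fun k => a k * ∏ i, (r i : ℂ) ^ k i
  have hc : Summable fun k => ‖c k‖ :=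
    (h (fun i => r i) fun i => by simp [abs_of_pos (hr i)]).1
  have hsum : Summable fun k => c k • UnitAddTorus.mFourier (d := Fin n) k := by
    refine Summable.of_norm ?_
    simpa [norm_smul, UnitAddTorus.mFourier_norm] using hc
  have hzero : ∑' k, c k • UnitAddTorus.mFourier (d := Fin n) k = 0 := by
    ext x
    rw [← ContinuousMap.tsum_apply hsum]
    have hz := (h (fun i => r i * fourier 1 (x i)) fun i => by
      rw [norm_mul, fourier_apply, Circle.norm_coe, mul_one]
      simp [abs_of_pos (hr i)]).2
    rw [ContinuousMap.zero_apply, ← hz]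
    congr 1
    ext k
    simp only [laurentTerm, c, ContinuousMap.smul_apply, smul_eq_mul, mul_assoc]
    congr 1
    simp only [mul_zpow, Finset.prod_mul_distrib, UnitAddTorus.mFourier, ContinuousMap.coe_mk]
    congr 1
    refine Finset.prod_congr rfl fun i _ => ?_
    rw [fourier_apply, fourier_apply, one_smul, AddCircle.toCircle_zsmul, Circle.coe_zpow]
  have hL : HasSum (fun k => c k • UnitAddTorus.mFourierLp (d := Fin n) 2 k) 0 := by
    -- The Fourier basis is orthonormal for normalized Haar measure on each circle, so `volume` has
    -- to denote that measure.
    let _ : MeasureTheory.MeasureSpace UnitAddCircle := ⟨AddCircle.haarAddCircle⟩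
    have : MeasureTheory.IsProbabilityMeasure
        (MeasureTheory.MeasureSpace.volume : MeasureTheory.Measure UnitAddCircle) :=
      inferInstanceAs (MeasureTheory.IsProbabilityMeasure AddCircle.haarAddCircle)
    have := hsum.hasSum.mapL (ContinuousMap.toLp (E := ℂ) 2 MeasureTheory.volume ℂ)
    simp only [hzero, map_zero, map_smul] at this
    exact this
  have hk : ∀ k, c k = 0 := by
    intro k
    have h1 := hL.mapL (innerSL ℂ (UnitAddTorus.mFourierLp (d := Fin n) 2 k))
    have h2 : ∀ l, innerSL ℂ (UnitAddTorus.mFourierLp (d := Fin n) 2 k)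
        (c l • UnitAddTorus.mFourierLp (d := Fin n) 2 l) = if l = k then c k else 0 := by
      intro l
      rw [innerSL_apply_apply, inner_smul_right,
        orthonormal_iff_ite.1 UnitAddTorus.orthonormal_mFourier]
      by_cases hl : l = k
      · simp [hl]
      · simp [hl, Ne.symm hl]
    simp only [h2, map_zero] at h1
    exact (hasSum_ite_eq k (c k)).unique h1
  ext k
  have hne : ∏ i, (r i : ℂ) ^ k i ≠ 0 :=
    Finset.prod_ne_zero_iff.2 fun i _ => zpow_ne_zero _ (by exact_mod_cast (hr i).ne')
  exact (mul_eq_zero.1 (hk k)).resolve_right hne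

theorem summable_comp_add_right_iff {G : Type*} [AddCommGroup G] {f : G → ℝ} (v : G) :
    Summable (fun k => f (k + v)) ↔ Summable f :=
  (Equiv.addRight v).summable_iff (f := f)

/-- Iterating the inequality bounds A k by the sum of ρ^m B(k + mv) over m; the remainder ρ^N A(k +
Nv) is exactly zero for large N. Summed over k, the bound is controlled by a geometric series times
the sum of B. -/
theorem summable_of_le_add_mul_shift {G : Type*} [AddCommGroup G] {A B : G → ℝ} (v : G) {ρ : ℝ}
    (hA : ∀ k, 0 ≤ A k) (hB : ∀ k, 0 ≤ B k) (hρ : 0 ≤ ρ) (hρ1 : ρ < 1)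
    (hAB : ∀ k, A k ≤ B k + ρ * A (k + v)) (hfin : ∀ k, ∃ N : ℕ, ∀ m ≥ N, A (k + m • v) = 0)
    (hs : Summable B) : Summable A := by
  have h1 : Summable fun x : ℕ × G => ρ ^ x.1 * B x.2 :=
    (summable_geometric_of_lt_one hρ hρ1).mul_of_nonneg hs (fun m => pow_nonneg hρ m) hB
  have h2 : Summable fun x : G × ℕ => ρ ^ x.2 * B (x.1 + x.2 • v) := by
    -- The double family is a reindexing of the product family along (k, m) ↦ (m, k + mv).
    have hinj : Function.Injective fun x : G × ℕ => (x.2, x.1 + x.2 • v) := by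
      rintro ⟨k, m⟩ ⟨k', m'⟩ h
      simp only [Prod.mk.injEq] at h
      obtain ⟨rfl, h⟩ := h
      simpa using h
    have h3 := h1.comp_injective hinj
    simpa only [Function.comp_def] using h3
  refine Summable.of_nonneg_of_le hA (fun k => ?_) h2.prod
  have iter : ∀ N : ℕ, A k ≤ ∑ m ∈ Finset.range N, ρ ^ m * B (k + m • v) + ρ ^ N * A (k + N • v) := by
    intro N
    induction N with
    | zero => simp
    | succ N ih =>
      rw [Finset.sum_range_succ]
      have := mul_le_mul_of_nonneg_left (hAB (k + N • v)) (pow_nonneg hρ N)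
      rw [add_assoc k, ← succ_nsmul] at this
      rw [pow_succ]
      linarith
  obtain ⟨N, hN⟩ := hfin k
  refine (iter N).trans ?_
  rw [hN N le_rfl, mul_zero, add_zero]
  exact (h2.prod_factor k).sum_le_tsum _ fun m _ => mul_nonneg (pow_nonneg hρ m) (hB _)

/-- Multiplication by `P` reflects absolute convergence at `z` for series in `M`. -/
def ReflectsSum (z : Fin n → ℂ) (M : Submodule ℂ ((Fin n → ℤ) → ℂ)) (P : MvPolynomial (Fin n) ℂ) :
    Prop :=
  ∀ a ∈ M, Summable (fun k => ‖laurentTerm (act P a) z k‖) → Summable fun k => ‖laurentTerm a z k‖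

theorem ReflectsSum.mul {z : Fin n → ℂ} {M : Submodule ℂ ((Fin n → ℤ) → ℂ)} (hM : ActStable M)
    {P Q : MvPolynomial (Fin n) ℂ} (hP : ReflectsSum z M P) (hQ : ReflectsSum z M Q) :
    ReflectsSum z M (P * Q) := fun a ha h =>
  hQ a ha (hP _ (hM.act_mem Q ha) (by rwa [act_mul_apply] at h))

theorem reflectsSum_C {z : Fin n → ℂ} {M : Submodule ℂ ((Fin n → ℤ) → ℂ)} {c : ℂ} (hc : c ≠ 0) :
    ReflectsSum z M (C c) := by
  intro a _ h
  simp only [act_C, laurentTerm, Pi.smul_apply, smul_eq_mul, mul_assoc, norm_mul] at h ⊢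
  exact (summable_mul_left_iff (norm_ne_zero_iff.2 hc)).1 h

theorem reflectsSum_X {z : Fin n → ℂ} (hz : ∀ i, z i ≠ 0) {M : Submodule ℂ ((Fin n → ℤ) → ℂ)}
    (i : Fin n) : ReflectsSum z M (X i) := by
  intro a _ h
  simp only [laurentTerm_act_X hz, norm_mul] at h
  rw [summable_mul_left_iff (norm_ne_zero_iff.2 (hz i))] at h
  exact ((Equiv.subRight (Pi.single i 1 : Fin n → ℤ)).summable_iff
    (f := fun k => ‖laurentTerm a z k‖)).1 h

theorem laurentTerm_act_linear {z : Fin n → ℂ} (hz : ∀ i, z i ≠ 0) (i j : Fin n) (β : ℂ)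
    (a : (Fin n → ℤ) → ℂ) (k : Fin n → ℤ) :
    laurentTerm (act (X i + C β * X j) a) z (k + Pi.single i 1) =
      z i * laurentTerm a z k +
        β * z j * laurentTerm a z (k + (Pi.single i 1 - Pi.single j 1)) := by
  have h2 := laurentTerm_act_X hz a i (k + Pi.single i 1)
  have h3 := laurentTerm_act_X hz a j (k + Pi.single i 1)
  rw [add_sub_cancel_right] at h2
  rw [add_sub_assoc] at h3
  rw [mul_assoc, ← h2, ← h3, act_add_apply, act_mul_apply, act_C]
  simp only [laurentTerm, Pi.add_apply, Pi.smul_apply, smul_eq_mul]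
  ring

/-- Dividing by zᵢ + βzⱼ amounts to a geometric series of ratio |βzⱼ/zᵢ| < 1, in the direction along
which the series terminates. -/
theorem reflectsSum_linear {z : Fin n → ℂ} (hz : ∀ i, z i ≠ 0) {S : Set (Fin n → ℤ)}
    {i j : Fin n} (hS : Pi.single i 1 - Pi.single j 1 ∈ S) {β : ℂ} (hβ : ‖β * z j‖ < ‖z i‖) :
    ReflectsSum z (boundedAlong S) (X i + C β * X j) := by
  intro a ha h
  have hzi : 0 < ‖z i‖ := norm_pos_iff.2 (hz i)
  have hB := ((summable_comp_add_right_iff (Pi.single i 1 : Fin n → ℤ)).2 h).mul_left ‖z i‖⁻¹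
  have hAB : ∀ k, ‖laurentTerm a z k‖ ≤
      ‖z i‖⁻¹ * ‖laurentTerm (act (X i + C β * X j) a) z (k + Pi.single i 1)‖ +
        ‖β * z j‖ / ‖z i‖ * ‖laurentTerm a z (k + (Pi.single i 1 - Pi.single j 1))‖ := by
    intro k
    rw [div_mul_eq_mul_div, inv_mul_eq_div, ← add_div, le_div_iff₀ hzi, laurentTerm_act_linear hz,
      mul_comm, ← norm_mul, ← norm_mul]
    have := norm_sub_le (z i * laurentTerm a z k + β * z j *
      laurentTerm a z (k + (Pi.single i 1 - Pi.single j 1)))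
      (β * z j * laurentTerm a z (k + (Pi.single i 1 - Pi.single j 1)))
    rwa [add_sub_cancel_right] at this
  have hfin : ∀ k, ∃ N : ℕ, ∀ m ≥ N,
      ‖laurentTerm a z (k + m • (Pi.single i 1 - Pi.single j 1))‖ = 0 := by
    intro k
    obtain ⟨N, hN⟩ := ha _ hS k
    exact ⟨N, fun m hm => by rw [laurentTerm, hN m hm, zero_mul, norm_zero]⟩
  exact summable_of_le_add_mul_shift (Pi.single i 1 - Pi.single j 1 : Fin n → ℤ)
    (fun _ => norm_nonneg _) (fun _ => mul_nonneg (inv_nonneg.2 (norm_nonneg _)) (norm_nonneg _))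
    (div_nonneg (norm_nonneg _) (norm_nonneg _)) ((div_lt_one hzi).2 hβ) hAB hfin hB

/-- The passage from formal identities back to analysis: once absolute convergence of `a` is known,
multiplication by P multiplies its sum by P(z). -/
theorem hasLaurentSum_div {z : Fin n → ℂ} (hz : ∀ i, z i ≠ 0)
    {M : Submodule ℂ ((Fin n → ℤ) → ℂ)} {a : (Fin n → ℤ) → ℂ} (ha : a ∈ M)
    {P g : MvPolynomial (Fin n) ℂ} (hP : ReflectsSum z M P) (hPz : eval z P ≠ 0)
    (h : act P a = act g (unitSeries (Fin n))) : HasLaurentSum z a (eval z g / eval z P) := by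
  have hg := hasLaurentSum_act_unitSeries hz g
  have hs := hP a ha (by rw [h]; exact hg.1)
  refine ⟨hs, ?_⟩
  have h1 := (HasLaurentSum.act hz ⟨hs, rfl⟩ P).2
  rw [h, hg.2] at h1
  rw [h1, mul_div_cancel_left₀ _ hPz]

/-- A series that converges to a quotient of polynomials on a torus is a formal quotient. -/
theorem act_eq_of_hasLaurentSum_div (r : Fin n → ℝ) (hr : ∀ i, 0 < r i) {a : (Fin n → ℤ) → ℂ}
    {P g : MvPolynomial (Fin n) ℂ}
    (h : ∀ z : Fin n → ℂ, (∀ i, ‖z i‖ = r i) →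
      eval z P ≠ 0 ∧ HasLaurentSum z a (eval z g / eval z P)) :
    act P a = act g (unitSeries (Fin n)) := by
  refine sub_eq_zero.1 (eq_zero_of_hasLaurentSum_zero r hr fun z hz => ?_)
  have hz0 : ∀ i, z i ≠ 0 := fun i => norm_pos_iff.1 (by rw [hz]; exact hr i)
  obtain ⟨hP, hs⟩ := h z hz
  have := (hs.act hz0 P).add ((hasLaurentSum_act_unitSeries hz0 g).smul (-1))
  rw [mul_div_cancel₀ _ hP, neg_one_mul, add_neg_cancel, neg_one_smul, ← sub_eq_add_neg] at this
  exact this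

end convergence

/-! ### Rational functions with poles at `zᵢ = 0` and `zᵢ = zⱼ` -/

section rational

open MvPolynomial

variable {n : ℕ}

theorem eval_ne_zero_of_mem_den {P : MvPolynomial (Fin n) ℂ} (hP : P ∈ den (Fin n))
    {z : Fin n → ℂ} (hz : ∀ i, z i ≠ 0) (hz' : ∀ i j, i < j → z i ≠ z j) : eval z P ≠ 0 := by
  refine den_induction (p := fun P => eval z P ≠ 0) (fun c hc => by simpa using hc)
    (fun i => by simpa using hz i) (fun i j h => ?_) (fun P Q hP hQ => ?_) hP
  · simpa [sub_eq_zero] using hz' i j h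
  · rw [map_mul]; exact mul_ne_zero hP hQ

/-- The polynomial `∏ zᵢ^pᵢ ∏ (zᵢ - zⱼ)^qᵢⱼ`. -/
noncomputable def polePoly (p : Fin n → ℕ) (q : Fin n → Fin n → ℕ) : MvPolynomial (Fin n) ℂ :=
  (∏ i, X i ^ p i) * ∏ i, ∏ j ∈ Finset.Ioi i, (X i - X j) ^ q i j

theorem eval_polePoly (p : Fin n → ℕ) (q : Fin n → Fin n → ℕ) (z : Fin n → ℂ) :
    eval z (polePoly p q) =
      (∏ i, z i ^ p i) * ∏ i, ∏ j ∈ Finset.Ioi i, (z i - z j) ^ q i j := by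
  simp [polePoly, map_prod]

theorem polePoly_mem_den (p : Fin n → ℕ) (q : Fin n → Fin n → ℕ) : polePoly p q ∈ den (Fin n) :=
  (den _).mul_mem (Submonoid.prod_mem _ fun i _ => Submonoid.pow_mem _ (X_mem_den i) _)
    (Submonoid.prod_mem _ fun _ _ => Submonoid.prod_mem _ fun _ hj =>
      Submonoid.pow_mem _ (X_sub_X_mem_den (Finset.mem_Ioi.1 hj).ne) _)

/-- This normal form matches the multiplicative description of `den` with the denominators
prescribed by `IsRationalWithPoles`. -/
theorem exists_eq_C_mul_polePoly {P : MvPolynomial (Fin n) ℂ} (hP : P ∈ den (Fin n)) :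
    ∃ c : ℂ, c ≠ 0 ∧ ∃ p q, P = C c * polePoly p q := by
  refine den_induction (p := fun P => ∃ c : ℂ, c ≠ 0 ∧ ∃ p q, P = C c * polePoly p q)
    (fun c hc => ⟨c, hc, 0, 0, ?_⟩) (fun i => ⟨1, one_ne_zero, Pi.single i 1, 0, ?_⟩)
    (fun i j hij => ⟨1, one_ne_zero, 0, Pi.single i (Pi.single j 1), ?_⟩) ?_ hP
  · simp [polePoly]
  · simp only [polePoly, Pi.zero_apply, pow_zero, Finset.prod_const_one, mul_one, C_1, one_mul]
    rw [Finset.prod_eq_single i] <;> simp +contextual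
  · simp only [polePoly, Pi.zero_apply, pow_zero, Finset.prod_const_one, C_1, one_mul]
    rw [Finset.prod_eq_single i, Finset.prod_eq_single j]
    · simp
    · intro b _ hb
      simp [hb]
    · simp [hij]
    · intro b _ hb
      simp [hb]
    · simp
  · rintro P Q ⟨c, hc, p, q, rfl⟩ ⟨c', hc', p', q', rfl⟩
    refine ⟨c * c', mul_ne_zero hc hc', p + p', q + q', ?_⟩
    simp only [polePoly, Pi.add_apply, pow_add, Finset.prod_mul_distrib, C_mul]
    ring

theorem isRationalWithPoles_div {P : MvPolynomial (Fin n) ℂ} (hP : P ∈ den (Fin n))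
    (g : MvPolynomial (Fin n) ℂ) : IsRationalWithPoles fun z => eval z g / eval z P := by
  obtain ⟨c, hc, p, q, rfl⟩ := exists_eq_C_mul_polePoly hP
  refine ⟨C c⁻¹ * g, p, q, fun z => ?_⟩
  simp only
  rw [← eval_polePoly, map_mul, map_mul, eval_C, eval_C, inv_mul_eq_div, div_div]

theorem IsRationalWithPoles.exists_eq_div {f : (Fin n → ℂ) → ℂ} (hf : IsRationalWithPoles f) :
    ∃ P ∈ den (Fin n), ∃ g : MvPolynomial (Fin n) ℂ, ∀ z, f z = eval z g / eval z P := by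
  obtain ⟨g, p, q, h⟩ := hf
  exact ⟨polePoly p q, polePoly_mem_den p q, g, fun z => by rw [h, eval_polePoly]⟩

theorem ne_zero_of_mem_productRegion {z : Fin n → ℂ} (hz : z ∈ productRegion n) (i : Fin n) :
    z i ≠ 0 := norm_pos_iff.1 (hz.2 i)

theorem ne_of_mem_productRegion {z : Fin n → ℂ} (hz : z ∈ productRegion n) {i j : Fin n}
    (h : i < j) : z i ≠ z j := fun he => by
  have := hz.1 i j h
  rw [he] at this
  exact lt_irrefl _ this

theorem vec_mem_productRegion {x y : ℂ} (h : ‖y‖ < ‖x‖) (hy : 0 < ‖y‖) :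
    ![x, y] ∈ productRegion 2 := by
  refine ⟨fun i j hij => ?_, fun i => ?_⟩
  · fin_cases i <;> fin_cases j <;> simp_all
  · fin_cases i
    · exact hy.trans h
    · exact hy

theorem ProductRational.exists_act_eq {a : (Fin n → ℤ) → ℂ} (ha : ProductRational a) :
    ∃ h ∈ den (Fin n), ∃ g, act h a = act g (unitSeries (Fin n)) ∧
      ∀ z ∈ productRegion n, HasLaurentSum z a (eval z g / eval z h) := by
  obtain ⟨f, hf, hs⟩ := ha
  obtain ⟨P, hP, g, hfP⟩ := hf.exists_eq_div
  have hs' : ∀ z ∈ productRegion n, HasLaurentSum z a (eval z g / eval z P) := fun z hz => by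
    rw [← hfP]; exact hs z hz
  refine ⟨P, hP, g, ?_, hs'⟩
  -- The radii n, n - 1, …, 1 put the whole torus inside the product region.
  refine act_eq_of_hasLaurentSum_div (fun i => (n : ℝ) - i) (fun i => ?_) fun z hz => ?_
  · have := i.2
    rw [sub_pos]
    exact_mod_cast this
  · have hreg : z ∈ productRegion n := by
      refine ⟨fun i j hij => ?_, fun i => ?_⟩
      · rw [hz, hz]
        have : (i : ℝ) < j := by exact_mod_cast hij
        linarith
      · rw [hz, sub_pos]
        exact_mod_cast i.2
    exact ⟨eval_ne_zero_of_mem_den hP (ne_zero_of_mem_productRegion hreg)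
      fun i j => ne_of_mem_productRegion hreg, hs' z hreg⟩

/-- The substitution `z₁ = ζ₁ + ζ₂`, `z₂ = ζ₂`. -/
noncomputable def iterateHom : MvPolynomial (Fin 2) ℂ →ₐ[ℂ] MvPolynomial (Fin 2) ℂ :=
  aeval ![X 0 + X 1, X 1]

theorem eval_aeval (z : Fin n → ℂ) {m : ℕ} (f : Fin m → MvPolynomial (Fin n) ℂ)
    (P : MvPolynomial (Fin m) ℂ) : eval z (aeval f P) = eval (fun i => eval z (f i)) P := by
  induction P using MvPolynomial.induction_on with
  | C c => simp
  | add p q hp hq => rw [map_add, map_add, map_add, hp, hq]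
  | mul_X p i hp => rw [map_mul, map_mul, map_mul, hp, aeval_X, eval_X]

theorem eval_iterateHom (z : Fin 2 → ℂ) (P : MvPolynomial (Fin 2) ℂ) :
    eval z (iterateHom P) = eval ![z 0 + z 1, z 1] P := by
  rw [iterateHom, eval_aeval]
  congr 2
  ext i
  fin_cases i <;> simp

/-- Associativity in formal terms: both series are expansions of one rational function. -/
theorem AssociativityHolds.exists_act_eq {a b : (Fin 2 → ℤ) → ℂ} (hab : AssociativityHolds a b)
    (ha : ProductRational a) (hb : IterateRational b) :
    ∃ h ∈ den (Fin 2), ∃ g, act h a = act g (unitSeries (Fin 2)) ∧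
      act (iterateHom h) b = act (iterateHom g) (unitSeries (Fin 2)) := by
  obtain ⟨P, hP, g, hPa, hs⟩ := ha.exists_act_eq
  obtain ⟨f, hf, hbs⟩ := hb
  obtain ⟨Q, hQ, g', hfQ⟩ := hf.exists_eq_div
  have ne : ∀ R ∈ den (Fin 2), ∀ z₁ z₂ : ℂ, z₁ ≠ 0 → z₂ ≠ 0 → z₁ ≠ z₂ → eval ![z₁, z₂] R ≠ 0 := by
    intro R hR z₁ z₂ h1 h2 h12
    refine eval_ne_zero_of_mem_den hR (fun i => ?_) fun i j hij => ?_
    · fin_cases i <;> simpa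
    · fin_cases i <;> fin_cases j <;> simp_all
  have hQb : act (iterateHom Q) b = act (iterateHom g') (unitSeries (Fin 2)) := by
    -- The variables are now ζ₁ = z₁ - z₂ and ζ₂ = z₂; radii 1 and 2 satisfy |ζ₁| < |ζ₂|, which also
    -- excludes z₁ = 0.
    refine act_eq_of_hasLaurentSum_div ![1, 2] (fun i => by fin_cases i <;> simp) fun z hz => ?_
    have h0 : ‖z 0‖ = 1 := hz 0
    have h1 : ‖z 1‖ = 2 := hz 1
    have hz0 : z 0 ≠ 0 := norm_pos_iff.1 (by rw [h0]; norm_num)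
    have hz1 : z 1 ≠ 0 := norm_pos_iff.1 (by rw [h1]; norm_num)
    have hzz : ![z 0 + z 1 - z 1, z 1] = z := by
      ext i; fin_cases i <;> simp
    rw [eval_iterateHom, eval_iterateHom]
    refine ⟨ne Q hQ _ _ (fun h => ?_) hz1 (by simpa using hz0), ?_⟩
    · rw [eq_neg_of_add_eq_zero_left h, norm_neg, h1] at h0
      norm_num at h0
    · have := hbs (z 0 + z 1) (z 1) (by simp [h0, h1]) (by simp [hz0])
      rwa [hzz, hfQ] at this
  have hcross : g * Q = g' * P := by
    -- Polynomials agreeing on a product of infinite sets are equal. For real x in [5/2, 3] and y in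
    -- [2, 9/4] one has x > y > x - y > 0, so both expansions converge and agree there.
    refine funext_set ![Complex.ofReal '' Set.Icc (5 / 2) 3, Complex.ofReal '' Set.Icc 2 (9 / 4)]
      (fun i => ?_) fun z hz => ?_
    · have hinf : ∀ x y : ℝ, x < y → (Complex.ofReal '' Set.Icc x y).Infinite := fun x y hxy =>
        (Set.Icc_infinite hxy).image Complex.ofReal_injective.injOn
      fin_cases i
      · exact hinf _ _ (by norm_num)
      · exact hinf _ _ (by norm_num)
    · obtain ⟨x, hx, hx'⟩ : z 0 ∈ Complex.ofReal '' Set.Icc (5 / 2) 3 := hz 0 trivial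
      obtain ⟨y, hy, hy'⟩ : z 1 ∈ Complex.ofReal '' Set.Icc 2 (9 / 4) := hz 1 trivial
      have hzz : z = ![(x : ℂ), (y : ℂ)] := by
        ext i; fin_cases i <;> simp [hx', hy']
      have hxn : ‖(x : ℂ)‖ = x := by rw [Complex.norm_real, Real.norm_of_nonneg (by linarith [hx.1])]
      have hyn : ‖(y : ℂ)‖ = y := by rw [Complex.norm_real, Real.norm_of_nonneg (by linarith [hy.1])]
      have hxyn : ‖(x : ℂ) - y‖ = x - y := by
        rw [← Complex.ofReal_sub, Complex.norm_real, Real.norm_of_nonneg (by linarith [hx.1, hy.2])]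
      have e1 := hab x y (by rw [hxn, hyn]; linarith [hx.1, hy.2])
        (by rw [hxyn, hyn]; linarith [hx.2, hy.1]) (by rw [hxyn]; linarith [hx.1, hy.2])
      have hreg : ![(x : ℂ), (y : ℂ)] ∈ productRegion 2 := vec_mem_productRegion
        (by rw [hxn, hyn]; linarith [hx.1, hy.2]) (by rw [hyn]; linarith [hy.1])
      have e2 := (hs _ hreg).2
      have e3 := (hbs x y (by rw [hxyn, hyn]; linarith [hx.2, hy.1])
        (by rw [hxyn]; linarith [hx.1, hy.2])).2
      rw [e2, e3, hfQ, ← hzz] at e1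
      have hPz : eval z P ≠ 0 := eval_ne_zero_of_mem_den hP
        (by rw [hzz]; exact ne_zero_of_mem_productRegion hreg)
        (by rw [hzz]; exact fun i j => ne_of_mem_productRegion hreg)
      have hQz : eval z Q ≠ 0 := eval_ne_zero_of_mem_den hQ
        (by rw [hzz]; exact ne_zero_of_mem_productRegion hreg)
        (by rw [hzz]; exact fun i j => ne_of_mem_productRegion hreg)
      rw [map_mul, map_mul]
      exact (div_eq_div_iff hPz hQz).1 e1
  refine ⟨Q * P, (den _).mul_mem hQ hP, Q * g, ?_, ?_⟩
  · rw [act_mul_apply, hPa, act_mul_apply]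
  · rw [mul_comm Q P, mul_comm Q g, hcross, map_mul, act_mul_apply, hQb, mul_comm g' P, map_mul,
      act_mul_apply]

end rational

/-! ### The exponential `e^{xD}` and skew-symmetry -/

section skewSymmetry

variable {X Z W : Type*} [AddCommGroup W] [Module ℂ W]

/-- A formal series with finitely many negative powers. -/
def LowerTruncated (s : ℤ → W) : Prop := ∃ N : ℤ, ∀ n < N, s n = 0

/-- The series `e^{xD} s(-x)`. -/
noncomputable def seqSkew (D : Module.End ℂ W) (s : ℤ → W) (n : ℤ) : W :=
  ∑ᶠ i : ℕ, ((i.factorial : ℂ)⁻¹ * (-1 : ℂ) ^ (n - (i : ℤ))) • (D ^ i) (s (n - (i : ℤ)))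

theorem skew_apply (D : Module.End ℂ W) (Y : X → Z → ℤ → W) (a : X) (b : Z) :
    skew D Y b a = seqSkew D (Y a b) := by
  ext n
  simp only [skew, skewTerm, seqSkew, Module.End.pow_apply]

/-- Any sufficiently long truncation may be used, so coefficient identities reduce to finite sums of
a common length. -/
theorem seqSkew_eq_sum (D : Module.End ℂ W) {s : ℤ → W} {N : ℤ} (hs : ∀ n < N, s n = 0) {n : ℤ}
    {M : ℕ} (hM : n - M < N) : seqSkew D s n = ∑ i ∈ Finset.range M,
      ((i.factorial : ℂ)⁻¹ * (-1 : ℂ) ^ (n - (i : ℤ))) • (D ^ i) (s (n - (i : ℤ))) := by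
  refine finsum_eq_sum_of_support_subset _ fun i hi => ?_
  rw [Finset.coe_range, Set.mem_Iio]
  by_contra h
  refine hi ?_
  simp only
  rw [hs _ (by omega), map_zero, smul_zero]

theorem exists_sub_lt (n N : ℤ) : ∃ M : ℕ, n - M < N := ⟨(n - N + 1).toNat, by omega⟩

theorem skewDefined_of_lowerTruncated (D : Module.End ℂ W) {Y : X → Z → ℤ → W}
    (hY : ∀ a b, LowerTruncated (Y a b)) : SkewDefined D Y := by
  intro a b n
  obtain ⟨N, hN⟩ := hY a b
  obtain ⟨M, hM⟩ := exists_sub_lt n N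
  refine (Finset.range M).finite_toSet.subset fun i hi => ?_
  rw [Finset.coe_range, Set.mem_Iio]
  by_contra h
  refine hi ?_
  rw [skewTerm, hN _ (by omega), ← Module.End.pow_apply, map_zero, smul_zero]

theorem seqSkew_eq_zero (D : Module.End ℂ W) {s : ℤ → W} {N : ℤ} (hs : ∀ n < N, s n = 0) {n : ℤ}
    (hn : n < N) : seqSkew D s n = 0 := by
  rw [seqSkew_eq_sum D hs (M := 0) (by simpa using hn), Finset.sum_range_zero]

theorem LowerTruncated.seqSkew {s : ℤ → W} (hs : LowerTruncated s) (D : Module.End ℂ W) :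
    LowerTruncated (seqSkew D s) := by
  obtain ⟨N, hN⟩ := hs
  exact ⟨N, fun n hn => seqSkew_eq_zero D hN hn⟩

theorem LowerTruncated.map [AddCommGroup X] [Module ℂ X] {s : ℤ → X} (hs : LowerTruncated s) (f : ℤ → X →ₗ[ℂ] W) :
    LowerTruncated fun n => f n (s n) := by
  obtain ⟨N, hN⟩ := hs
  exact ⟨N, fun n hn => by simp only; rw [hN n hn, map_zero]⟩

theorem LowerTruncated.sub {G : Type*} [AddCommGroup G] {s t : ℤ → G} (hs : LowerTruncated s) (ht : LowerTruncated t) :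
    LowerTruncated (s - t) := by
  obtain ⟨N, hN⟩ := hs
  obtain ⟨N', hN'⟩ := ht
  exact ⟨min N N', fun n hn => by
    rw [Pi.sub_apply, hN n (by omega), hN' n (by omega), sub_zero]⟩

theorem seqSkew_add (D : Module.End ℂ W) {s t : ℤ → W} (hs : LowerTruncated s)
    (ht : LowerTruncated t) : seqSkew D (s + t) = seqSkew D s + seqSkew D t := by
  obtain ⟨N, hN⟩ := hs
  obtain ⟨N', hN'⟩ := ht
  ext n
  obtain ⟨M, hM⟩ := exists_sub_lt n (min N N')
  have hst : ∀ m < min N N', (s + t) m = 0 := fun m hm => by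
    rw [Pi.add_apply, hN m (by omega), hN' m (by omega), add_zero]
  rw [Pi.add_apply, seqSkew_eq_sum D hst hM, seqSkew_eq_sum D hN (M := M) (by omega),
    seqSkew_eq_sum D hN' (M := M) (by omega), ← Finset.sum_add_distrib]
  simp

theorem seqSkew_smul (D : Module.End ℂ W) {s : ℤ → W} (hs : LowerTruncated s) (c : ℂ) :
    seqSkew D (c • s) = c • seqSkew D s := by
  obtain ⟨N, hN⟩ := hs
  ext n
  obtain ⟨M, hM⟩ := exists_sub_lt n N
  have hst : ∀ m < N, (c • s) m = 0 := fun m hm => by rw [Pi.smul_apply, hN m hm, smul_zero]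
  rw [Pi.smul_apply, seqSkew_eq_sum D hst hM, seqSkew_eq_sum D hN hM, Finset.smul_sum]
  simp [smul_comm c]

theorem seqSkew_sub (D : Module.End ℂ W) {s t : ℤ → W} (hs : LowerTruncated s)
    (ht : LowerTruncated t) : seqSkew D (s - t) = seqSkew D s - seqSkew D t := by
  have h := seqSkew_add D (hs.sub ht) ht
  rw [sub_add_cancel] at h
  rw [h, add_sub_cancel_right]

theorem isVertexMap_skew [AddCommGroup X] [Module ℂ X] [AddCommGroup Z] [Module ℂ Z] (D : Module.End ℂ W) {Y : X → Z → ℤ → W} (hY : IsVertexMap Y)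
    (ht : ∀ a b, LowerTruncated (Y a b)) : IsVertexMap (skew D Y) where
  linear_left a := by
    refine ⟨fun b b' => ?_, fun c b => ?_⟩
    · rw [skew_apply, skew_apply, skew_apply, ← seqSkew_add D (ht _ _) (ht _ _)]
      exact congrArg _ ((hY.linear_right a).map_add b b')
    · rw [skew_apply, skew_apply, ← seqSkew_smul D (ht _ _)]
      exact congrArg _ ((hY.linear_right a).map_smul c b)
  linear_right b := by
    refine ⟨fun a a' => ?_, fun c a => ?_⟩
    · rw [skew_apply, skew_apply, skew_apply, ← seqSkew_add D (ht _ _) (ht _ _)]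
      exact congrArg _ ((hY.linear_left b).map_add a a')
    · rw [skew_apply, skew_apply, ← seqSkew_smul D (ht _ _)]
      exact congrArg _ ((hY.linear_left b).map_smul c a)

theorem map_seqSkew_of_commute (D : Module.End ℂ W) {s : ℤ → W} (hs : LowerTruncated s) (n : ℤ) :
    D (seqSkew D s n) = seqSkew D (fun m => D (s m)) n := by
  obtain ⟨N, hN⟩ := hs
  obtain ⟨M, hM⟩ := exists_sub_lt n N
  have hD : ∀ m < N, D (s m) = 0 := fun m hm => by rw [hN m hm, map_zero]
  rw [seqSkew_eq_sum D hN hM, seqSkew_eq_sum D hD hM, map_sum]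
  refine Finset.sum_congr rfl fun i _ => ?_
  rw [map_smul, ← Module.End.mul_apply, ← pow_succ', pow_succ, Module.End.mul_apply]

/-- `(d/dx) e^{xD} s(-x) = D e^{xD} s(-x) - e^{xD} s'(-x)`. -/
theorem seqSkew_deriv (D : Module.End ℂ W) {s : ℤ → W} (hs : LowerTruncated s) (n : ℤ) :
    ((n : ℂ) + 1) • seqSkew D s (n + 1) =
      D (seqSkew D s n) - seqSkew D (fun m => ((m : ℂ) + 1) • s (m + 1)) n := by
  obtain ⟨N, hN⟩ := hs
  obtain ⟨M, hM⟩ := exists_sub_lt n (N - 1)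
  have hd : ∀ m < N - 1, ((m : ℂ) + 1) • s (m + 1) = 0 := fun m hm => by
    rw [hN _ (by omega), smul_zero]
  -- T i is the i-th term of the coefficient n + 1. Applying D contributes i·T i after an index
  -- shift, minus the derivative contributes (n + 1 - i)·T i, and the weights add up to n + 1.
  set T : ℕ → W := fun i =>
    ((i.factorial : ℂ)⁻¹ * (-1 : ℂ) ^ (n + 1 - (i : ℤ))) • (D ^ i) (s (n + 1 - (i : ℤ))) with hT
  have h1 : D (seqSkew D s n) = ∑ i ∈ Finset.range M, ((i : ℂ) + 1) • T (i + 1) := by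
    rw [seqSkew_eq_sum D hN (M := M) (by omega), map_sum]
    refine Finset.sum_congr rfl fun i _ => ?_
    rw [map_smul, ← Module.End.mul_apply, ← pow_succ', hT]
    simp only
    rw [smul_smul, show n + 1 - ((i + 1 : ℕ) : ℤ) = n - i by push_cast; ring, ← mul_assoc]
    congr 2
    rw [Nat.factorial_succ]
    push_cast
    have : (i : ℂ) + 1 ≠ 0 := by exact_mod_cast i.succ_ne_zero
    field_simp
  have h2 : seqSkew D (fun m => ((m : ℂ) + 1) • s (m + 1)) n =
      -∑ i ∈ Finset.range M, ((n : ℂ) + 1 - i) • T i := by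
    rw [seqSkew_eq_sum D hd (M := M) (by omega), ← Finset.sum_neg_distrib]
    refine Finset.sum_congr rfl fun i _ => ?_
    rw [hT]
    simp only
    rw [map_smul, smul_smul, smul_smul, ← neg_smul,
      show n + 1 - (i : ℤ) = n - i + 1 by ring, zpow_add_one₀ (by norm_num)]
    congr 1
    push_cast
    ring
  have h3 : ∑ i ∈ Finset.range M, ((i : ℂ) + 1) • T (i + 1) =
      ∑ i ∈ Finset.range M, (i : ℂ) • T i := by
    -- The top term lies below the truncation bound and the bottom one has weight 0, so the shift
    -- loses nothing.
    have hTM : T M = 0 := by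
      rw [hT]
      simp only
      rw [hN _ (by omega), map_zero, smul_zero]
    have := Finset.sum_range_succ' (fun i : ℕ => (i : ℂ) • T i) M
    rw [Finset.sum_range_succ, hTM, smul_zero, add_zero] at this
    simpa using this.symm
  rw [h1, h2, h3, sub_neg_eq_add, ← Finset.sum_add_distrib,
    seqSkew_eq_sum D hN (M := M) (by omega), Finset.smul_sum]
  refine Finset.sum_congr rfl fun i _ => ?_
  rw [← add_smul]
  congr 1
  ring

theorem map_pow_of_commutator {d D : Module.End ℂ W} (h : ∀ w, d (D w) = D (d w) + D w) (i : ℕ)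
    (w : W) : d ((D ^ i) w) = (D ^ i) (d w) + (i : ℂ) • (D ^ i) w := by
  induction i generalizing w with
  | zero => simp
  | succ i ih =>
    rw [pow_succ, Module.End.mul_apply, ih, h, map_add, Module.End.mul_apply, Nat.cast_succ,
      add_smul, one_smul]
    abel

/-- In the i-th term D^i adds i to the weight, while the coefficient is taken at n - i; together
they give n. -/
theorem map_seqSkew_of_commutator {d D : Module.End ℂ W} (h : ∀ w, d (D w) = D (d w) + D w)
    {s : ℤ → W} (hs : LowerTruncated s) (n : ℤ) :
    d (seqSkew D s n) = seqSkew D (fun m => d (s m) - (m : ℂ) • s m) n + (n : ℂ) • seqSkew D s n := by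
  obtain ⟨N, hN⟩ := hs
  obtain ⟨M, hM⟩ := exists_sub_lt n N
  have hd : ∀ m < N, d (s m) - (m : ℂ) • s m = 0 := fun m hm => by rw [hN m hm]; simp
  rw [seqSkew_eq_sum D hN hM, seqSkew_eq_sum D hd hM, map_sum, Finset.smul_sum,
    ← Finset.sum_add_distrib]
  refine Finset.sum_congr rfl fun i _ => ?_
  rw [map_smul, map_pow_of_commutator h, map_sub, map_smul]
  push_cast
  module

/-- This is (1 - 1)^m / m!, the coefficient form of e^x e^{-x} = 1. -/
theorem sum_alternating_div_factorial (m : ℕ) :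
    ∑ k ∈ Finset.range (m + 1), ((k.factorial : ℂ)⁻¹ * ((m - k).factorial : ℂ)⁻¹ * (-1) ^ (m - k)) =
      if m = 0 then 1 else 0 := by
  have h := add_pow (1 : ℂ) (-1) m
  rw [add_neg_cancel] at h
  have h2 : ∑ k ∈ Finset.range (m + 1),
      ((k.factorial : ℂ)⁻¹ * ((m - k).factorial : ℂ)⁻¹ * (-1) ^ (m - k)) =
      (m.factorial : ℂ)⁻¹ * 0 ^ m := by
    rw [h, Finset.mul_sum]
    refine Finset.sum_congr rfl fun k hk => ?_
    rw [Nat.cast_choose ℂ (Nat.lt_succ_iff.1 (Finset.mem_range.1 hk)), one_pow, one_mul]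
    have := Nat.cast_ne_zero (R := ℂ).2 m.factorial_ne_zero
    field_simp
  rw [h2]
  split_ifs with hm
  · simp [hm]
  · simp [hm]

/-- The sign change squares to the identity and the exponentials e^{xD}, e^{-xD} cancel. -/
theorem seqSkew_seqSkew (D : Module.End ℂ W) {s : ℤ → W} (hs : LowerTruncated s) :
    seqSkew D (seqSkew D s) = s := by
  obtain ⟨N, hN⟩ := hs
  ext n
  obtain ⟨M, hM⟩ := exists_sub_lt n N
  have hM' : n - (M + 1 : ℕ) < N := by push_cast; omega
  rw [seqSkew_eq_sum D (fun m hm => seqSkew_eq_zero D hN hm) hM']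
  set f : ℕ → ℕ → W := fun i j => ((i.factorial : ℂ)⁻¹ * (j.factorial : ℂ)⁻¹ * (-1) ^ j) •
    (D ^ (i + j)) (s (n - ((i + j : ℕ) : ℤ))) with hf
  have h1 : ∀ i ∈ Finset.range (M + 1), ((i.factorial : ℂ)⁻¹ * (-1 : ℂ) ^ (n - (i : ℤ))) •
      (D ^ i) (seqSkew D s (n - (i : ℤ))) = ∑ j ∈ Finset.range (M + 1 - i), f i j := by
    intro i hi
    have hi' := Finset.mem_range.1 hi
    -- The inner length depends on i so that the double sum runs over a triangle and can be
    -- regrouped by i + j.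
    rw [seqSkew_eq_sum D hN (M := M + 1 - i) (by omega), map_sum, Finset.smul_sum]
    refine Finset.sum_congr rfl fun j _ => ?_
    rw [map_smul, ← Module.End.mul_apply, ← pow_add, smul_smul, hf]
    simp only
    rw [show n - (i : ℤ) - j = n - ((i + j : ℕ) : ℤ) by push_cast; ring]
    congr 1
    have hsgn : (-1 : ℂ) ^ (n - (i : ℤ)) * (-1 : ℂ) ^ (n - ((i + j : ℕ) : ℤ)) = (-1) ^ j := by
      rw [← zpow_add₀ (by norm_num), ← zpow_natCast,
        show n - (i : ℤ) + (n - ((i + j : ℕ) : ℤ)) = 2 * (n - i - j) + j by push_cast; ring,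
        zpow_add₀ (by norm_num), zpow_mul]
      norm_num
    rw [← hsgn]
    ring
  rw [Finset.sum_congr rfl h1, ← Finset.sum_range_diag_flip]
  have h2 : ∀ m ∈ Finset.range (M + 1), ∑ k ∈ Finset.range (m + 1), f k (m - k) =
      if m = 0 then s n else 0 := by
    intro m _
    have : ∀ k ∈ Finset.range (m + 1), f k (m - k) =
        ((k.factorial : ℂ)⁻¹ * ((m - k).factorial : ℂ)⁻¹ * (-1) ^ (m - k)) •
          (D ^ m) (s (n - (m : ℤ))) := by
      intro k hk
      rw [hf]
      simp only
      rw [Nat.add_sub_cancel' (Nat.lt_succ_iff.1 (Finset.mem_range.1 hk))]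
    rw [Finset.sum_congr rfl this, ← Finset.sum_smul, sum_alternating_div_factorial]
    split_ifs with hm
    · simp [hm]
    · simp
  rw [Finset.sum_congr rfl h2, Finset.sum_ite_eq']
  simp

/-! ### Vertex operator axioms under skew-symmetry -/

theorem lowerTruncated_skew (D : Module.End ℂ W) {Y : X → Z → ℤ → W}
    (hY : ∀ a b, LowerTruncated (Y a b)) (b : Z) (a : X) : LowerTruncated (skew D Y b a) := by
  rw [skew_apply]
  exact (hY a b).seqSkew D

theorem skew_skew (D : Module.End ℂ W) {Y : X → Z → ℤ → W}
    (hY : ∀ a b, LowerTruncated (Y a b)) : skew D (skew D Y) = Y := by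
  ext a b n
  rw [skew_apply, skew_apply, seqSkew_seqSkew D (hY a b)]

/-- The D-commutator formula of Y yields the D-derivative formula of its opposite; `skew_commutator`
is the converse exchange. -/
theorem skew_deriv (D : Module.End ℂ W) {Y : X → Z → ℤ → W}
    (hY : ∀ a b, LowerTruncated (Y a b)) {DZ : Z → Z}
    (h : ∀ a b (n : ℤ), ((n : ℂ) + 1) • Y a b (n + 1) = D (Y a b n) - Y a (DZ b) n) (b : Z) (a : X)
    (n : ℤ) : ((n : ℂ) + 1) • skew D Y b a (n + 1) = skew D Y (DZ b) a n := by
  rw [skew_apply, skew_apply, seqSkew_deriv D (hY a b)]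
  have : Y a (DZ b) = (fun m => D (Y a b m)) - fun m : ℤ => ((m : ℂ) + 1) • Y a b (m + 1) := by
    ext m
    rw [Pi.sub_apply, h]
    abel
  have h2 : LowerTruncated fun m : ℤ => ((m : ℂ) + 1) • Y a b (m + 1) := by
    obtain ⟨N, hN⟩ := hY a b
    exact ⟨N - 1, fun m hm => by simp only; rw [hN _ (by omega), smul_zero]⟩
  rw [this, seqSkew_sub D ((hY a b).map fun _ => D) h2, Pi.sub_apply,
    map_seqSkew_of_commute D (hY a b)]

theorem skew_commutator (D : Module.End ℂ W) {Y : X → Z → ℤ → W}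
    (hY : ∀ a b, LowerTruncated (Y a b)) {DX : X → X}
    (h : ∀ a b (n : ℤ), ((n : ℂ) + 1) • Y a b (n + 1) = Y (DX a) b n) (b : Z) (a : X)
    (n : ℤ) : ((n : ℂ) + 1) • skew D Y b a (n + 1) =
      D (skew D Y b a n) - skew D Y b (DX a) n := by
  rw [skew_apply, skew_apply, seqSkew_deriv D (hY a b)]
  congr 2
  ext m
  rw [h]

theorem skew_weight {d D : Module.End ℂ W} (hd : ∀ w, d (D w) = D (d w) + D w)
    {Y : X → Z → ℤ → W} (hY : ∀ a b, LowerTruncated (Y a b)) {dX : X → X} {dZ : Z → Z}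
    (h : ∀ a b (n : ℤ), d (Y a b n) - Y a (dZ b) n = Y (dX a) b n + (n : ℂ) • Y a b n) (b : Z)
    (a : X) (n : ℤ) : d (skew D Y b a n) - skew D Y b (dX a) n =
      skew D Y (dZ b) a n + (n : ℂ) • skew D Y b a n := by
  rw [skew_apply, skew_apply, skew_apply, map_seqSkew_of_commutator hd (hY a b)]
  have : (fun m : ℤ => d (Y a b m) - (m : ℂ) • Y a b m) = Y (dX a) b + Y a (dZ b) := by
    ext m
    rw [Pi.add_apply, sub_eq_iff_eq_add, eq_add_of_sub_eq (h a b m)]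
    abel
  rw [this, seqSkew_add D (hY _ _) (hY _ _), Pi.add_apply]
  abel

/-- If `Y(v, x)` is `e^{xD}w`, then skew-symmetry turns it into the constant series `w`. -/
theorem seqSkew_exp (D : Module.End ℂ W) {s : ℤ → W} (hneg : ∀ n < 0, s n = 0)
    (h : ∀ n : ℤ, ((n : ℂ) + 1) • s (n + 1) = D (s n)) (n : ℤ) :
    seqSkew D s n = if n = 0 then s 0 else 0 := by
  set t : ℤ → W := fun n => if n = 0 then s 0 else 0 with ht
  -- The recursion forces s = e^{xD}s₀, the transform of a constant series; involutivity then
  -- finishes.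
  have hs : s = seqSkew D t := by
    have htneg : ∀ n < 0, t n = 0 := fun n hn => by rw [ht]; exact if_neg hn.ne
    have hst : ∀ n : ℕ, s n = ((n.factorial : ℂ)⁻¹) • (D ^ n) (s 0) := by
      intro n
      induction n with
      | zero => simp
      | succ n ih =>
        have hn : (n : ℂ) + 1 ≠ 0 := by exact_mod_cast n.succ_ne_zero
        have h1 := h n
        rw [ih, map_smul, ← Module.End.mul_apply, ← pow_succ', Int.cast_natCast] at h1
        rw [Nat.cast_succ, ← inv_smul_smul₀ hn (s _), h1, smul_smul, Nat.factorial_succ]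
        congr 1
        push_cast
        rw [mul_inv]
    ext n
    rcases lt_or_ge n 0 with hn | hn
    · rw [hneg n hn, seqSkew_eq_zero D htneg hn]
    · lift n to ℕ using hn
      rw [hst, seqSkew_eq_sum D htneg (M := n + 1) (by push_cast; omega),
        Finset.sum_eq_single n]
      · simp [ht]
      · intro b _ hb
        have : (n : ℤ) - b ≠ 0 := by omega
        simp [ht, this]
      · simp
  rw [hs, seqSkew_seqSkew D ⟨0, fun n hn => if_neg hn.ne⟩, ← hs]

/-- A functional killed by `D^N` sees only `N` terms of the exponential. -/
theorem dual_seqSkew (D : Module.End ℂ W) {s : ℤ → W} (hs : LowerTruncated s)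
    (φ : Module.Dual ℂ W) {N : ℕ} (hφ : ∀ i ≥ N, φ ∘ₗ D ^ i = 0) (n : ℤ) :
    φ (seqSkew D s n) = ∑ i ∈ Finset.range N,
      ((i.factorial : ℂ)⁻¹ * (-1 : ℂ) ^ (n - (i : ℤ))) * (φ ∘ₗ D ^ i) (s (n - (i : ℤ))) := by
  obtain ⟨L, hL⟩ := hs
  obtain ⟨M, hM⟩ := exists_sub_lt n L
  rw [seqSkew_eq_sum D hL (M := max M N) (by push_cast; omega), map_sum]
  simp only [map_smul, smul_eq_mul, LinearMap.comp_apply]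
  refine (Finset.sum_subset (Finset.range_mono (le_max_right M N)) fun i _ hi => ?_).symm
  rw [← LinearMap.comp_apply φ, hφ i (by simpa using hi), LinearMap.zero_apply, mul_zero]

end skewSymmetry

/-! ### Substitutions in formal series -/

section substitution

open MvPolynomial

/-- The directions in which the first nonzero exponent decreases. -/
def lexNegative (n : ℕ) : Set (Fin n → ℤ) := {v | ∃ j, v j < 0 ∧ ∀ i < j, v i = 0}

theorem zero_notMem_lexNegative (n : ℕ) : (0 : Fin n → ℤ) ∉ lexNegative n := by
  rintro ⟨j, hj, _⟩
  exact lt_irrefl _ hj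

theorem single_sub_single_mem_lexNegative {n : ℕ} {i j : Fin n} (h : j < i) :
    (Pi.single i 1 - Pi.single j 1 : Fin n → ℤ) ∈ lexNegative n := by
  refine ⟨j, by simp [h.ne], fun l hl => by simp [hl.ne, (hl.trans h).ne]⟩

/-- Series in `ζ₁, …, ζₙ` of the shape that converges for `|ζ₁| < ⋯ < |ζₙ|`. -/
def nestedSeries (n : ℕ) : Submodule ℂ ((Fin n → ℤ) → ℂ) := boundedAlong (lexNegative n)

theorem actStable_nestedSeries (n : ℕ) : ActStable (nestedSeries n) := actStable_boundedAlong _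

theorem unitSeries_mem_nestedSeries (n : ℕ) : unitSeries (Fin n) ∈ nestedSeries n :=
  unitSeries_mem_boundedAlong (zero_notMem_lexNegative n)

/-- The substitution `z₀ = tₙ`, `zⱼ₊₁ = tₙ + tⱼ`. -/
noncomputable def nestHom (n : ℕ) : MvPolynomial (Fin (n + 1)) ℂ →ₐ[ℂ] MvPolynomial (Fin (n + 1)) ℂ :=
  aeval (Fin.cons (X (Fin.last n)) fun j : Fin n => X (Fin.last n) + X j.castSucc)

/-- Under the substitution, z₀ - zⱼ₊₁ becomes -tⱼ and zᵢ₊₁ - zⱼ₊₁ becomes tᵢ - tⱼ. Hence every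
generator turns into constants, variables and binomials dominated by the variable of larger index,
as nested expansions require. -/
theorem nestHom_den_induction {n : ℕ} {p : MvPolynomial (Fin (n + 1)) ℂ → Prop}
    (hC : ∀ c : ℂ, c ≠ 0 → p (C c)) (hX : ∀ i, p (X i))
    (hlin : ∀ i j, j < i → ∀ β : ℂ, ‖β‖ = 1 → p (X i + C β * X j))
    (hmul : ∀ P Q, p P → p Q → p (P * Q)) {P : MvPolynomial (Fin (n + 1)) ℂ}
    (hP : P ∈ den (Fin (n + 1))) : p (nestHom n P) := by
  refine den_induction (p := fun P => p (nestHom n P)) (fun c hc => ?_) (fun i => ?_)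
    (fun i j hij => ?_) (fun P Q hP hQ => by rw [map_mul]; exact hmul _ _ hP hQ) hP
  · rw [nestHom, aeval_C]; exact hC c hc
  · rw [nestHom, aeval_X]
    refine Fin.cases (hX _) (fun j => ?_) i
    simpa using hlin (Fin.last n) j.castSucc (Fin.castSucc_lt_last j) 1 (by simp)
  · rw [nestHom, map_sub, aeval_X, aeval_X]
    obtain ⟨j, rfl⟩ : ∃ j', j = Fin.succ j' := Fin.exists_succ_eq.2 (Fin.ne_zero_of_lt hij) |>.imp
      fun _ h => h.symm
    rw [Fin.cons_succ]
    induction i using Fin.cases with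
    | zero => simpa using hmul _ _ (hC (-1) (by simp)) (hX j.castSucc)
    | succ i =>
      have := hmul _ _ (hC (-1) (by simp)) (hlin j.castSucc i.castSucc
        (Fin.castSucc_lt_castSucc_iff.2 (Fin.succ_lt_succ_iff.1 hij)) (-1) (by simp))
      rw [Fin.cons_succ]
      convert this using 1
      simp only [map_neg, map_one]
      ring

theorem actRegular_nestHom {n : ℕ} {P : MvPolynomial (Fin (n + 1)) ℂ} (hP : P ∈ den (Fin (n + 1))) :
    ActRegular (nestedSeries (n + 1)) (nestHom n P) :=
  nestHom_den_induction (fun _ hc => actRegular_C hc) actRegular_X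
    (fun _ _ h β _ => actRegular_linear (single_sub_single_mem_lexNegative h) β)
    (fun _ _ hP hQ => hP.mul (actStable_nestedSeries _) hQ) hP

/-- The region `0 < |t₀| < ⋯ < |tₙ|`. -/
def nestedRegion (n : ℕ) : Set (Fin n → ℂ) :=
  {t | (∀ i j, j < i → ‖t j‖ < ‖t i‖) ∧ ∀ i, t i ≠ 0}

theorem reflectsSum_linear_of_mem_nestedRegion {n : ℕ} {t : Fin n → ℂ} (ht : t ∈ nestedRegion n)
    {i j : Fin n} (h : j < i) {β : ℂ} (hβ : ‖β‖ = 1) :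
    ReflectsSum t (nestedSeries n) (X i + C β * X j) :=
  reflectsSum_linear ht.2 (single_sub_single_mem_lexNegative h)
    (by rw [norm_mul, hβ, one_mul]; exact ht.1 i j h)

theorem reflectsSum_nestHom {n : ℕ} {P : MvPolynomial (Fin (n + 1)) ℂ} (hP : P ∈ den (Fin (n + 1)))
    {t : Fin (n + 1) → ℂ} (ht : t ∈ nestedRegion (n + 1)) :
    ReflectsSum t (nestedSeries (n + 1)) (nestHom n P) :=
  nestHom_den_induction (fun _ hc => reflectsSum_C hc) (reflectsSum_X ht.2)
    (fun _ _ h _ hβ => reflectsSum_linear_of_mem_nestedRegion ht h hβ)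
    (fun _ _ hP hQ => hP.mul (actStable_nestedSeries _) hQ) hP

/-! ### The binomial expansion of (y, z) ↦ (-y, z + y) -/

/-- The coefficients of `(1 - x)^(-l - 1)`. -/
noncomputable def risingBinom (l : ℂ) (i : ℕ) : ℂ :=
  (∏ s ∈ Finset.range i, (l + s + 1)) * (i.factorial : ℂ)⁻¹

theorem risingBinom_zero (l : ℂ) : risingBinom l 0 = 1 := by simp [risingBinom]

theorem risingBinom_succ (l : ℂ) (i : ℕ) :
    risingBinom l (i + 1) = risingBinom (l - 1) (i + 1) + risingBinom l i := by
  have h1 : ∏ s ∈ Finset.range (i + 1), (l - 1 + (s : ℂ) + 1) =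
      l * ∏ s ∈ Finset.range i, (l + s + 1) := by
    rw [Finset.prod_range_succ', mul_comm]
    congr 1
    · simp
    · refine Finset.prod_congr rfl fun s _ => ?_
      push_cast; ring
  have hi : (i : ℂ) + 1 ≠ 0 := by exact_mod_cast i.succ_ne_zero
  have hf : (i.factorial : ℂ) ≠ 0 := by exact_mod_cast i.factorial_ne_zero
  rw [risingBinom, risingBinom, risingBinom, h1, Finset.prod_range_succ, Nat.factorial_succ]
  push_cast
  field_simp
  ring

/-- The substitution `(y, z) ↦ (-y, z + y)` of formal series, expanded for `|y| < |z|`. -/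
noncomputable def shiftSkew (b : (Fin 2 → ℤ) → ℂ) (k : Fin 2 → ℤ) : ℂ :=
  ∑ᶠ i : ℕ, (-1 : ℂ) ^ (k 0 - i) * risingBinom (k 1) i * b (k + i • ![-1, 1])

theorem shiftSkew_eq_sum {b : (Fin 2 → ℤ) → ℂ} {k : Fin 2 → ℤ} {N : ℕ}
    (h : ∀ i ≥ N, b (k + i • ![-1, 1]) = 0) : shiftSkew b k =
      ∑ i ∈ Finset.range N, (-1 : ℂ) ^ (k 0 - i) * risingBinom (k 1) i * b (k + i • ![-1, 1]) := by
  refine finsum_eq_sum_of_support_subset _ fun i hi => ?_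
  rw [Finset.coe_range, Set.mem_Iio]
  by_contra h'
  refine hi ?_
  simp only
  rw [h i (not_lt.1 h'), mul_zero]

theorem exists_forall_ge_eq_zero {b : (Fin 2 → ℤ) → ℂ} (hb : b ∈ nestedSeries 2) (k : Fin 2 → ℤ) :
    ∃ N : ℕ, ∀ i ≥ N, b (k + i • ![-1, 1]) = 0 :=
  hb _ ⟨0, by simp, fun i hi => absurd hi (Fin.not_lt_zero i)⟩ k

/-- The substitution `(y, z) ↦ (-y, z + y)`. -/
noncomputable def shiftSkewHom : MvPolynomial (Fin 2) ℂ →ₐ[ℂ] MvPolynomial (Fin 2) ℂ :=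
  aeval ![-X 0, X 1 + X 0]

/-- The factor `risingBinom (k 1) i` is the binomial coefficient of y^i in (z + y)^(k₁ + i).
Multiplicativity need only be checked on variables, and for z it is Pascal's rule. -/
theorem shiftSkew_act (P : MvPolynomial (Fin 2) ℂ) {b : (Fin 2 → ℤ) → ℂ} (hb : b ∈ nestedSeries 2) :
    shiftSkew (act P b) = act (shiftSkewHom P) (shiftSkew b) := by
  refine act_intertwine shiftSkewHom (actStable_nestedSeries 2) shiftSkew ?_ ?_ ?_ P hb
  · intro a ha b hb
    ext k
    obtain ⟨N, hN⟩ := exists_forall_ge_eq_zero ha k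
    obtain ⟨N', hN'⟩ := exists_forall_ge_eq_zero hb k
    have h1 : ∀ i ≥ max N N', a (k + i • ![-1, 1]) = 0 := fun i hi => hN i (le_of_max_le_left hi)
    have h2 : ∀ i ≥ max N N', b (k + i • ![-1, 1]) = 0 := fun i hi => hN' i (le_of_max_le_right hi)
    have h3 : ∀ i ≥ max N N', (a + b) (k + i • ![-1, 1]) = 0 := fun i hi => by
      rw [Pi.add_apply, h1 i hi, h2 i hi, add_zero]
    rw [Pi.add_apply, shiftSkew_eq_sum h1, shiftSkew_eq_sum h2, shiftSkew_eq_sum h3,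
      ← Finset.sum_add_distrib]
    refine Finset.sum_congr rfl fun i _ => ?_
    rw [Pi.add_apply, mul_add]
  · intro c a ha
    ext k
    obtain ⟨N, hN⟩ := exists_forall_ge_eq_zero ha k
    have h1 : ∀ i ≥ N, (c • a) (k + i • ![-1, 1]) = 0 := fun i hi => by
      rw [Pi.smul_apply, hN i hi, smul_zero]
    rw [Pi.smul_apply, shiftSkew_eq_sum hN, shiftSkew_eq_sum h1, Finset.smul_sum]
    refine Finset.sum_congr rfl fun i _ => ?_
    rw [Pi.smul_apply, smul_eq_mul, smul_eq_mul]
    ring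
  · have hv : (![-1, 1] : Fin 2 → ℤ) = Pi.single 1 1 - Pi.single 0 1 := by
      ext i; fin_cases i <;> simp
    intro i a ha
    ext k
    rw [shiftSkewHom, aeval_X]
    fin_cases i
    · change shiftSkew (act (X 0) a) k = act (-X 0) (shiftSkew a) k
      rw [map_neg, LinearMap.neg_apply, Pi.neg_apply, act_X, shiftSkew, shiftSkew, ← finsum_neg_distrib]
      refine finsum_congr fun i => ?_
      rw [act_X, add_sub_right_comm]
      simp only [Pi.sub_apply, Pi.single_eq_same, Pi.single_eq_of_ne (one_ne_zero (α := Fin 2)),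
        sub_zero]
      rw [show k 0 - 1 - (i : ℤ) = k 0 - i - 1 by ring, zpow_sub_one₀ (by norm_num)]
      norm_num
    · change shiftSkew (act (X 1) a) k = act (X 1 + X 0) (shiftSkew a) k
      rw [act_add_apply, Pi.add_apply, act_X, act_X]
      set t : ℕ → ℂ := fun i => a (k - Pi.single 1 1 + i • ![-1, 1]) with ht
      obtain ⟨N, hN⟩ := exists_forall_ge_eq_zero ha (k - Pi.single 1 1)
      -- Since (-1, 1) = e₁ - e₀, lowering the exponent of y is lowering that of z and taking one
      -- more step.
      have e1 : ∀ i : ℕ, k - Pi.single 0 1 + i • (![-1, 1] : Fin 2 → ℤ) =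
          k - Pi.single 1 1 + (i + 1) • ![-1, 1] := by
        intro i
        rw [add_smul, one_smul, hv]
        abel
      have h1 : ∀ i ≥ N + 1, act (X 1) a (k + i • ![-1, 1]) = 0 := fun i hi => by
        rw [act_X, add_sub_right_comm, hN i (by omega)]
      have h2 : ∀ i ≥ N, a (k - Pi.single 0 1 + i • ![-1, 1]) = 0 := fun i hi => by
        rw [e1, hN _ (by omega)]
      rw [shiftSkew_eq_sum h1, shiftSkew_eq_sum (N := N + 1) fun i hi => hN i (by omega),
        shiftSkew_eq_sum h2, Finset.sum_range_succ', Finset.sum_range_succ', add_right_comm,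
        ← Finset.sum_add_distrib]
      congr 1
      · refine Finset.sum_congr rfl fun i _ => ?_
        rw [act_X, add_sub_right_comm, e1]
        simp only [Pi.sub_apply, Pi.single_eq_same, Pi.single_eq_of_ne (one_ne_zero (α := Fin 2)),
          Pi.single_eq_of_ne (zero_ne_one (α := Fin 2)), sub_zero]
        rw [risingBinom_succ]
        push_cast
        rw [show k 0 - 1 - (i : ℤ) = k 0 - (i + 1) by ring]
        ring
      · rw [act_X, add_sub_right_comm]
        simp [risingBinom_zero]

theorem shiftSkew_unitSeries : shiftSkew (unitSeries (Fin 2)) = unitSeries (Fin 2) := by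
  ext k
  have hterm : ∀ i : ℕ, (-1 : ℂ) ^ (k 0 - i) * risingBinom (k 1) i *
      unitSeries (Fin 2) (k + i • ![-1, 1]) = if i = 0 ∧ k = 0 then 1 else 0 := by
    intro i
    rw [unitSeries_apply]
    by_cases h : k + i • ![-1, 1] = 0
    · have h0 : k 0 - i = 0 := by simpa [← sub_eq_add_neg] using congrFun h 0
      have h1 : k 1 + i = 0 := by simpa using congrFun h 1
      rw [if_pos h, h0, mul_one, zpow_zero, one_mul]
      rcases i with _ | i
      · have hk : k = 0 := by simpa using h
        simp [hk, risingBinom_zero]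
      -- Here k₁ = -(i + 1), so the factor with s = i vanishes: (z + y)^0 has no further terms.
      · rw [if_neg (by simp), risingBinom, Finset.prod_eq_zero (i := i) (by simp), zero_mul]
        have : ((k 1 : ℤ) : ℂ) + ((i + 1 : ℕ) : ℂ) = 0 := by exact_mod_cast congrArg (Int.cast (R := ℂ)) h1
        push_cast at this
        rw [add_assoc, this]
    · rw [if_neg h, mul_zero, if_neg]
      rintro ⟨rfl, rfl⟩
      simp at h
  rw [shiftSkew, finsum_congr hterm, finsum_eq_single _ 0 fun i hi => by simp [hi], unitSeries_apply]
  simp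

theorem map_pow_of_deriv {U : Type*} [AddCommGroup U] [Module ℂ U] {D : Module.End ℂ U}
    {L : ℤ → U →ₗ[ℂ] ℂ} (hL : ∀ l x, L l (D x) = ((l : ℂ) + 1) * L (l + 1) x) (i : ℕ) (l : ℤ) (x : U) :
    (i.factorial : ℂ)⁻¹ * L l ((D ^ i) x) = risingBinom l i * L (l + i) x := by
  have h : L l ((D ^ i) x) = (∏ s ∈ Finset.range i, ((l : ℂ) + s + 1)) * L (l + i) x := by
    induction i generalizing x with
    | zero => simp
    | succ i ih =>
      rw [pow_succ, Module.End.mul_apply, ih, hL, Finset.prod_range_succ]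
      push_cast
      rw [mul_assoc, ← add_assoc]
  rw [h, risingBinom]
  ring

/-- Taylor's formula: if D acts as d/dz, then e^{yD} acts as the translation z ↦ z + y. -/
theorem map_seqSkew_eq_shiftSkew {U : Type*} [AddCommGroup U] [Module ℂ U] {D : Module.End ℂ U}
    {L : ℤ → U →ₗ[ℂ] ℂ} (hL : ∀ l x, L l (D x) = ((l : ℂ) + 1) * L (l + 1) x) {s : ℤ → U}
    (hs : LowerTruncated s) (k : Fin 2 → ℤ) :
    L (k 1) (seqSkew D s (k 0)) = shiftSkew (fun k => L (k 1) (s (k 0))) k := by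
  obtain ⟨N, hN⟩ := hs
  obtain ⟨M, hM⟩ := exists_sub_lt (k 0) N
  rw [seqSkew_eq_sum D hN hM, map_sum, shiftSkew_eq_sum (N := M) fun i hi => ?_]
  · refine Finset.sum_congr rfl fun i _ => ?_
    rw [map_smul, smul_eq_mul, mul_comm (_ : ℂ)⁻¹, mul_assoc, map_pow_of_deriv hL, mul_assoc]
    simp [sub_eq_add_neg]
  · rw [hN, map_zero]
    simp
    omega

/-! ### Factoring the nested substitution, and transfer along slices -/

/-- The substitution `z₀ = t₁`, `z₁ = t₁ + t₀`, and `zⱼ = tⱼ` for `j ≥ 2`. -/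
noncomputable def mergeHom (m : ℕ) : MvPolynomial (Fin (m + 2)) ℂ →ₐ[ℂ] MvPolynomial (Fin (m + 2)) ℂ :=
  aeval (Fin.cons (X 1) (Fin.cons (X 1 + X 0) fun j : Fin m => X j.succ.succ))

/-- `nestHom n` applied to all variables but the first. -/
noncomputable def nestTailHom (n : ℕ) :
    MvPolynomial (Fin (n + 2)) ℂ →ₐ[ℂ] MvPolynomial (Fin (n + 2)) ℂ :=
  aeval (Fin.cons (X 0) fun j : Fin (n + 1) => rename Fin.succ (nestHom n (X j)))

/-- The induction step for nested operators: merge the two leftmost factors, then nest the rest with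
t₀ kept as a parameter. -/
theorem nestHom_succ (n : ℕ) : nestHom (n + 1) = (nestTailHom n).comp (mergeHom n) := by
  refine algHom_ext fun i => ?_
  rw [AlgHom.comp_apply, mergeHom, aeval_X, nestHom, aeval_X]
  have h1 : nestTailHom n (X 1) = X (Fin.last (n + 1)) := by
    rw [nestTailHom, aeval_X, ← Fin.succ_zero_eq_one, Fin.cons_succ, nestHom, aeval_X]
    simp
  induction i using Fin.cases with
  | zero => exact h1.symm
  | succ i =>
    induction i using Fin.cases with
    | zero =>
      simp only [Fin.cons_succ, Fin.cons_zero, map_add, h1]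
      rw [nestTailHom, aeval_X]
      simp
    | succ i =>
      simp only [Fin.cons_succ]
      rw [nestTailHom, aeval_X, Fin.cons_succ, nestHom, aeval_X]
      simp

theorem funLeft_act_X {σ ρ : Type} [DecidableEq σ] [DecidableEq ρ] {f : (σ → ℤ) → (ρ → ℤ)} {i : σ}
    {j : ρ} (h : ∀ k, f (k - Pi.single i 1) = f k - Pi.single j 1) (a : (ρ → ℤ) → ℂ) :
    LinearMap.funLeft ℂ ℂ f (act (X j) a) = act (X i) (LinearMap.funLeft ℂ ℂ f a) := by
  ext k
  rw [act_X, LinearMap.funLeft_apply, LinearMap.funLeft_apply, act_X, h]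

theorem cons_sub_single_zero {n : ℕ} (x : ℤ) (k : Fin n → ℤ) :
    (Fin.cons x k : Fin (n + 1) → ℤ) - Pi.single 0 1 = Fin.cons (x - 1) k := by
  ext i
  induction i using Fin.cases <;> simp

theorem cons_sub_single_succ {n : ℕ} (x : ℤ) (k : Fin n → ℤ) (j : Fin n) :
    (Fin.cons x k : Fin (n + 1) → ℤ) - Pi.single j.succ 1 = Fin.cons x (k - Pi.single j 1) := by
  ext i
  induction i using Fin.cases with
  | zero => simp [Ne.symm (Fin.succ_ne_zero j)]
  | succ i => simp [Pi.single_apply]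

theorem funLeft_cons_act_rename {n : ℕ} (κ : ℤ) (P : MvPolynomial (Fin n) ℂ)
    (a : (Fin (n + 1) → ℤ) → ℂ) :
    LinearMap.funLeft ℂ ℂ (fun k : Fin n → ℤ => (Fin.cons κ k : Fin (n + 1) → ℤ)) (act (rename Fin.succ P) a) =
      act P (LinearMap.funLeft ℂ ℂ (fun k : Fin n → ℤ => (Fin.cons κ k : Fin (n + 1) → ℤ)) a) := by
  induction P using MvPolynomial.induction_on generalizing a with
  | C c => rw [rename_C, act_C, act_C, map_smul]
  | add p q hp hq => rw [map_add, act_add_apply, act_add_apply, map_add, hp, hq]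
  | mul_X p i hp =>
    rw [map_mul, rename_X, act_mul_apply, hp, act_mul_apply,
      funLeft_act_X (i := i) fun k => (cons_sub_single_succ κ k i).symm]

theorem funLeft_cons_unitSeries {n : ℕ} (κ : ℤ) :
    LinearMap.funLeft ℂ ℂ (fun k : Fin n → ℤ => (Fin.cons κ k : Fin (n + 1) → ℤ)) (unitSeries (Fin (n + 1))) =
      if κ = 0 then unitSeries (Fin n) else 0 := by
  ext k
  have : (Fin.cons κ k : Fin (n + 1) → ℤ) = 0 ↔ κ = 0 ∧ k = 0 := by
    rw [show (0 : Fin (n + 1) → ℤ) = Fin.cons 0 0 by ext i; induction i using Fin.cases <;> simp,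
      Fin.cons_inj]
  rw [LinearMap.funLeft_apply, unitSeries_apply]
  by_cases h : κ = 0
  · rw [if_pos h, unitSeries_apply]
    exact if_congr (by rw [this, and_iff_right h]) rfl rfl
  · rw [if_neg h, if_neg (fun h' => h (this.1 h').1)]
    rfl

/-- Slices fix the exponent of the first variable, which therefore moves between slices; the other
variables act inside them. -/
theorem act_transfer_nestTail {n : ℕ} {a b : (Fin (n + 2) → ℤ) → ℂ}
    (hab : ∀ κ : ℤ, SameRational (nestHom n) (nestedSeries (n + 1))
      (fun k => a (Fin.cons κ k)) (fun k => b (Fin.cons κ k)))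
    {P g : MvPolynomial (Fin (n + 2)) ℂ} (hP : act P a = act g (unitSeries _)) :
    act (nestTailHom n P) b = act (nestTailHom n g) (unitSeries _) := by
  refine act_transfer (nestTailHom n) (nestHom n)
    (fun κ : ℤ => LinearMap.funLeft ℂ ℂ fun k : Fin (n + 1) → ℤ => Fin.cons κ k)
    (fun κ : ℤ => LinearMap.funLeft ℂ ℂ fun k : Fin (n + 1) → ℤ => Fin.cons κ k) (fun i => ?_) (fun κ => ?_)
    (fun b hb => ?_) (actStable_nestedSeries _) (unitSeries_mem_nestedSeries _) hab hP
  · induction i using Fin.cases with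
    | zero =>
      refine Or.inr ⟨fun κ => κ - 1, fun κ a b => ⟨?_, ?_⟩⟩
      · ext k
        rw [LinearMap.funLeft_apply, act_X, cons_sub_single_zero]
        rfl
      · ext k
        rw [nestTailHom, aeval_X, Fin.cons_zero, LinearMap.funLeft_apply, act_X,
          cons_sub_single_zero]
        rfl
    | succ i =>
      refine Or.inl ⟨i, fun κ a b => ⟨?_, ?_⟩⟩
      · exact funLeft_act_X (fun k => (cons_sub_single_succ κ k i).symm) a
      · rw [nestTailHom, aeval_X, Fin.cons_succ, funLeft_cons_act_rename]
  · refine ⟨if κ = 0 then 1 else 0, ?_, ?_⟩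
    · rw [funLeft_cons_unitSeries]
      split_ifs
      · rw [act_one]
      · rw [map_zero]; rfl
    · rw [funLeft_cons_unitSeries]
      split_ifs
      · rw [map_one, act_one]
      · rw [map_zero, map_zero]; rfl
  · ext k
    have := congrFun (hb (k 0)) (Fin.tail k)
    rwa [LinearMap.funLeft_apply, Fin.cons_self_tail] at this

/-- Slices fix all exponents except the first two, so an identity for two operators suffices on each
of them. -/
theorem act_transfer_merge {m : ℕ} {a b : (Fin (m + 2) → ℤ) → ℂ}
    (hab : ∀ κ : Fin m → ℤ, SameRational (nestHom 1) (nestedSeries 2)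
      (fun k => a (Fin.cons (k 0) (Fin.cons (k 1) κ)))
      (fun k => b (Fin.cons (k 0) (Fin.cons (k 1) κ))))
    {P g : MvPolynomial (Fin (m + 2)) ℂ} (hP : act P a = act g (unitSeries _)) :
    act (mergeHom m P) b = act (mergeHom m g) (unitSeries _) := by
  have hsl0 : ∀ (κ : Fin m → ℤ) (k : Fin 2 → ℤ), (Fin.cons ((k - Pi.single 0 1 : Fin 2 → ℤ) 0)
      (Fin.cons ((k - Pi.single 0 1 : Fin 2 → ℤ) 1) κ) : Fin (m + 2) → ℤ) =
      Fin.cons (k 0) (Fin.cons (k 1) κ) - Pi.single 0 1 := by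
    intro κ k
    rw [cons_sub_single_zero]
    simp
  have hsl1 : ∀ (κ : Fin m → ℤ) (k : Fin 2 → ℤ), (Fin.cons ((k - Pi.single 1 1 : Fin 2 → ℤ) 0)
      (Fin.cons ((k - Pi.single 1 1 : Fin 2 → ℤ) 1) κ) : Fin (m + 2) → ℤ) =
      Fin.cons (k 0) (Fin.cons (k 1) κ) - Pi.single 1 1 := by
    intro κ k
    have h1 : (1 : Fin (m + 2)) = Fin.succ 0 := rfl
    rw [h1, cons_sub_single_succ, cons_sub_single_zero]
    simp
  have hslj : ∀ (κ : Fin m → ℤ) (k : Fin 2 → ℤ) (j : Fin m),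
      (Fin.cons (k 0) (Fin.cons (k 1) κ) : Fin (m + 2) → ℤ) - Pi.single j.succ.succ 1 =
        Fin.cons (k 0) (Fin.cons (k 1) (κ - Pi.single j 1)) := by
    intro κ k j
    rw [cons_sub_single_succ, cons_sub_single_succ]
  have hunit : ∀ κ : Fin m → ℤ, LinearMap.funLeft ℂ ℂ
      (fun k : Fin 2 → ℤ => (Fin.cons (k 0) (Fin.cons (k 1) κ) : Fin (m + 2) → ℤ))
      (unitSeries _) = if κ = 0 then unitSeries _ else 0 := by
    intro κ
    ext k
    have h : (Fin.cons (k 0) (Fin.cons (k 1) κ) : Fin (m + 2) → ℤ) = 0 ↔ k = 0 ∧ κ = 0 := by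
      constructor
      · intro h
        refine ⟨?_, ?_⟩
        · ext i
          fin_cases i
          · exact congrFun h 0
          · exact congrFun h 1
        · ext i
          exact congrFun h i.succ.succ
      · rintro ⟨rfl, rfl⟩
        ext i
        induction i using Fin.cases with
        | zero => rfl
        | succ i => induction i using Fin.cases <;> rfl
    rw [LinearMap.funLeft_apply, unitSeries_apply]
    by_cases hκ : κ = 0
    · rw [if_pos hκ, unitSeries_apply]
      exact if_congr (by rw [h, and_iff_left hκ]) rfl rfl
    · rw [if_neg hκ, if_neg (fun h' => hκ (h.1 h').2)]
      rfl
  refine act_transfer (mergeHom m) (nestHom 1)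
    (fun κ : Fin m → ℤ => LinearMap.funLeft ℂ ℂ
      fun k : Fin 2 → ℤ => Fin.cons (k 0) (Fin.cons (k 1) κ))
    (fun κ : Fin m → ℤ => LinearMap.funLeft ℂ ℂ
      fun k : Fin 2 → ℤ => Fin.cons (k 0) (Fin.cons (k 1) κ)) (fun i => ?_) (fun κ => ?_)
    (fun b hb => ?_) (actStable_nestedSeries _) (unitSeries_mem_nestedSeries _) hab hP
  · induction i using Fin.cases with
    | zero =>
      refine Or.inl ⟨0, fun κ a b => ⟨funLeft_act_X (hsl0 κ) a, ?_⟩⟩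
      rw [mergeHom, aeval_X, nestHom, aeval_X]
      exact funLeft_act_X (hsl1 κ) b
    | succ i =>
      induction i using Fin.cases with
      | zero =>
        refine Or.inl ⟨1, fun κ a b => ⟨funLeft_act_X (hsl1 κ) a, ?_⟩⟩
        rw [mergeHom, aeval_X, nestHom, aeval_X]
        change LinearMap.funLeft ℂ ℂ _ (act (X 1 + X 0) b) = act (X 1 + X 0) _
        rw [act_add_apply, map_add, act_add_apply]
        congr 1
        · exact funLeft_act_X (hsl1 κ) b
        · exact funLeft_act_X (hsl0 κ) b
      | succ i =>
        refine Or.inr ⟨fun κ => κ - Pi.single i 1, fun κ a b => ⟨?_, ?_⟩⟩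
        · ext k
          rw [LinearMap.funLeft_apply, act_X, hslj]
          rfl
        · ext k
          rw [mergeHom, aeval_X, Fin.cons_succ, Fin.cons_succ, LinearMap.funLeft_apply, act_X, hslj]
          rfl
  · refine ⟨if κ = 0 then 1 else 0, ?_, ?_⟩
    · rw [hunit]
      split_ifs
      · rw [act_one]
      · rw [map_zero]; rfl
    · rw [hunit]
      split_ifs
      · rw [map_one, act_one]
      · rw [map_zero, map_zero]; rfl
  · ext k
    have := congrFun (hb (Fin.tail (Fin.tail k))) ![k 0, k 1]
    rw [LinearMap.funLeft_apply] at this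
    refine Eq.trans (congrArg b ?_) this
    ext i
    induction i using Fin.cases with
    | zero => rfl
    | succ i => induction i using Fin.cases <;> rfl

end substitution

/-! ### Duality for the opposite vertex operator map -/

section duality

open MvPolynomial

variable {U : Type*} [AddCommGroup U] [Module ℂ U]

/-- A vertex operator map on a single space without vacuum and grading, which is rational and
associative when tested against the functionals in `Φ`. -/
structure IsRationalField (Y : U → U → ℤ → U) (D : Module.End ℂ U) (Φ : Set (Module.Dual ℂ U)) :
    Prop where
  vertexMap : IsVertexMap Y
  lowerTruncated : ∀ u v, LowerTruncated (Y u v)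
  D_derivative : ∀ u v (n : ℤ), ((n : ℂ) + 1) • Y u v (n + 1) = Y (D u) v n
  D_commutator : ∀ u v (n : ℤ), ((n : ℂ) + 1) • Y u v (n + 1) = D (Y u v n) - Y u (D v) n
  comp_mem : ∀ φ ∈ Φ, φ ∘ₗ D ∈ Φ
  nilpotent : ∀ φ ∈ Φ, ∃ N : ℕ, ∀ i ≥ N, φ ∘ₗ D ^ i = 0
  product_rational : ∀ (n : ℕ) (u : Fin n → U) (v : U), ∀ φ ∈ Φ,
    ProductRational fun k => φ (prodCoeff Y n u v k)
  iterate_rational : ∀ u₁ u₂ v : U, ∀ φ ∈ Φ,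
    IterateRational fun k => φ (Y (Y u₁ u₂ (k 0)) v (k 1))
  associativity : ∀ u₁ u₂ v : U, ∀ φ ∈ Φ,
    AssociativityHolds (fun k => φ (Y u₁ (Y u₂ v (k 1)) (k 0)))
      (fun k => φ (Y (Y u₁ u₂ (k 0)) v (k 1)))

theorem IsVertexMap.zero_left {Y : U → U → ℤ → U} (h : IsVertexMap Y) (b : U) (n : ℤ) :
    Y 0 b n = 0 := congrFun (h.linear_left b).map_zero n

theorem exists_add_mul_lt (x N : ℤ) {d : ℤ} (hd : d < 0) :
    ∃ M : ℕ, ∀ m : ℕ, m ≥ M → x + m * d < N := by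
  refine ⟨(x - N + 1).toNat, fun m hm => ?_⟩
  have : (m : ℤ) * d ≤ -m := by nlinarith [Int.natCast_nonneg m]
  omega

/-- The inner exponent is bounded below outright, the outer one only once the inner is fixed. This
is why the support condition is lexicographic. -/
theorem mem_nestedSeries_two {Y Y' : U → U → ℤ → U} (hY : IsVertexMap Y)
    (ht : ∀ u v, LowerTruncated (Y u v)) (ht' : ∀ u v, LowerTruncated (Y' u v))
    (φ : Module.Dual ℂ U) (u v w : U) :
    (fun k : Fin 2 → ℤ => φ (Y (Y' u v (k 0)) w (k 1))) ∈ nestedSeries 2 := by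
  rintro d ⟨j, hj, hj'⟩ k
  obtain ⟨N, hN⟩ := ht' u v
  obtain ⟨N', hN'⟩ := ht (Y' u v (k 0)) w
  fin_cases j
  · change d 0 < 0 at hj
    obtain ⟨M, hM⟩ := exists_add_mul_lt (k 0) N hj
    refine ⟨M, fun m hm => ?_⟩
    simp only
    rw [hN _ (by simpa using hM m hm), hY.zero_left, map_zero]
  · change d 1 < 0 at hj
    have h0 : d 0 = 0 := hj' 0 (by decide)
    obtain ⟨M, hM⟩ := exists_add_mul_lt (k 1) N' hj
    refine ⟨M, fun m hm => ?_⟩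
    have hk0 : (k + m • d) 0 = k 0 := by simp [h0]
    simp only
    rw [hk0, hN' _ (by simpa using hM m hm), map_zero]

/-- The coefficients of `Y(Z(uₙ₋₁, tₙ₋₁) ⋯ Z(u₀, t₀)v, tₙ)w`. -/
def nestCoeff {U : Type*} (Y Z : U → U → ℤ → U) :
    (n : ℕ) → U → (Fin n → U) → U → (Fin (n + 1) → ℤ) → U
  | 0, v, _, w, k => Y v w (k 0)
  | n + 1, v, u, w, k => nestCoeff Y Z n (Z (u 0) v (k 0)) (Fin.tail u) w (Fin.tail k)

theorem nestCoeff_zero_left {Y Z : U → U → ℤ → U} (hY : IsVertexMap Y) (hZ : IsVertexMap Z) (n : ℕ)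
    (u : Fin n → U) (w : U) (k : Fin (n + 1) → ℤ) : nestCoeff Y Z n 0 u w k = 0 := by
  induction n with
  | zero => exact hY.zero_left _ _
  | succ n ih =>
    rw [nestCoeff, show Z (u 0) 0 (k 0) = 0 from congrFun (hZ.linear_right _).map_zero _, ih]

theorem nestCoeff_mem_nestedSeries {Y Z : U → U → ℤ → U} (hY : IsVertexMap Y) (hZ : IsVertexMap Z)
    (ht : ∀ u v, LowerTruncated (Y u v)) (ht' : ∀ u v, LowerTruncated (Z u v))
    (φ : Module.Dual ℂ U) (n : ℕ) (v : U) (u : Fin n → U) (w : U) :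
    (fun k => φ (nestCoeff Y Z n v u w k)) ∈ nestedSeries (n + 1) := by
  induction n generalizing v with
  | zero =>
    rintro d ⟨j, hj, -⟩ k
    obtain rfl : j = 0 := Fin.fin_one_eq_zero j
    obtain ⟨N, hN⟩ := ht v w
    obtain ⟨M, hM⟩ := exists_add_mul_lt (k 0) N hj
    refine ⟨M, fun m hm => ?_⟩
    simp only [nestCoeff]
    rw [hN _ (by simpa using hM m hm), map_zero]
  | succ n ih =>
    rintro d ⟨j, hj, hj'⟩ k
    induction j using Fin.cases with
    | zero =>
      obtain ⟨N, hN⟩ := ht' (u 0) v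
      obtain ⟨M, hM⟩ := exists_add_mul_lt (k 0) N hj
      refine ⟨M, fun m hm => ?_⟩
      simp only [nestCoeff]
      rw [hN _ (by simpa using hM m hm), nestCoeff_zero_left hY hZ, map_zero]
    | succ j =>
      have h0 : d 0 = 0 := hj' 0 (Fin.succ_pos j)
      obtain ⟨M, hM⟩ := ih (Z (u 0) v (k 0)) (Fin.tail u) (Fin.tail d)
        ⟨j, hj, fun i hi => hj' i.succ (Fin.succ_lt_succ_iff.2 hi)⟩ (Fin.tail k)
      refine ⟨M, fun m hm => ?_⟩
      have hk0 : (k + m • d) 0 = k 0 := by simp [h0]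
      simp only [nestCoeff]
      rw [hk0]
      exact hM m hm

theorem prodCoeff_snoc {U : Type*} (Y : U → U → ℤ → U) (n : ℕ) (u : Fin (n + 1) → U) (w : U)
    (k : Fin (n + 1) → ℤ) : prodCoeff Y (n + 1) u w k =
      prodCoeff Y n (Fin.init u) (Y (u (Fin.last n)) w (k (Fin.last n))) (Fin.init k) := by
  induction n with
  | zero => rfl
  | succ n ih => rw [prodCoeff, ih, prodCoeff]; rfl

/-- The recursion of `nestCoeff` peels off the innermost operator, that of `prodCoeff` the
outermost; hence the reversal. -/
theorem nestCoeff_eq {U : Type*} (Y Z : U → U → ℤ → U) (n : ℕ) (v : U) (u : Fin n → U) (w : U)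
    (k : Fin (n + 1) → ℤ) : nestCoeff Y Z n v u w k =
      Y (prodCoeff Z n (u ∘ Fin.rev) v fun i => k i.rev.castSucc) w (k (Fin.last n)) := by
  induction n generalizing v with
  | zero => rfl
  | succ n ih =>
    rw [nestCoeff, ih, prodCoeff_snoc]
    congr 2
    · ext i
      simp [Fin.tail, Fin.init, Fin.rev_castSucc]
    · simp
    · ext i
      simp [Fin.tail, Fin.init, Fin.rev_castSucc]

theorem shiftSkewHom_iterateHom (P : MvPolynomial (Fin 2) ℂ) :
    shiftSkewHom (iterateHom P) = nestHom 1 P := by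
  have h : shiftSkewHom.comp iterateHom = (nestHom 1 : MvPolynomial (Fin 2) ℂ →ₐ[ℂ] _) := by
    refine algHom_ext (Fin.forall_fin_two.2 ⟨?_, ?_⟩)
    · simp [shiftSkewHom, iterateHom, nestHom]
    · simp [shiftSkewHom, iterateHom, nestHom]
  exact DFunLike.congr_fun h P

namespace IsRationalField

variable {Y : U → U → ℤ → U} {D : Module.End ℂ U} {Φ : Set (Module.Dual ℂ U)}

theorem lowerTruncated_skew (h : IsRationalField Y D Φ) (u v : U) :
    LowerTruncated (skew D Y u v) := _root_.lowerTruncated_skew D h.lowerTruncated u v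

theorem isVertexMap_skew (h : IsRationalField Y D Φ) : IsVertexMap (skew D Y) :=
  _root_.isVertexMap_skew D h.vertexMap h.lowerTruncated

theorem comp_pow_mem (h : IsRationalField Y D Φ) {φ : Module.Dual ℂ U} (hφ : φ ∈ Φ) (i : ℕ) :
    φ ∘ₗ D ^ i ∈ Φ := by
  induction i with
  | zero => rwa [pow_zero, Module.End.one_eq_id, LinearMap.comp_id]
  | succ i ih =>
    rw [pow_succ, Module.End.mul_eq_comp, ← LinearMap.comp_assoc]
    exact h.comp_mem _ ih

/-- Y(Yˢ(u,y)v,z)w = Y(Y(v,-y)u,z+y)w by Taylor's formula, and associativity identifies this with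
Y(v,z₀)Y(u,z₁)w at z₀ = z, z₁ = z + y. -/
theorem sameRational_merge (h : IsRationalField Y D Φ) {φ : Module.Dual ℂ U} (hφ : φ ∈ Φ)
    (v u w : U) : SameRational (nestHom 1) (nestedSeries 2)
      (fun k => φ (Y v (Y u w (k 1)) (k 0))) (fun k => φ (Y (skew D Y u v (k 0)) w (k 1))) := by
  refine ⟨mem_nestedSeries_two h.vertexMap h.lowerTruncated h.lowerTruncated_skew φ u v w, ?_⟩
  obtain ⟨P, hP, g, hPa, hPb⟩ := (h.associativity v u w φ hφ).exists_act_eq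
    (h.product_rational 2 ![v, u] w φ hφ) (h.iterate_rational v u w φ hφ)
  have hb := mem_nestedSeries_two h.vertexMap h.lowerTruncated h.lowerTruncated φ v u w
  have hshift : (fun k : Fin 2 → ℤ => φ (Y (skew D Y u v (k 0)) w (k 1))) =
      shiftSkew fun k => φ (Y (Y v u (k 0)) w (k 1)) := by
    ext k
    rw [skew_apply]
    refine map_seqSkew_eq_shiftSkew (L := fun l => φ ∘ₗ
      { toFun := fun x => Y x w l
        map_add' := fun x y => congrFun ((h.vertexMap.linear_left w).map_add x y) l
        map_smul' := fun c x => congrFun ((h.vertexMap.linear_left w).map_smul c x) l })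
      (fun l x => ?_) (h.lowerTruncated v u) k
    change φ (Y (D x) w l) = _ * φ (Y x w (l + 1))
    rw [← h.D_derivative, map_smul, smul_eq_mul]
  refine ⟨P, g, actRegular_nestHom hP, hPa, ?_⟩
  rw [hshift, ← shiftSkewHom_iterateHom, ← shiftSkewHom_iterateHom, ← shiftSkew_act _ hb, hPb,
    shiftSkew_act _ (unitSeries_mem_nestedSeries 2), shiftSkew_unitSeries]

theorem act_nestCoeff (h : IsRationalField Y D Φ) {φ : Module.Dual ℂ U} (hφ : φ ∈ Φ) (n : ℕ) (v : U)
    (u : Fin n → U) (w : U) {P g : MvPolynomial (Fin (n + 1)) ℂ}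
    (hP : act P (fun k => φ (prodCoeff Y (n + 1) (Fin.cons v u) w k)) = act g (unitSeries _)) :
    act (nestHom n P) (fun k => φ (nestCoeff Y (skew D Y) n v u w k)) =
      act (nestHom n g) (unitSeries _) := by
  induction n generalizing v with
  | zero =>
    have : ∀ Q, nestHom 0 Q = Q := by
      intro Q
      have h0 : nestHom 0 = AlgHom.id ℂ _ := by
        refine algHom_ext fun i => ?_
        obtain rfl : i = 0 := Fin.fin_one_eq_zero i
        rw [nestHom, aeval_X]
        rfl
      rw [h0, AlgHom.id_apply]
    rw [this, this]
    exact hP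
  | succ n ih =>
    rw [nestHom_succ, AlgHom.comp_apply, AlgHom.comp_apply]
    -- The intermediate series has only the first two factors merged: Y(Yˢ(u₀,t₀)v, ·) followed by
    -- the remaining original operators.
    refine act_transfer_nestTail (a := fun k =>
      φ (Y (skew D Y (u 0) v (k 0)) (prodCoeff Y n (Fin.tail u) w (Fin.tail (Fin.tail k))) (k 1)))
      (fun κ => ?_) ?_
    -- For a fixed exponent of t₀ the merged vector is an ordinary element, so the slice is a
    -- shorter product with its own denominator, and the induction hypothesis applies.
    · obtain ⟨Q, hQ, f, hf, -⟩ := (h.product_rational (n + 1)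
        (Fin.cons (skew D Y (u 0) v κ) (Fin.tail u)) w φ hφ).exists_act_eq
      exact ⟨nestCoeff_mem_nestedSeries h.vertexMap h.isVertexMap_skew h.lowerTruncated
        h.lowerTruncated_skew φ n (skew D Y (u 0) v κ) (Fin.tail u) w, Q, f, actRegular_nestHom hQ, hf, ih _ _ hf⟩
    · exact act_transfer_merge (fun κ => h.sameRational_merge hφ v (u 0)
        (prodCoeff Y n (Fin.tail u) w κ)) hP

end IsRationalField

/-- Intended for the functionals φ ∘ D^i, of which only finitely many are nonzero. -/
theorem exists_common_den {n : ℕ} {a : ℕ → (Fin n → ℤ) → ℂ} {N : ℕ} (hN : ∀ i ≥ N, a i = 0)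
    (h : ∀ i, ∃ P ∈ den (Fin n), ∃ g, act P (a i) = act g (unitSeries (Fin n))) :
    ∃ P ∈ den (Fin n), ∃ g : ℕ → MvPolynomial (Fin n) ℂ,
      ∀ i, act P (a i) = act (g i) (unitSeries (Fin n)) := by
  have key : ∀ M : ℕ, ∃ P ∈ den (Fin n), ∀ i < M, ∃ g, act P (a i) = act g (unitSeries (Fin n)) := by
    intro M
    induction M with
    | zero => exact ⟨1, (den _).one_mem, fun i hi => absurd hi (Nat.not_lt_zero i)⟩
    | succ M ih =>
      obtain ⟨P, hP, hPa⟩ := ih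
      obtain ⟨Q, hQ, f, hf⟩ := h M
      refine ⟨P * Q, (den _).mul_mem hP hQ, fun i hi => ?_⟩
      rcases Nat.lt_succ_iff_lt_or_eq.1 hi with hi | rfl
      · obtain ⟨g, hg⟩ := hPa i hi
        exact ⟨Q * g, by rw [mul_comm, act_mul_apply, hg, act_mul_apply]⟩
      · exact ⟨P * f, by rw [act_mul_apply, hf, act_mul_apply]⟩
  obtain ⟨P, hP, hPa⟩ := key N
  have : ∀ i, ∃ g, act P (a i) = act g (unitSeries (Fin n)) := by
    intro i
    rcases lt_or_ge i N with hi | hi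
    · exact hPa i hi
    · exact ⟨0, by rw [hN i hi, map_zero, map_zero]; rfl⟩
  choose g hg using this
  exact ⟨P, hP, g, hg⟩

/-! ### Products of opposite operators -/

/-- The substitution `z₀ = -x₀`, `zⱼ₊₁ = xₘ₋ⱼ - x₀`. -/
noncomputable def oppositeHom (m : ℕ) :
    MvPolynomial (Fin (m + 1)) ℂ →ₐ[ℂ] MvPolynomial (Fin (m + 1)) ℂ :=
  aeval (Fin.cons (-X 0) fun j : Fin m => X j.rev.succ - X 0)

theorem oppositeHom_mem_den {m : ℕ} {P : MvPolynomial (Fin (m + 1)) ℂ}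
    (hP : P ∈ den (Fin (m + 1))) : oppositeHom m P ∈ den (Fin (m + 1)) := by
  refine den_induction (p := fun P => oppositeHom m P ∈ den (Fin (m + 1))) (fun c hc => ?_)
    (fun i => ?_) (fun i j hij => ?_) (fun P Q hP hQ => ?_) hP
  · rw [oppositeHom, aeval_C]; exact C_mem_den hc
  · rw [oppositeHom, aeval_X]
    induction i using Fin.cases with
    | zero => exact neg_mem_den (X_mem_den 0)
    | succ j => exact X_sub_X_mem_den (Fin.succ_ne_zero _)
  · rw [oppositeHom, map_sub, aeval_X, aeval_X]
    obtain ⟨j, rfl⟩ : ∃ j', j = Fin.succ j' := Fin.exists_succ_eq.2 (Fin.ne_zero_of_lt hij) |>.imp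
      fun _ h => h.symm
    induction i using Fin.cases with
    | zero =>
      rw [Fin.cons_succ, Fin.cons_zero, show -X 0 - (X j.rev.succ - X 0) =
        -(X j.rev.succ : MvPolynomial (Fin (m + 1)) ℂ) by ring]
      exact neg_mem_den (X_mem_den _)
    | succ i =>
      rw [Fin.cons_succ, Fin.cons_succ, sub_sub_sub_cancel_right]
      refine X_sub_X_mem_den fun he => hij.ne ?_
      rw [Fin.rev_injective (Fin.succ_injective _ he)]
  · rw [map_mul]; exact (den _).mul_mem hP hQ

/-- The reversed point with the sign of the last coordinate changed. -/
def reversePoint {m : ℕ} (z : Fin (m + 1) → ℂ) : Fin (m + 1) → ℂ :=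
  Fin.snoc (fun j => z j.rev.succ) (-z 0)

theorem norm_reversePoint {m : ℕ} (z : Fin (m + 1) → ℂ) (j : Fin (m + 1)) :
    ‖reversePoint z j‖ = ‖z j.rev‖ := by
  induction j using Fin.lastCases with
  | last => simp [reversePoint]
  | cast j => simp [reversePoint, Fin.rev_castSucc]

theorem reversePoint_mem_nestedRegion {m : ℕ} {z : Fin (m + 1) → ℂ}
    (hz : z ∈ productRegion (m + 1)) : reversePoint z ∈ nestedRegion (m + 1) := by
  refine ⟨fun i j hij => ?_, fun i => ?_⟩
  · rw [norm_reversePoint, norm_reversePoint]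
    exact hz.1 _ _ (Fin.rev_lt_rev.2 hij)
  · rw [← norm_pos_iff, norm_reversePoint]
    exact hz.2 _

theorem eval_reversePoint_nestHom {m : ℕ} (z : Fin (m + 1) → ℂ) (P : MvPolynomial (Fin (m + 1)) ℂ) :
    eval (reversePoint z) (nestHom m P) = eval z (oppositeHom m P) := by
  rw [nestHom, oppositeHom, eval_aeval, eval_aeval]
  congr 2
  ext i
  induction i using Fin.cases with
  | zero => simp [reversePoint]
  | succ i => simp [reversePoint]; ring

theorem act_X_pow {n : ℕ} (i : Fin n) (m : ℕ) (a : (Fin n → ℤ) → ℂ) (k : Fin n → ℤ) :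
    act (X i ^ m) a k = a (k - m • Pi.single i 1) := by
  rw [X_pow_eq_monomial, act_monomial, one_mul]
  congr 1
  ext j
  by_cases h : j = i
  · subst h; simp
  · simp [h]

theorem HasLaurentSum.reverse {m : ℕ} {z : Fin (m + 1) → ℂ} {b : (Fin (m + 1) → ℤ) → ℂ} {s : ℂ}
    (h : HasLaurentSum (reversePoint z) b s) :
    HasLaurentSum z (fun k => (-1) ^ k 0 * b (k ∘ Fin.rev)) s := by
  let e : (Fin (m + 1) → ℤ) ≃ (Fin (m + 1) → ℤ) := Equiv.arrowCongr Fin.revPerm (Equiv.refl ℤ)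
  have he : ∀ k, laurentTerm (fun k => (-1) ^ k 0 * b (k ∘ Fin.rev)) z k =
      laurentTerm b (reversePoint z) (e k) := by
    intro k
    have h1 : ∏ i, reversePoint z i ^ e k i = (-1) ^ k 0 * ∏ i, z i ^ k i := by
      rw [Fin.prod_univ_castSucc, Fin.prod_univ_succ, ← Equiv.prod_comp Fin.revPerm]
      simp only [e, reversePoint, Equiv.arrowCongr_apply, Function.comp_apply, Fin.revPerm_symm,
        Fin.revPerm_apply, Equiv.refl_apply, Fin.snoc_castSucc, Fin.snoc_last, Fin.rev_castSucc,
        Fin.rev_rev, Fin.rev_last]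
      rw [neg_eq_neg_one_mul (z 0), mul_zpow]
      ring
    have h2 : e k = k ∘ Fin.rev := by
      ext i
      simp [e]
    rw [laurentTerm, laurentTerm, h1, h2]
    ring
  refine ⟨?_, ?_⟩
  · simp only [he]
    exact e.summable_iff (f := fun k => ‖laurentTerm b (reversePoint z) k‖) |>.2 h.1
  · simp only [he]
    rw [← h.2]
    exact e.tsum_eq (laurentTerm b (reversePoint z))

theorem HasLaurentSum.sum {n : ℕ} {z : Fin n → ℂ} {a : ℕ → (Fin n → ℤ) → ℂ} {s : ℕ → ℂ} (N : ℕ)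
    (h : ∀ i, HasLaurentSum z (a i) (s i)) :
    HasLaurentSum z (∑ i ∈ Finset.range N, a i) (∑ i ∈ Finset.range N, s i) := by
  induction N with
  | zero => simpa using (hasLaurentSum_unitSeries z).smul 0
  | succ N ih =>
    rw [Finset.sum_range_succ, Finset.sum_range_succ]
    exact ih.add (h N)

/-- The numerator of the rational function of a product of opposite vertex operators. -/
noncomputable def oppositeNumerator {m : ℕ} (g : ℕ → MvPolynomial (Fin (m + 1)) ℂ) (N : ℕ) :
    MvPolynomial (Fin (m + 1)) ℂ :=
  ∑ i ∈ Finset.range N, C ((i.factorial : ℂ)⁻¹) * X 0 ^ i * oppositeHom m (g i)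

namespace IsRationalField

variable {Y : U → U → ℤ → U} {D : Module.End ℂ U} {Φ : Set (Module.Dual ℂ U)}

/-- The outermost opposite operator is expanded as e^{x₀D}Y(·,-x₀)u₀, and φ ∘ D^i is applied to the
nested series at the reversed point. The i-th term carries x₀^i / i!, which explains
`oppositeNumerator`. -/
theorem hasLaurentSum_skew_product (h : IsRationalField Y D Φ) {φ : Module.Dual ℂ U} (hφ : φ ∈ Φ)
    {N : ℕ} (hN : ∀ i ≥ N, φ ∘ₗ D ^ i = 0) (m : ℕ) (u : Fin (m + 1) → U) (v : U)
    {P : MvPolynomial (Fin (m + 1)) ℂ} (hP : P ∈ den (Fin (m + 1)))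
    {g : ℕ → MvPolynomial (Fin (m + 1)) ℂ}
    (hg : ∀ i, act P (fun k => (φ ∘ₗ D ^ i) (prodCoeff Y (m + 1)
      (Fin.cons v (Fin.tail u ∘ Fin.rev)) (u 0) k)) = act (g i) (unitSeries _))
    {z : Fin (m + 1) → ℂ} (hz : z ∈ productRegion (m + 1)) :
    HasLaurentSum z (fun k => φ (prodCoeff (skew D Y) (m + 1) u v k))
      (eval z (oppositeNumerator g N) / eval z (oppositeHom m P)) := by
  have hz0 := ne_zero_of_mem_productRegion hz
  have hden : eval z (oppositeHom m P) ≠ 0 := eval_ne_zero_of_mem_den (oppositeHom_mem_den hP) hz0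
    fun i j => ne_of_mem_productRegion hz
  set b : ℕ → (Fin (m + 1) → ℤ) → ℂ := fun i k =>
    (φ ∘ₗ D ^ i) (nestCoeff Y (skew D Y) m v (Fin.tail u ∘ Fin.rev) (u 0) k) with hb
  have hbs : ∀ i, HasLaurentSum (reversePoint z) (b i)
      (eval z (oppositeHom m (g i)) / eval z (oppositeHom m P)) := by
    intro i
    have hreg := reversePoint_mem_nestedRegion hz
    have := hasLaurentSum_div hreg.2 (nestCoeff_mem_nestedSeries h.vertexMap h.isVertexMap_skew
      h.lowerTruncated h.lowerTruncated_skew (φ ∘ₗ D ^ i) m v (Fin.tail u ∘ Fin.rev) (u 0))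
      (reflectsSum_nestHom hP hreg) (by rwa [eval_reversePoint_nestHom])
      (h.act_nestCoeff (h.comp_pow_mem hφ i) m v _ _ (hg i))
    rwa [eval_reversePoint_nestHom, eval_reversePoint_nestHom] at this
  have hc : (fun k => φ (prodCoeff (skew D Y) (m + 1) u v k)) = ∑ i ∈ Finset.range N,
      act (C ((i.factorial : ℂ)⁻¹) * X 0 ^ i) (fun k => (-1) ^ k 0 * b i (k ∘ Fin.rev)) := by
    ext k
    rw [prodCoeff, skew_apply, dual_seqSkew D (h.lowerTruncated _ _) φ hN, Finset.sum_apply]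
    refine Finset.sum_congr rfl fun i _ => ?_
    rw [act_mul_apply, act_C, Pi.smul_apply, act_X_pow, smul_eq_mul, ← mul_assoc, hb]
    simp only [nestCoeff_eq]
    have h1 : ∀ j : Fin m, ((k - i • Pi.single 0 1) ∘ Fin.rev) j.rev.castSucc = Fin.tail k j := by
      intro j
      simp [Fin.tail, Fin.rev_castSucc]
    have h2 : (Fin.tail u ∘ Fin.rev) ∘ Fin.rev = Fin.tail u := by
      ext j
      simp
    have h3 : ((k - i • Pi.single 0 1) ∘ Fin.rev) (Fin.last m) = k 0 - i := by
      simp [Fin.rev_last]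
    have h4 : (k - i • Pi.single 0 1 : Fin (m + 1) → ℤ) 0 = k 0 - i := by simp
    simp only [h1, h2, h3, h4]
  rw [hc]
  convert HasLaurentSum.sum N fun i => (hbs i).reverse.act hz0 (C ((i.factorial : ℂ)⁻¹) * X 0 ^ i)
    using 1
  rw [oppositeNumerator, map_sum, Finset.sum_div]
  refine Finset.sum_congr rfl fun i _ => ?_
  rw [map_mul, mul_div_assoc]

theorem exists_opposite_den (h : IsRationalField Y D Φ) {φ : Module.Dual ℂ U} (hφ : φ ∈ Φ)
    (n : ℕ) (u : Fin n → U) (v : U) : ∃ P ∈ den (Fin n), ∃ g : ℕ → MvPolynomial (Fin n) ℂ,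
      ∀ i, act P (fun k => (φ ∘ₗ D ^ i) (prodCoeff Y n u v k)) = act (g i) (unitSeries _) := by
  obtain ⟨N, hN⟩ := h.nilpotent φ hφ
  refine exists_common_den (N := N) (fun i hi => ?_) fun i => ?_
  · rw [hN i hi]
    rfl
  · obtain ⟨P, hP, g, hPg, -⟩ := (h.product_rational n u v _ (h.comp_pow_mem hφ i)).exists_act_eq
    exact ⟨P, hP, g, hPg⟩

theorem skew_product_rational (h : IsRationalField Y D Φ) (n : ℕ) (u : Fin n → U) (v : U)
    {φ : Module.Dual ℂ U} (hφ : φ ∈ Φ) :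
    ProductRational fun k => φ (prodCoeff (skew D Y) n u v k) := by
  rcases n with _ | m
  · exact h.product_rational 0 u v φ hφ
  · obtain ⟨N, hN⟩ := h.nilpotent φ hφ
    obtain ⟨P, hP, g, hg⟩ := h.exists_opposite_den hφ (m + 1)
      (Fin.cons v (Fin.tail u ∘ Fin.rev)) (u 0)
    exact ⟨_, isRationalWithPoles_div (oppositeHom_mem_den hP) _,
      fun z hz => h.hasLaurentSum_skew_product hφ hN m u v hP hg hz⟩

end IsRationalField

end duality

/-! ### Iterates of the opposite vertex operator map -/

section iterates

open MvPolynomial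

theorem eq_zero_and_eq_one_of_lt {i j : Fin 2} (h : i < j) : i = 0 ∧ j = 1 := by omega

/-- The substitution `(z, y) ↦ (-y, z)` of formal series, with the variables interchanged. -/
noncomputable def flipSeries (a : (Fin 2 → ℤ) → ℂ) (k : Fin 2 → ℤ) : ℂ := (-1) ^ k 1 * a ![k 1, k 0]

/-- The substitution `z₀ = -X₁`, `z₁ = X₀`. -/
noncomputable def flipHom : MvPolynomial (Fin 2) ℂ →ₐ[ℂ] MvPolynomial (Fin 2) ℂ :=
  aeval ![-X 1, X 0]

theorem flipSeries_act (P : MvPolynomial (Fin 2) ℂ) (a : (Fin 2 → ℤ) → ℂ) :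
    flipSeries (act P a) = act (flipHom P) (flipSeries a) := by
  refine act_intertwine flipHom (M := ⊤) (fun _ _ _ => trivial) flipSeries (fun a _ b _ => ?_)
    (fun c a _ => ?_) ?_ P trivial
  · ext k
    simp [flipSeries, mul_add]
  · ext k
    simp only [flipSeries, Pi.smul_apply, smul_eq_mul]
    ring
  · refine Fin.forall_fin_two.2 ⟨fun a _ => ?_, fun a _ => ?_⟩
    · ext k
      have h : (![k 1, k 0] - Pi.single 0 1 : Fin 2 → ℤ) = ![(k - Pi.single 1 1 : Fin 2 → ℤ) 1,
          (k - Pi.single 1 1 : Fin 2 → ℤ) 0] := by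
        ext i; fin_cases i <;> simp
      rw [flipHom, aeval_X, Matrix.cons_val_zero, map_neg, LinearMap.neg_apply, Pi.neg_apply, act_X,
        flipSeries, flipSeries, act_X, h]
      have h1 : (k - Pi.single 1 1 : Fin 2 → ℤ) 1 = k 1 - 1 := by simp
      rw [h1, zpow_sub_one₀ (by norm_num)]
      norm_num
    · ext k
      have h : (![k 1, k 0] - Pi.single 1 1 : Fin 2 → ℤ) = ![(k - Pi.single 0 1 : Fin 2 → ℤ) 1,
          (k - Pi.single 0 1 : Fin 2 → ℤ) 0] := by
        ext i; fin_cases i <;> simp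
      rw [flipHom, aeval_X, Matrix.cons_val_one, Matrix.cons_val_fin_one, act_X, flipSeries,
        flipSeries, act_X, h]
      simp

theorem flipSeries_unitSeries : flipSeries (unitSeries (Fin 2)) = unitSeries (Fin 2) := by
  ext k
  have h : ![k 1, k 0] = 0 ↔ k = 0 := by
    rw [funext_iff, funext_iff, Fin.forall_fin_two, Fin.forall_fin_two]
    simp [and_comm]
  rw [flipSeries, unitSeries_apply, unitSeries_apply]
  by_cases hk : k = 0
  · simp [hk]
  · rw [if_neg hk, if_neg (fun h' => hk (h.1 h')), mul_zero]

/-- The generators z₀, z₁, z₀ - z₁ become -(z + y), -y, -z, all invertible by expansion for |y| <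
|z|. -/
theorem reflectsSum_shiftSkewHom_flipHom {P : MvPolynomial (Fin 2) ℂ} (hP : P ∈ den (Fin 2))
    {t : Fin 2 → ℂ} (ht : t ∈ nestedRegion 2) :
    ReflectsSum t (nestedSeries 2) (shiftSkewHom (flipHom P)) := by
  have hmul : ∀ P Q, ReflectsSum t (nestedSeries 2) P → ReflectsSum t (nestedSeries 2) Q →
      ReflectsSum t (nestedSeries 2) (P * Q) := fun P Q hP hQ =>
    hP.mul (actStable_nestedSeries 2) hQ
  have hneg : ∀ P, ReflectsSum t (nestedSeries 2) P → ReflectsSum t (nestedSeries 2) (-P) :=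
    fun P hP => by simpa using hmul _ _ (reflectsSum_C (c := -1) (by simp)) hP
  have h0 : shiftSkewHom (flipHom (X 0)) = -(X 1 + C 1 * X 0) := by
    simp [shiftSkewHom, flipHom]
  have h1 : shiftSkewHom (flipHom (X 1)) = -X 0 := by
    simp [shiftSkewHom, flipHom]
  refine den_induction (p := fun P => ReflectsSum t (nestedSeries 2) (shiftSkewHom (flipHom P)))
    (fun c hc => ?_) ?_ ?_ (fun P Q hP hQ => by rw [map_mul, map_mul]; exact hmul _ _ hP hQ) hP
  · rw [flipHom, aeval_C, algebraMap_eq, shiftSkewHom, aeval_C]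
    exact reflectsSum_C hc
  · refine Fin.forall_fin_two.2 ⟨?_, ?_⟩
    · rw [h0]
      exact hneg _ (reflectsSum_linear_of_mem_nestedRegion ht (by decide) (by simp))
    · rw [h1]
      exact hneg _ (reflectsSum_X ht.2 0)
  · intro i j hij
    obtain ⟨rfl, rfl⟩ : i = 0 ∧ j = 1 := eq_zero_and_eq_one_of_lt hij
    rw [map_sub, map_sub, h0, h1, show -(X 1 + C 1 * X 0) - -X 0 =
      -(X 1 : MvPolynomial (Fin 2) ℂ) by simp]
    exact hneg _ (reflectsSum_X ht.2 1)

/-- The source of associativity: with y = z₁ - z₂ and z = z₂, iterates and products evaluate their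
rational function at the same point (-z₁, z₂ - z₁). -/
theorem eval_shiftSkewHom_flipHom (z₁ z₂ : ℂ) (P : MvPolynomial (Fin 2) ℂ) :
    eval ![z₁ - z₂, z₂] (shiftSkewHom (flipHom P)) = eval ![z₁, z₂] (oppositeHom 1 P) := by
  rw [shiftSkewHom, flipHom, oppositeHom, eval_aeval, eval_aeval, eval_aeval]
  congr 2
  ext i
  revert i
  refine Fin.forall_fin_two.2 ⟨?_, ?_⟩
  · simp
  · simp

variable {U : Type*} [AddCommGroup U] [Module ℂ U]

namespace IsRationalField

variable {Y : U → U → ℤ → U} {D : Module.End ℂ U} {Φ : Set (Module.Dual ℂ U)}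

/-- Unfolding the inner opposite operator is the substitution (y, z) ↦ (-y, z + y) in
Yˢ(Y(u₂,y)u₁,z)v = e^{zD}Y(v,-z)Y(u₂,y)u₁. Only rationality of products of two operators is used,
not associativity. -/
theorem hasLaurentSum_skew_iterate (h : IsRationalField Y D Φ) {φ : Module.Dual ℂ U}
    {N : ℕ} (hN : ∀ i ≥ N, φ ∘ₗ D ^ i = 0) (u₁ u₂ v : U)
    {P : MvPolynomial (Fin 2) ℂ} (hP : P ∈ den (Fin 2)) {g : ℕ → MvPolynomial (Fin 2) ℂ}
    (hg : ∀ i, act P (fun k => (φ ∘ₗ D ^ i) (Y v (Y u₂ u₁ (k 1)) (k 0))) =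
      act (g i) (unitSeries (Fin 2)))
    {z₁ z₂ : ℂ} (h1 : ‖z₁ - z₂‖ < ‖z₂‖) (h2 : 0 < ‖z₁ - z₂‖) :
    HasLaurentSum ![z₁ - z₂, z₂] (fun k => φ (skew D Y (skew D Y u₁ u₂ (k 0)) v (k 1)))
      (eval ![z₁, z₂] (oppositeNumerator (m := 1) g N) / eval ![z₁, z₂] (oppositeHom 1 P)) := by
  set f : (Fin 2 → ℤ) → ℂ := fun k => φ (skew D Y (Y u₂ u₁ (k 0)) v (k 1)) with hf
  have hfm : f ∈ nestedSeries 2 := mem_nestedSeries_two h.isVertexMap_skew h.lowerTruncated_skew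
    h.lowerTruncated φ u₂ u₁ v
  have he : (fun k : Fin 2 → ℤ => φ (skew D Y (skew D Y u₁ u₂ (k 0)) v (k 1))) = shiftSkew f := by
    ext k
    rw [skew_apply D Y u₂ u₁]
    refine map_seqSkew_eq_shiftSkew (L := fun l => φ ∘ₗ
      { toFun := fun x => skew D Y x v l
        map_add' := fun x y => congrFun ((h.isVertexMap_skew.linear_left v).map_add x y) l
        map_smul' := fun c x => congrFun ((h.isVertexMap_skew.linear_left v).map_smul c x) l })
      (fun l x => ?_) (h.lowerTruncated u₂ u₁) k
    change φ (skew D Y (D x) v l) = _ * φ (skew D Y x v (l + 1))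
    rw [← skew_deriv D h.lowerTruncated h.D_commutator, map_smul, smul_eq_mul]
  have hem := mem_nestedSeries_two h.isVertexMap_skew h.lowerTruncated_skew h.lowerTruncated_skew
    φ u₁ u₂ v
  set F : MvPolynomial (Fin 2) ℂ :=
    ∑ i ∈ Finset.range N, C ((i.factorial : ℂ)⁻¹) * X 1 ^ i * flipHom (g i) with hF
  have hfsum : f = ∑ i ∈ Finset.range N, act (C ((i.factorial : ℂ)⁻¹) * X 1 ^ i)
      (flipSeries fun k => (φ ∘ₗ D ^ i) (Y v (Y u₂ u₁ (k 1)) (k 0))) := by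
    ext k
    rw [hf]
    simp only
    rw [skew_apply, dual_seqSkew D (h.lowerTruncated _ _) φ hN, Finset.sum_apply]
    refine Finset.sum_congr rfl fun i _ => ?_
    rw [act_mul_apply, act_C, Pi.smul_apply, act_X_pow, smul_eq_mul, flipSeries, mul_assoc]
    simp
  have hPf : act (flipHom P) f = act F (unitSeries (Fin 2)) := by
    rw [hfsum, map_sum, hF, map_sum, LinearMap.sum_apply]
    refine Finset.sum_congr rfl fun i _ => ?_
    rw [act_comm, ← flipSeries_act, hg, flipSeries_act, flipSeries_unitSeries, ← act_mul_apply]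
  have hPe : act (shiftSkewHom (flipHom P)) (shiftSkew f) =
      act (shiftSkewHom F) (unitSeries (Fin 2)) := by
    rw [← shiftSkew_act _ hfm, hPf, shiftSkew_act _ (unitSeries_mem_nestedSeries 2),
      shiftSkew_unitSeries]
  have hreg : ![z₁ - z₂, z₂] ∈ nestedRegion 2 := by
    have hz2 : z₂ ≠ 0 := norm_pos_iff.1 (h2.trans h1)
    refine ⟨fun i j hij => ?_, Fin.forall_fin_two.2 ⟨norm_pos_iff.1 h2, hz2⟩⟩
    obtain ⟨rfl, rfl⟩ := eq_zero_and_eq_one_of_lt hij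
    exact h1
  have h3 : z₁ ≠ 0 := by
    rintro rfl
    rw [zero_sub, norm_neg] at h1
    exact lt_irrefl _ h1
  have hne : eval ![z₁, z₂] (oppositeHom 1 P) ≠ 0 := by
    refine eval_ne_zero_of_mem_den (oppositeHom_mem_den hP)
      (Fin.forall_fin_two.2 ⟨h3, hreg.2 1⟩) fun i j hij => ?_
    obtain ⟨rfl, rfl⟩ := eq_zero_and_eq_one_of_lt hij
    exact sub_ne_zero.1 (norm_pos_iff.1 h2)
  have hFe : eval ![z₁ - z₂, z₂] (shiftSkewHom F) =
      eval ![z₁, z₂] (oppositeNumerator (m := 1) g N) := by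
    rw [hF, oppositeNumerator, map_sum, map_sum, map_sum]
    refine Finset.sum_congr rfl fun i _ => ?_
    rw [map_mul, map_mul, eval_shiftSkewHom_flipHom, map_mul, map_mul, map_mul, map_mul, map_pow,
      map_pow]
    simp [shiftSkewHom]
  rw [he] at hem ⊢
  rw [← eval_shiftSkewHom_flipHom] at hne
  have := hasLaurentSum_div hreg.2 hem (reflectsSum_shiftSkewHom_flipHom hP hreg) hne hPe
  rwa [hFe, eval_shiftSkewHom_flipHom] at this

theorem exists_skew_duality (h : IsRationalField Y D Φ) {φ : Module.Dual ℂ U} (hφ : φ ∈ Φ)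
    (u₁ u₂ v : U) :
    IterateRational (fun k => φ (skew D Y (skew D Y u₁ u₂ (k 0)) v (k 1))) ∧
    AssociativityHolds (fun k => φ (skew D Y u₁ (skew D Y u₂ v (k 1)) (k 0)))
      (fun k => φ (skew D Y (skew D Y u₁ u₂ (k 0)) v (k 1))) := by
  obtain ⟨N, hN⟩ := h.nilpotent φ hφ
  obtain ⟨P, hP, g, hg⟩ := h.exists_opposite_den hφ 2 ![v, u₂] u₁
  have hit := fun z₁ z₂ h1 h2 =>
    h.hasLaurentSum_skew_iterate hN u₁ u₂ v hP hg (z₁ := z₁) (z₂ := z₂) h1 h2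
  refine ⟨⟨fun z => eval z (oppositeNumerator (m := 1) g N) / eval z (oppositeHom 1 P),
    isRationalWithPoles_div (oppositeHom_mem_den hP) _, fun z₁ z₂ h1 h2 => hit z₁ z₂ h1 h2⟩,
    fun z₁ z₂ h1 h2 h3 => ?_⟩
  rw [(hit z₁ z₂ h2 h3).2]
  have hv : (Fin.cons v (Fin.tail ![u₁, u₂] ∘ Fin.rev) : Fin 2 → U) = ![v, u₂] := by
    ext i
    revert i
    exact Fin.forall_fin_two.2 ⟨rfl, rfl⟩
  exact (h.hasLaurentSum_skew_product hφ hN 1 ![u₁, u₂] v hP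
    (fun i => by rw [hv]; exact hg i) (vec_mem_productRegion h1 (h3.trans h2))).2

end IsRationalField

end iterates

/-! ### Components of products on V × W -/

theorem prodCoeff_fst {V W : Type*} {Y : V → V → ℤ → V} {P : V × W → V × W → ℤ → V × W}
    (h : ∀ p q n, (P p q n).1 = Y p.1 q.1 n) (n : ℕ) (u : Fin n → V × W) (w : V × W)
    (k : Fin n → ℤ) : (prodCoeff P n u w k).1 = prodCoeff Y n (fun i => (u i).1) w.1 k := by
  induction n with
  | zero => rfl
  | succ n ih =>
    rw [prodCoeff, h, ih]
    rfl

theorem prodCoeff_snd {V W : Type*} {Y : V → W → ℤ → W} {P : V × W → V × W → ℤ → V × W}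
    (h : ∀ p q n, (P p q n).2 = Y p.1 q.2 n) (n : ℕ) (u : Fin n → V × W) (w : V × W)
    (k : Fin n → ℤ) : (prodCoeff P n u w k).2 = prodCoeff Y n (fun i => (u i).1) w.2 k := by
  induction n with
  | zero => rfl
  | succ n ih =>
    rw [prodCoeff, h, ih]
    rfl

/-! ### Gradings -/

section gradings

variable {ι W : Type*} [AddCommGroup W] [Module ℂ W] {𝒲 : ι → Submodule ℂ W} {c : ι → ℂ}

/-- The other eigenspaces already span W, and eigenspaces are independent. -/
theorem eq_zero_of_eigenvalue {d : Module.End ℂ W} (hsup : ⨆ i, 𝒲 i = ⊤)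
    (hd : ∀ i, ∀ w ∈ 𝒲 i, d w = c i • w) {μ : ℂ} (hμ : ∀ i, c i = μ → 𝒲 i = ⊥) {w : W}
    (hw : d w = μ • w) : w = 0 := by
  have h1 : (⨆ ν, ⨆ _ : ν ≠ μ, d.eigenspace ν) = ⊤ := by
    rw [eq_top_iff, ← hsup]
    refine iSup_le fun i => ?_
    by_cases hi : c i = μ
    · rw [hμ i hi]
      exact bot_le
    · exact le_trans (fun w hw => Module.End.mem_eigenspace_iff.2 (hd i w hw))
        (le_iSup₂_of_le (c i) hi le_rfl)
  have h2 := d.eigenspaces_iSupIndep μ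
  rw [h1] at h2
  have : w ∈ d.eigenspace μ := Module.End.mem_eigenspace_iff.2 hw
  rwa [h2.eq_bot_of_le le_top, Submodule.mem_bot] at this

theorem mem_of_eigenvalue {d : Module.End ℂ W} (hc : Function.Injective c) (hsup : ⨆ i, 𝒲 i = ⊤)
    (hd : ∀ i, ∀ w ∈ 𝒲 i, d w = c i • w) {i : ι} {w : W} (hw : d w = c i • w) : w ∈ 𝒲 i := by
  have h1 : 𝒲 i ⊔ ⨆ ν, ⨆ _ : ν ≠ c i, d.eigenspace ν = ⊤ := by
    rw [eq_top_iff, ← hsup]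
    refine iSup_le fun j => ?_
    by_cases hj : j = i
    · rw [hj]
      exact le_sup_left
    · exact le_trans (fun w hw => Module.End.mem_eigenspace_iff.2 (hd j w hw))
        (le_sup_of_le_right (le_iSup₂_of_le (c j) (hc.ne hj) le_rfl))
  obtain ⟨x, hx, y, hy, rfl⟩ := Submodule.mem_sup.1 (h1 ▸ Submodule.mem_top : w ∈ _)
  have hy' : y ∈ d.eigenspace (c i) := by
    rw [Module.End.mem_eigenspace_iff]
    rw [map_add, hd i x hx, smul_add] at hw
    exact add_left_cancel hw
  rw [Submodule.disjoint_def.1 (d.eigenspaces_iSupIndep (c i)) y hy' hy, add_zero]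
  exact hx

/-- For homogeneous a and b the coefficient of x^n has weight wt a + wt b + n, which eventually
falls below the lower bound. -/
theorem lowerTruncated_of_grading {ι₁ ι₂ X Z : Type*} [AddCommGroup X] [Module ℂ X]
    [AddCommGroup Z] [Module ℂ Z] {𝒳 : ι₁ → Submodule ℂ X} {𝒵 : ι₂ → Submodule ℂ Z} {c₁ : ι₁ → ℂ}
    {c₂ : ι₂ → ℂ} {d : Module.End ℂ W} {d₁ : X → X} {d₂ : Z → Z} (hsup : ⨆ i, 𝒲 i = ⊤)
    (hsup₁ : ⨆ i, 𝒳 i = ⊤) (hsup₂ : ⨆ i, 𝒵 i = ⊤) (hd : ∀ i, ∀ w ∈ 𝒲 i, d w = c i • w)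
    (hd₁ : ∀ i, ∀ w ∈ 𝒳 i, d₁ w = c₁ i • w) (hd₂ : ∀ i, ∀ w ∈ 𝒵 i, d₂ w = c₂ i • w) {r : ℝ}
    (hr : ∀ i, (c i).re < r → 𝒲 i = ⊥) {Y : X → Z → ℤ → W} (hY : IsVertexMap Y)
    (h : ∀ a b (n : ℤ), d (Y a b n) - Y a (d₂ b) n = Y (d₁ a) b n + (n : ℂ) • Y a b n) (a : X)
    (b : Z) : LowerTruncated (Y a b) := by
  have hadd : ∀ s t : ℤ → W, LowerTruncated s → LowerTruncated t → LowerTruncated (s + t) := by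
    rintro s t ⟨N, hN⟩ ⟨N', hN'⟩
    exact ⟨min N N', fun n hn => by
      rw [Pi.add_apply, hN n (by omega), hN' n (by omega), add_zero]⟩
  have hzero : LowerTruncated (0 : ℤ → W) := ⟨0, fun _ _ => rfl⟩
  refine Submodule.iSup_induction 𝒳 (motive := fun a => LowerTruncated (Y a b))
    (hsup₁ ▸ Submodule.mem_top) (fun i a ha => ?_) ?_ fun a a' ha ha' => ?_
  · refine Submodule.iSup_induction 𝒵 (motive := fun b => LowerTruncated (Y a b))
      (hsup₂ ▸ Submodule.mem_top) (fun j b hb => ?_) ?_ fun b b' hb hb' => ?_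
    · refine ⟨⌊r - (c₁ i).re - (c₂ j).re⌋, fun n hn => ?_⟩
      refine eq_zero_of_eigenvalue hsup hd (μ := c₁ i + c₂ j + n) (fun l hl => hr l ?_) ?_
      · have h1 : (n : ℝ) + 1 ≤ r - (c₁ i).re - (c₂ j).re := Int.lt_floor_iff.1 hn
        rw [hl]
        simp only [Complex.add_re, Complex.intCast_re]
        linarith
      · have := h a b n
        rw [hd₁ i a ha, hd₂ j b hb,
          show Y (c₁ i • a) b n = c₁ i • Y a b n from congrFun ((hY.linear_left b).map_smul _ _) n,
          show Y a (c₂ j • b) n = c₂ j • Y a b n from congrFun ((hY.linear_right a).map_smul _ _) n,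
          sub_eq_iff_eq_add] at this
        rw [this, add_smul, add_smul]
        abel
    · rw [show Y a 0 = 0 from (hY.linear_right a).map_zero]
      exact hzero
    · rw [show Y a (b + b') = Y a b + Y a b' from (hY.linear_right a).map_add b b']
      exact hadd _ _ hb hb'
  · rw [show Y 0 b = 0 from (hY.linear_left b).map_zero]
    exact hzero
  · rw [show Y (a + a') b = Y a b + Y a' b from (hY.linear_left b).map_add a a']
    exact hadd _ _ ha ha'

theorem eq_of_eq_on_grading {X : Type*} [AddCommGroup X] [Module ℂ X] (hsup : ⨆ i, 𝒲 i = ⊤)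
    {f g : W →ₗ[ℂ] X} (h : ∀ i, ∀ w ∈ 𝒲 i, f w = g w) : f = g := by
  ext w
  exact Submodule.iSup_induction 𝒲 (motive := fun w => f w = g w) (hsup ▸ Submodule.mem_top) h
    (by simp) (fun x y hx hy => by rw [map_add, map_add, hx, hy])

theorem comp_mem_gradedDual {D : Module.End ℂ W} {s : ι → ι} (hs : Function.Injective s)
    (hD : ∀ i, ∀ w ∈ 𝒲 i, D w ∈ 𝒲 (s i)) {φ : Module.Dual ℂ W} (hφ : φ ∈ gradedDual 𝒲) :
    φ ∘ₗ D ∈ gradedDual 𝒲 := by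
  have : Set.Finite {i | ∃ w ∈ 𝒲 i, φ w ≠ 0} := hφ
  refine (this.preimage hs.injOn).subset ?_
  rintro i ⟨w, hw, hne⟩
  exact ⟨D w, hD i w hw, hne⟩

theorem exists_comp_pow_eq_zero {D : Module.End ℂ W} {s : ι → ι} (hsup : ⨆ i, 𝒲 i = ⊤)
    (hs : ∀ i, c (s i) = c i + 1) (hD : ∀ i, ∀ w ∈ 𝒲 i, D w ∈ 𝒲 (s i)) {r : ℝ}
    (hr : ∀ i, (c i).re < r → 𝒲 i = ⊥) {φ : Module.Dual ℂ W} (hφ : φ ∈ gradedDual 𝒲) :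
    ∃ N : ℕ, ∀ i ≥ N, φ ∘ₗ D ^ i = 0 := by
  have hfin : Set.Finite {i | ∃ w ∈ 𝒲 i, φ w ≠ 0} := hφ
  obtain ⟨B, hB⟩ := (hfin.image fun i => (c i).re).bddAbove
  -- Weights start at real part r, D raises them by one, and φ vanishes above B, so more than B - r
  -- applications of D cannot be detected.
  obtain ⟨N, hN⟩ := exists_nat_gt (B - r)
  refine ⟨N, fun j hj => eq_of_eq_on_grading hsup fun i w hw => ?_⟩
  have hpow : ∀ j : ℕ, (D ^ j) w ∈ 𝒲 (s^[j] i) ∧ c (s^[j] i) = c i + j := by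
    intro j
    induction j with
    | zero => simpa using hw
    | succ j ih =>
      rw [pow_succ', Module.End.mul_apply, Function.iterate_succ_apply', hs, ih.2]
      exact ⟨hD _ _ ih.1, by push_cast; ring⟩
  rw [LinearMap.zero_apply, LinearMap.comp_apply]
  by_contra hne
  have h1 : (c (s^[j] i)).re ≤ B := hB ⟨_, ⟨_, (hpow j).1, hne⟩, rfl⟩
  rw [(hpow j).2, Complex.add_re, Complex.natCast_re] at h1
  have h2 : (N : ℝ) ≤ j := by exact_mod_cast hj
  have h3 : w = 0 := by
    rw [hr i (by linarith)] at hw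
    exact hw
  rw [h3, map_zero, map_zero] at hne
  exact hne rfl

end gradings

/-! ### Algebras and modules as rational fields -/

section opposites

variable {V W : Type*} [AddCommGroup V] [Module ℂ V] [AddCommGroup W] [Module ℂ W]
  {A : VertexData V}

theorem VertexData.iSup_grade (A : VertexData V) : ⨆ i, A.grade i = ⊤ :=
  A.internal.submodule_iSup_eq_top

theorem VertexData.d_apply_of_mem (A : VertexData V) (i : ℤ) (v : V) (hv : v ∈ A.grade i) :
    A.d v = (i : ℂ) • v := weightOp_apply_of_mem _ _ _ hv

namespace IsMOSVA

/-- The operator `D` as a linear map. -/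
def linD (hA : IsMOSVA A) : Module.End ℂ V where
  toFun := A.D
  map_add' u v := congrFun ((hA.vertexMap.linear_left A.vac).map_add u v) 1
  map_smul' c v := congrFun ((hA.vertexMap.linear_left A.vac).map_smul c v) 1

theorem coe_linD (hA : IsMOSVA A) : ⇑hA.linD = A.D := rfl

theorem D_vac (hA : IsMOSVA A) : A.D A.vac = 0 := by
  rw [VertexData.D, hA.identity, if_neg one_ne_zero]

theorem d_vac (hA : IsMOSVA A) : A.d A.vac = 0 := by
  have := hA.d_commutator A.vac A.vac 0
  rw [hA.identity, hA.identity, if_pos rfl, if_pos rfl, sub_self, Int.cast_zero, zero_smul,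
    zero_add, hA.creation] at this
  exact this.symm

theorem d_D (hA : IsMOSVA A) (v : V) : A.d (A.D v) = A.D (A.d v) + A.D v := by
  have := hA.d_commutator v A.vac 1
  rw [hA.d_vac, show A.Y v 0 1 = 0 from congrFun (hA.vertexMap.linear_right v).map_zero 1, sub_zero,
    Int.cast_one, one_smul, add_comm] at this
  exact this

/-- Not an axiom for the algebra: it follows from [d, D] = D, read off the coefficient of x in the
d-commutator at the vacuum. -/
theorem D_mem_grade (hA : IsMOSVA A) (i : ℤ) (v : V) (hv : v ∈ A.grade i) :
    A.D v ∈ A.grade (i + 1) := by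
  refine mem_of_eigenvalue (c := fun n : ℤ => (n : ℂ)) Int.cast_injective A.iSup_grade
    A.d_apply_of_mem ?_
  rw [hA.d_D, A.d_apply_of_mem i v hv, ← hA.coe_linD, map_smul]
  push_cast
  rw [add_smul, one_smul]

theorem exists_re_lt (hA : IsMOSVA A) :
    ∃ r : ℝ, ∀ i : ℤ, ((i : ℂ)).re < r → A.grade i = ⊥ := by
  obtain ⟨N, hN⟩ := hA.lower_bound
  exact ⟨N, fun i hi => hN i (by simpa using hi)⟩

theorem lowerTruncated (hA : IsMOSVA A) (u v : V) : LowerTruncated (A.Y u v) := by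
  obtain ⟨r, hr⟩ := hA.exists_re_lt
  exact lowerTruncated_of_grading A.iSup_grade A.iSup_grade A.iSup_grade A.d_apply_of_mem
    A.d_apply_of_mem A.d_apply_of_mem hr hA.vertexMap
    (fun a b n => by rw [hA.d_commutator, add_comm]) u v

theorem isRationalField (hA : IsMOSVA A) :
    IsRationalField A.Y hA.linD {φ | φ ∈ gradedDual A.grade} where
  vertexMap := hA.vertexMap
  lowerTruncated := hA.lowerTruncated
  D_derivative := hA.D_derivative
  D_commutator := hA.D_commutator
  comp_mem _ hφ := comp_mem_gradedDual (add_left_injective 1) hA.D_mem_grade hφ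
  nilpotent _ hφ := by
    obtain ⟨r, hr⟩ := hA.exists_re_lt
    exact exists_comp_pow_eq_zero (c := fun i : ℤ => (i : ℂ)) A.iSup_grade
      (fun i => by push_cast; rfl) hA.D_mem_grade hr hφ
  product_rational := hA.product_rational
  iterate_rational := hA.iterate_rational
  associativity := hA.associativity

end IsMOSVA

theorem seqSkew_const_zero (D : Module.End ℂ W) {s : ℤ → W} {w : W}
    (hs : ∀ n, s n = if n = 0 then w else 0) : seqSkew D s 0 = w := by
  rw [seqSkew_eq_sum D (N := 0) (M := 1) (fun n hn => by rw [hs, if_neg hn.ne]) (by simp)]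
  simp [hs]

theorem seqSkew_const_one (D : Module.End ℂ W) {s : ℤ → W} {w : W}
    (hs : ∀ n, s n = if n = 0 then w else 0) : seqSkew D s 1 = D w := by
  rw [seqSkew_eq_sum D (N := 0) (M := 2) (fun n hn => by rw [hs, if_neg hn.ne]) (by simp)]
  simp [hs, Finset.sum_range_succ]

theorem seqSkew_const_of_neg (D : Module.End ℂ W) {s : ℤ → W} {w : W}
    (hs : ∀ n, s n = if n = 0 then w else 0) {n : ℤ} (hn : n < 0) : seqSkew D s n = 0 :=
  seqSkew_eq_zero D (N := 0) (fun n hn => by rw [hs, if_neg hn.ne]) hn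

namespace IsMOSVA

theorem op_Y (hA : IsMOSVA A) : A.op.Y = skew hA.linD A.Y := rfl

/-- The opposite operator sends the vacuum to e^{xD}v, whose linear coefficient is D v. -/
theorem op_D (hA : IsMOSVA A) : A.op.D = A.D := by
  ext v
  change skew hA.linD A.Y v A.vac 1 = A.D v
  rw [skew_apply, seqSkew_const_one hA.linD (hA.identity v), coe_linD]

theorem op (hA : IsMOSVA A) : IsMOSVA A.op where
  vertexMap := hA.isRationalField.isVertexMap_skew
  lower_bound := hA.lower_bound
  d_commutator u v n := by
    rw [add_comm]
    exact skew_weight (D := hA.linD) hA.d_D hA.lowerTruncated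
      (fun a b n => (hA.d_commutator a b n).trans (add_comm _ _)) u v n
  identity v n := by
    change skew hA.linD A.Y A.vac v n = _
    rw [skew_apply, seqSkew_exp hA.linD (hA.creation_regular v) (fun n => ?_), hA.creation]
    rw [hA.D_commutator, hA.D_vac, show A.Y v 0 n = 0 from
      congrFun (hA.vertexMap.linear_right v).map_zero n, sub_zero, coe_linD]
  creation_regular u n hn := by
    change skew hA.linD A.Y u A.vac n = 0
    rw [skew_apply, seqSkew_const_of_neg hA.linD (hA.identity u) hn]
  creation u := by
    change skew hA.linD A.Y u A.vac 0 = u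
    rw [skew_apply, seqSkew_const_zero hA.linD (hA.identity u)]
  D_derivative u v n := by
    rw [hA.op_D]
    exact skew_deriv hA.linD hA.lowerTruncated hA.D_commutator u v n
  D_commutator u v n := by
    rw [hA.op_D]
    exact skew_commutator hA.linD hA.lowerTruncated hA.D_derivative u v n
  product_rational n u v _ hφ := hA.isRationalField.skew_product_rational n u v hφ
  iterate_rational u₁ u₂ v _ hφ := (hA.isRationalField.exists_skew_duality hφ u₁ u₂ v).1
  associativity u₁ u₂ v _ hφ := (hA.isRationalField.exists_skew_duality hφ u₁ u₂ v).2

end IsMOSVA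

/-! ### Gluing an algebra and a module into one field on V × W -/

theorem productRational_zero (a : (Fin 0 → ℤ) → ℂ) : ProductRational a := by
  refine ⟨_, isRationalWithPoles_div (den _).one_mem (MvPolynomial.C (a 0)), fun z _ => ?_⟩
  have : a = act (MvPolynomial.C (a 0)) (unitSeries (Fin 0)) := by
    ext k
    rw [act_C, Pi.smul_apply, unitSeries_apply, if_pos (Subsingleton.elim _ _),
      Subsingleton.elim k 0]
    simp
  have h := hasLaurentSum_act_unitSeries (z := z) (fun i => i.elim0) (MvPolynomial.C (a 0))
  rw [← this] at h
  simp only [map_one, div_one]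
  exact h

theorem map_seqSkew {f : V →ₗ[ℂ] W} {D₁ : Module.End ℂ V} {D₂ : Module.End ℂ W}
    (hf : ∀ v, f (D₁ v) = D₂ (f v)) {s : ℤ → V} (hs : LowerTruncated s) (n : ℤ) :
    f (seqSkew D₁ s n) = seqSkew D₂ (fun m => f (s m)) n := by
  obtain ⟨N, hN⟩ := hs
  obtain ⟨M, hM⟩ := exists_sub_lt n N
  have hpow : ∀ (i : ℕ) v, f ((D₁ ^ i) v) = (D₂ ^ i) (f v) := by
    intro i
    induction i with
    | zero => simp
    | succ i ih =>
      intro v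
      rw [pow_succ, pow_succ, Module.End.mul_apply, Module.End.mul_apply, ih, hf]
  rw [seqSkew_eq_sum D₁ hN hM, seqSkew_eq_sum D₂ (fun m hm => by rw [hN m hm, map_zero]) hM, map_sum]
  exact Finset.sum_congr rfl fun i _ => by rw [map_smul, hpow]

/-- Two vertex operator maps with values in `V` and `W` combined into one on `V × W`. -/
def pairMap (Y : V → V → ℤ → V) (Z : V × W → V × W → ℤ → W) (p q : V × W) (n : ℤ) : V × W :=
  (Y p.1 q.1 n, Z p q n)

/-- Functionals factoring through W see only the second component, so rationality is required of the
module-valued series alone. -/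
theorem pairMap_isRationalField {Y : V → V → ℤ → V} {Z : V × W → V × W → ℤ → W}
    {D₁ : Module.End ℂ V} {D₂ : Module.End ℂ W} {Φ : Set (Module.Dual ℂ W)} (hY : IsVertexMap Y)
    (hZ : IsVertexMap Z) (hYt : ∀ u v, LowerTruncated (Y u v)) (hZt : ∀ p q, LowerTruncated (Z p q))
    (hY1 : ∀ u v (n : ℤ), ((n : ℂ) + 1) • Y u v (n + 1) = Y (D₁ u) v n)
    (hY2 : ∀ u v (n : ℤ), ((n : ℂ) + 1) • Y u v (n + 1) = D₁ (Y u v n) - Y u (D₁ v) n)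
    (hZ1 : ∀ p q (n : ℤ), ((n : ℂ) + 1) • Z p q (n + 1) = Z (D₁.prodMap D₂ p) q n)
    (hZ2 : ∀ p q (n : ℤ), ((n : ℂ) + 1) • Z p q (n + 1) = D₂ (Z p q n) - Z p (D₁.prodMap D₂ q) n)
    (hΦ : ∀ φ ∈ Φ, φ ∘ₗ D₂ ∈ Φ) (hΦ' : ∀ φ ∈ Φ, ∃ N : ℕ, ∀ i ≥ N, φ ∘ₗ D₂ ^ i = 0)
    (hprod : ∀ (n : ℕ) (u : Fin n → V × W) (v : V × W), ∀ φ ∈ Φ,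
      ProductRational fun k => φ (prodCoeff (pairMap Y Z) n u v k).2)
    (hit : ∀ p q w, ∀ φ ∈ Φ, IterateRational fun k =>
      φ (pairMap Y Z (pairMap Y Z p q (k 0)) w (k 1)).2)
    (hassoc : ∀ p q w, ∀ φ ∈ Φ, AssociativityHolds
      (fun k => φ (pairMap Y Z p (pairMap Y Z q w (k 1)) (k 0)).2)
      (fun k => φ (pairMap Y Z (pairMap Y Z p q (k 0)) w (k 1)).2)) :
    IsRationalField (pairMap Y Z) (D₁.prodMap D₂) ((fun φ => φ ∘ₗ LinearMap.snd ℂ V W) '' Φ) where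
  vertexMap :=
    { linear_left := fun q => ⟨fun p p' => funext fun n => Prod.ext
        (congrFun ((hY.linear_left q.1).map_add p.1 p'.1) n)
        (congrFun ((hZ.linear_left q).map_add p p') n), fun c p => funext fun n => Prod.ext
        (congrFun ((hY.linear_left q.1).map_smul c p.1) n)
        (congrFun ((hZ.linear_left q).map_smul c p) n)⟩
      linear_right := fun p => ⟨fun q q' => funext fun n => Prod.ext
        (congrFun ((hY.linear_right p.1).map_add q.1 q'.1) n)
        (congrFun ((hZ.linear_right p).map_add q q') n), fun c q => funext fun n => Prod.ext
        (congrFun ((hY.linear_right p.1).map_smul c q.1) n)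
        (congrFun ((hZ.linear_right p).map_smul c q) n)⟩ }
  lowerTruncated p q := by
    obtain ⟨N, hN⟩ := hYt p.1 q.1
    obtain ⟨N', hN'⟩ := hZt p q
    exact ⟨min N N', fun n hn => Prod.ext (hN n (by omega)) (hN' n (by omega))⟩
  D_derivative p q n := Prod.ext (hY1 p.1 q.1 n) (hZ1 p q n)
  D_commutator p q n := Prod.ext (hY2 p.1 q.1 n) (hZ2 p q n)
  comp_mem := by
    rintro _ ⟨φ, hφ, rfl⟩
    exact ⟨φ ∘ₗ D₂, hΦ φ hφ, rfl⟩
  nilpotent := by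
    rintro _ ⟨φ, hφ, rfl⟩
    obtain ⟨N, hN⟩ := hΦ' φ hφ
    refine ⟨N, fun i hi => ?_⟩
    have : ∀ p, ((D₁.prodMap D₂ ^ i) p).2 = (D₂ ^ i) p.2 := by
      clear hi
      induction i with
      | zero => simp
      | succ i ih =>
        intro p
        rw [pow_succ, pow_succ, Module.End.mul_apply, Module.End.mul_apply, ih]
        rfl
    refine LinearMap.ext fun p => ?_
    change φ ((D₁.prodMap D₂ ^ i) p).2 = 0
    rw [this]
    exact DFunLike.congr_fun (hN i hi) p.2
  product_rational := by
    rintro n u v _ ⟨φ, hφ, rfl⟩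
    exact hprod n u v φ hφ
  iterate_rational := by
    rintro p q w _ ⟨φ, hφ, rfl⟩
    exact hit p q w φ hφ
  associativity := by
    rintro p q w _ ⟨φ, hφ, rfl⟩
    exact hassoc p q w φ hφ

theorem skew_pairMap_fst {Y : V → V → ℤ → V} {Z : V × W → V × W → ℤ → W} {D₁ : Module.End ℂ V}
    {D₂ : Module.End ℂ W} {Φ : Set (Module.Dual ℂ (V × W))}
    (h : IsRationalField (pairMap Y Z) (D₁.prodMap D₂) Φ) (p q : V × W) (n : ℤ) :
    (skew (D₁.prodMap D₂) (pairMap Y Z) p q n).1 = skew D₁ Y p.1 q.1 n := by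
  rw [skew_apply, skew_apply]
  exact map_seqSkew (f := LinearMap.fst ℂ V W) (fun _ => rfl) (h.lowerTruncated q p) n

theorem skew_pairMap_snd {Y : V → V → ℤ → V} {Z : V × W → V × W → ℤ → W} {D₁ : Module.End ℂ V}
    {D₂ : Module.End ℂ W} {Φ : Set (Module.Dual ℂ (V × W))}
    (h : IsRationalField (pairMap Y Z) (D₁.prodMap D₂) Φ) (p q : V × W) (n : ℤ) :
    (skew (D₁.prodMap D₂) (pairMap Y Z) p q n).2 = seqSkew D₂ (Z q p) n := by
  rw [skew_apply]
  exact map_seqSkew (f := LinearMap.snd ℂ V W) (fun _ => rfl) (h.lowerTruncated q p) n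

variable {𝒲 : ℂ → Submodule ℂ W} {d D : Module.End ℂ W}

theorem commutator_of_grading (hW : DirectSum.IsInternal 𝒲) (hd : ∀ m, ∀ w ∈ 𝒲 m, d w = m • w)
    (hD : ∀ m, ∀ w ∈ 𝒲 m, D w ∈ 𝒲 (m + 1)) (w : W) : d (D w) = D (d w) + D w := by
  refine DFunLike.congr_fun (f := d ∘ₗ D) (g := D ∘ₗ d + D)
    (eq_of_eq_on_grading hW.submodule_iSup_eq_top fun m w hw => ?_) w
  rw [LinearMap.comp_apply, hd _ _ (hD m w hw), LinearMap.add_apply, LinearMap.comp_apply,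
    hd m w hw, map_smul, add_smul, one_smul]

theorem IsRightModule.lowerTruncated {YR : W → V → ℤ → W} (h : IsRightModule A 𝒲 YR d D) (w : W)
    (v : V) : LowerTruncated (YR w v) := by
  obtain ⟨r, hr⟩ := h.lower_bound
  exact lowerTruncated_of_grading h.internal.submodule_iSup_eq_top h.internal.submodule_iSup_eq_top
    A.iSup_grade h.d_grading h.d_grading A.d_apply_of_mem hr h.vertexMap h.d_commutator w v

theorem IsLeftModule.lowerTruncated {YL : V → W → ℤ → W} (h : IsLeftModule A 𝒲 YL d D) (v : V)
    (w : W) : LowerTruncated (YL v w) := by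
  obtain ⟨r, hr⟩ := h.lower_bound
  exact lowerTruncated_of_grading h.internal.submodule_iSup_eq_top A.iSup_grade
    h.internal.submodule_iSup_eq_top h.d_grading A.d_apply_of_mem h.d_grading hr h.vertexMap
    h.d_commutator v w

theorem comp_mem_and_nilpotent (hW : DirectSum.IsInternal 𝒲)
    (hD : ∀ m, ∀ w ∈ 𝒲 m, D w ∈ 𝒲 (m + 1)) (hr : ∃ r : ℝ, ∀ m : ℂ, m.re < r → 𝒲 m = ⊥)
    {φ : Module.Dual ℂ W} (hφ : φ ∈ gradedDual 𝒲) :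
    φ ∘ₗ D ∈ gradedDual 𝒲 ∧ ∃ N : ℕ, ∀ i ≥ N, φ ∘ₗ D ^ i = 0 := by
  obtain ⟨r, hr⟩ := hr
  exact ⟨comp_mem_gradedDual (add_left_injective 1) hD hφ,
    exists_comp_pow_eq_zero (c := id) hW.submodule_iSup_eq_top (fun _ => rfl) hD hr hφ⟩

theorem IsRightModule.isRationalField (hA : IsMOSVA A) {YR : W → V → ℤ → W}
    (h : IsRightModule A 𝒲 YR d D) :
    IsRationalField (pairMap A.Y fun p q => YR p.2 q.1) (hA.linD.prodMap D)
      ((fun φ => φ ∘ₗ LinearMap.snd ℂ V W) '' {φ | φ ∈ gradedDual 𝒲}) := by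
  refine pairMap_isRationalField hA.vertexMap
    ⟨fun q => ⟨fun p p' => (h.vertexMap.linear_left q.1).map_add p.2 p'.2,
      fun c p => (h.vertexMap.linear_left q.1).map_smul c p.2⟩,
      fun p => ⟨fun q q' => (h.vertexMap.linear_right p.2).map_add q.1 q'.1,
      fun c q => (h.vertexMap.linear_right p.2).map_smul c q.1⟩⟩
    hA.lowerTruncated (fun p q => h.lowerTruncated _ _) hA.D_derivative hA.D_commutator
    (fun p q n => h.D_derivative _ _ n) (fun p q n => h.D_commutator _ _ n)
    (fun φ hφ => (comp_mem_and_nilpotent h.internal h.D_weight_one h.lower_bound hφ).1)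
    (fun φ hφ => (comp_mem_and_nilpotent h.internal h.D_weight_one h.lower_bound hφ).2)
    (fun n u v φ hφ => ?_) (fun p q w φ hφ => h.iterate_rational p.2 q.1 w.1 φ hφ)
    (fun p q w φ hφ => h.associativity p.2 q.1 w.1 φ hφ)
  rcases n with _ | n
  -- The right-module axiom covers only products with at least one operator.
  · exact productRational_zero _
  · have := h.product_rational n (u 0).2 (fun i => (Fin.tail u i).1) v.1 φ hφ
    convert this using 3 with k
    rw [← prodCoeff_fst (P := pairMap A.Y fun p q : V × W => YR p.2 q.1) fun _ _ _ => rfl]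
    rfl

theorem IsLeftModule.isRationalField (hA : IsMOSVA A) {YL : V → W → ℤ → W}
    (h : IsLeftModule A 𝒲 YL d D) :
    IsRationalField (pairMap A.Y fun p q => YL p.1 q.2) (hA.linD.prodMap D)
      ((fun φ => φ ∘ₗ LinearMap.snd ℂ V W) '' {φ | φ ∈ gradedDual 𝒲}) := by
  refine pairMap_isRationalField hA.vertexMap
    ⟨fun q => ⟨fun p p' => (h.vertexMap.linear_left q.2).map_add p.1 p'.1,
      fun c p => (h.vertexMap.linear_left q.2).map_smul c p.1⟩,
      fun p => ⟨fun q q' => (h.vertexMap.linear_right p.1).map_add q.2 q'.2,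
      fun c q => (h.vertexMap.linear_right p.1).map_smul c q.2⟩⟩
    hA.lowerTruncated (fun p q => h.lowerTruncated _ _) hA.D_derivative hA.D_commutator
    (fun p q n => h.D_derivative _ _ n) (fun p q n => h.D_commutator _ _ n)
    (fun φ hφ => (comp_mem_and_nilpotent h.internal h.D_weight_one h.lower_bound hφ).1)
    (fun φ hφ => (comp_mem_and_nilpotent h.internal h.D_weight_one h.lower_bound hφ).2)
    (fun n u v φ hφ => ?_) (fun p q w φ hφ => h.iterate_rational p.1 q.1 w.2 φ hφ)
    (fun p q w φ hφ => h.associativity p.1 q.1 w.2 φ hφ)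
  have := h.product_rational n (fun i => (u i).1) v.2 φ hφ
  convert this using 3 with k
  exact prodCoeff_snd (fun _ _ _ => rfl) n u v k

/-- The opposite of a right module is a left module for the opposite algebra. -/
theorem IsRightModule.skew (hA : IsMOSVA A) {YR : W → V → ℤ → W} (h : IsRightModule A 𝒲 YR d D) :
    IsLeftModule A.op 𝒲 (skew D YR) d D := by
  have hF := h.isRationalField hA
  have hfst : ∀ p q n, (_root_.skew (hA.linD.prodMap D) (pairMap A.Y fun p q : V × W => YR p.2 q.1)
      p q n).1 = A.op.Y p.1 q.1 n := skew_pairMap_fst hF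
  have hsnd : ∀ p q n, (_root_.skew (hA.linD.prodMap D) (pairMap A.Y fun p q : V × W => YR p.2 q.1)
      p q n).2 = _root_.skew D YR p.1 q.2 n := fun p q n => by
    rw [skew_pairMap_snd hF, skew_apply]
  have hdual : ∀ φ ∈ gradedDual 𝒲, φ ∘ₗ LinearMap.snd ℂ V W ∈
      (fun φ => φ ∘ₗ LinearMap.snd ℂ V W) '' {φ | φ ∈ gradedDual 𝒲} := fun φ hφ => ⟨φ, hφ, rfl⟩
  exact
  { internal := h.internal
    vertexMap := isVertexMap_skew D h.vertexMap h.lowerTruncated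
    D_weight_one := h.D_weight_one
    lower_bound := h.lower_bound
    d_grading := h.d_grading
    d_commutator := skew_weight (commutator_of_grading h.internal h.d_grading h.D_weight_one)
      h.lowerTruncated h.d_commutator
    identity := fun w n => by
      change _root_.skew D YR A.vac w n = _
      rw [skew_apply, seqSkew_exp D (h.creation_regular w) (fun n => ?_), h.creation]
      rw [h.D_commutator, hA.D_vac, show YR w 0 n = 0 from
        congrFun (h.vertexMap.linear_right w).map_zero n, sub_zero]
    D_derivative := by
      rw [hA.op_D]
      exact skew_deriv D h.lowerTruncated h.D_commutator
    D_commutator := skew_commutator D h.lowerTruncated h.D_derivative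
    product_rational := fun n u w φ hφ => by
      -- Algebra elements enter as (u, 0) and the module vector as (0, w).
      have := hF.skew_product_rational n (fun i => (u i, 0)) (0, w) (hdual φ hφ)
      convert this using 3 with k
      exact congrArg φ (prodCoeff_snd hsnd n (fun i => (u i, 0)) (0, w) k).symm
    iterate_rational := fun u₁ u₂ w φ hφ => by
      have := (hF.exists_skew_duality (hdual φ hφ) (u₁, 0) (u₂, 0) (0, w)).1
      simpa only [LinearMap.comp_apply, LinearMap.snd_apply, hsnd, hfst] using this
    associativity := fun u₁ u₂ w φ hφ => by
      have := (hF.exists_skew_duality (hdual φ hφ) (u₁, 0) (u₂, 0) (0, w)).2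
      simpa only [LinearMap.comp_apply, LinearMap.snd_apply, hsnd, hfst] using this }

/-- The opposite of a left module for the opposite algebra is a right module. -/
theorem IsLeftModule.skew (hA : IsMOSVA A) {YL : V → W → ℤ → W}
    (h : IsLeftModule A.op 𝒲 YL d D) : IsRightModule A 𝒲 (skew D YL) d D := by
  have hF := h.isRationalField hA.op
  -- The opposite of the opposite algebra is the original one, since D is unchanged.
  have hY : _root_.skew hA.op.linD A.op.Y = A.Y := by
    rw [IsMOSVA.coe_linD, hA.op_D, hA.op_Y, ← hA.coe_linD, skew_skew hA.linD hA.lowerTruncated]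
  have hfst : ∀ p q n, (_root_.skew (hA.op.linD.prodMap D)
      (pairMap A.op.Y fun p q : V × W => YL p.1 q.2) p q n).1 = A.Y p.1 q.1 n := fun p q n => by
    rw [skew_pairMap_fst hF, hY]
  have hsnd : ∀ p q n, (_root_.skew (hA.op.linD.prodMap D)
      (pairMap A.op.Y fun p q : V × W => YL p.1 q.2) p q n).2 = _root_.skew D YL p.2 q.1 n :=
    fun p q n => by rw [skew_pairMap_snd hF, skew_apply]
  have hdual : ∀ φ ∈ gradedDual 𝒲, φ ∘ₗ LinearMap.snd ℂ V W ∈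
      (fun φ => φ ∘ₗ LinearMap.snd ℂ V W) '' {φ | φ ∈ gradedDual 𝒲} := fun φ hφ => ⟨φ, hφ, rfl⟩
  have hder := h.D_derivative
  rw [hA.op_D] at hder
  exact
  { internal := h.internal
    vertexMap := isVertexMap_skew D h.vertexMap h.lowerTruncated
    D_weight_one := h.D_weight_one
    lower_bound := h.lower_bound
    d_grading := h.d_grading
    d_commutator := skew_weight (commutator_of_grading h.internal h.d_grading h.D_weight_one)
      h.lowerTruncated h.d_commutator
    creation_regular := fun w n hn => by
      rw [skew_apply]
      exact seqSkew_const_of_neg D (h.identity w) hn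
    creation := fun w => by
      rw [skew_apply]
      exact seqSkew_const_zero D (h.identity w)
    D_derivative := skew_deriv D h.lowerTruncated h.D_commutator
    D_commutator := skew_commutator D h.lowerTruncated hder
    product_rational := fun n w u v φ hφ => by
      -- The module element is now the outermost operator, and all inner products stay in V.
      have := hF.skew_product_rational (n + 1) (Fin.cons (0, w) fun i => (u i, 0)) (v, 0)
        (hdual φ hφ)
      convert this using 2 with k
      rw [LinearMap.comp_apply, LinearMap.snd_apply, prodCoeff, hsnd, prodCoeff_fst hfst]
      simp
    iterate_rational := fun w u₁ u₂ φ hφ => by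
      have := (hF.exists_skew_duality (hdual φ hφ) (0, w) (u₁, 0) (u₂, 0)).1
      simpa only [LinearMap.comp_apply, LinearMap.snd_apply, hsnd, hfst] using this
    associativity := fun w u₁ u₂ φ hφ => by
      have := (hF.exists_skew_duality (hdual φ hφ) (0, w) (u₁, 0) (u₂, 0)).2
      simpa only [LinearMap.comp_apply, LinearMap.snd_apply, hsnd, hfst] using this }

end opposites

/-! ### Right modules as left modules over the opposite algebra -/

theorem mainTheorem5 {V W : Type*} [AddCommGroup V] [Module ℂ V] [AddCommGroup W] [Module ℂ W]
    (A : VertexData V) (hA : IsMOSVA A)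
    (𝒲 : ℂ → Submodule ℂ W) (d D : Module.End ℂ W) :
    (SkewDefined A.D A.Y ∧ IsMOSVA A.op) ∧
    (∀ YR : W → V → ℤ → W, IsRightModule A 𝒲 YR d D →
      SkewDefined D YR ∧ IsLeftModule A.op 𝒲 (skew D YR) d D ∧
        skew D (skew D YR) = YR) ∧
    (∀ YL : V → W → ℤ → W, IsLeftModule A.op 𝒲 YL d D →
      SkewDefined D YL ∧ IsRightModule A 𝒲 (skew D YL) d D ∧
        skew D (skew D YL) = YL) :=
  ⟨⟨skewDefined_of_lowerTruncated hA.linD hA.lowerTruncated, hA.op⟩,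
    fun _ h => ⟨skewDefined_of_lowerTruncated D h.lowerTruncated, h.skew hA,
      skew_skew D h.lowerTruncated⟩,
    fun _ h => ⟨skewDefined_of_lowerTruncated D h.lowerTruncated, h.skew hA,
      skew_skew D h.lowerTruncated⟩⟩
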